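/- \textbf{Model.} A TCP New Reno flow with constant round trip time $R>0$ uses a channel that alternates between ON and OFF periods, all independent. The ON durations are i.i.d. copies of a non-negative random variable $Y_{on}$. During an OFF period the channel state follows a continuous-time Markov chain on $\mathcal X_0\cup\{1\}$ ($\mathcal X_0$ finite), started in a fixed phase $i_0\in\mathcal X_0$, until it reaches the absorbing state $1$ (the ON state). The sojourn times in $i\in\mathcal X_0$ are exponential with parameter $\lambda_i\in(0,\infty)$, $\mathcal X_0$ is irreducible, and $1$ is reachable from every state of $\mathcal X_0$. Let $M=\max\{R,T_{min}\}$ and $T_{max}=2^bM$ with $b\ge 1$. Attempts (transmissions of a window) take place at times $U_0=0$, $U_{k+1}=U_k+J_k$, and $(S_k,J_k,W_k,H_k)$ denotes the channel state at $U_k$, the time to the next attempt, the window size and the slow start threshold, where $1\le W_k,H_k\le W_{max}$. Write $h(w)=\max\{1,\lfloor w/2\rfloor\}$. \begin{itemize} \item If $S_{k+1}\in\mathcal X_0$: $W_{k+1}=1$, $H_{k+1}=h(W_k)$, and $J_{k+1}=M$ if $S_k=1$, $J_{k+1}=\min\{2J_k,T_{max}\}$ if $S_k\in\mathcal X_0$.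 \item If $S_{k+1}=1$: $J_{k+1}=R$. If moreover $S_k\in\mathcal X_0$, then $W_{k+1}=1$, $H_{k+1}=H_k$. If $S_k=1$, then each of the $W_k$ packets has been lost independently with probability $p\in[0,1)$; after a loss $W_{k+1}=H_{k+1}=h(W_k)$, and otherwise $H_{k+1}=H_k$ and $W_{k+1}=\min\{W_{max},W_k+1\}$ if $W_k\ge H_k$, $W_{k+1}=\min\{W_{max},2W_k\}$ if $W_k<H_k$. \end{itemize} An initial condition consists of a value of $(S_0,J_0,W_0,H_0)$ and, if $S_0=1$, of the age $a\ge 0$ of the current ON period, with $\mathbb P(Y_{on}>a)>0$; its remaining duration then has the law of $Y_{on}-a$ given $Y_{on}>a$. Here $J_0=R$ if $S_0=1$, while $J_0\in\{M,2M,\dots,T_{max}\}$ and $W_0=1$ if $S_0\in\mathcal X_0$; and $1\le W_0,H_0\le W_{max}$. An initial law is a probability distribution of initial conditions. A distribution $\pi$ is called a stationary distribution of $\{(S_k,J_k,W_k,H_k)\}$ if, for some initial law, this process is strictly stationary with one-dimensional marginal $\pi$. \textbf{Proposition.} Suppose that for some $\epsilon_0>0$ $$\mathbb P(Y_{on}\le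 s+R\mid Y_{on}\ge s)\ge\epsilon_0\quad\text{for all } s\ge 0 \text{ with } \mathbb P(Y_{on}\ge s)>0,$$ and $0<\mathbb P(Y_{on}\le R)<1$. Start the process in the regeneration state $(i_0,2M,1,1)$ and let $N=\min\{k\ge 1:(S_k,J_k,W_k,H_k)=(i_0,2M,1,1)\}$ be the number of attempts in a regeneration cycle. Then \begin{enumerate} \item $N<\infty$ almost surely, and $\mathbb E[N^\alpha]<\infty$ for all $\alpha>0$; \item the moment generating function of $N$ is finite in a neighbourhood of $0$; \item $N$ is aperiodic: the only natural number dividing every $n$ with $\mathbb P(N=n)>0$ is $1$; \item the formula $$\pi(A)=\frac{\mathbb E\left[\sum_{k=0}^{N-1}\mathbf 1_A(S_k,J_k,W_k,H_k)\right]}{\mathbb E[N]}$$ (with $k=0$ a regeneration epoch) defines a probability distribution which is the unique stationary distribution of $\{(S_k,J_k,W_k,H_k)\}$; \item the process converges to $\pi$ exponentially in total variation: there are $C$ and $\rho\in(0,1)$ such that for every initial law and all $k\ge 0$, $\sup_A|\mathbb P((S_k,J_k,W_k,H_k)\in A)-\pi(A)|\le C\rho^k$. \end{enumerate} -/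

import Mathlib

open MeasureTheory ProbabilityTheory
open scoped ENNReal

/-- State of the ON-OFF channel: the single ON state, or OFF with a phase `x : Φ`. -/
inductive ChannelState (Φ : Type*) where
  | on : ChannelState Φ
  | off (x : Φ) : ChannelState Φ

instance (Φ : Type*) : MeasurableSpace (ChannelState Φ) := ⊤

/-- The state `(S_k, J_k, W_k, H_k)`: channel state, time to the next transmission attempt, window
size and slow start threshold. -/
abbrev TcpState (Φ : Type*) := ChannelState Φ × ℝ × ℕ × ℕ

/-- An initial condition: the state at the attempt `k = 0`, and the age of the current ON period at
that time (irrelevant when the channel is OFF). -/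
abbrev TcpStart (Φ : Type*) := TcpState Φ × ℝ

/-- The randomness driving the model. -/
structure Drive (Φ : Type*) where
  /-- remaining duration of the ON period in progress at time `0` -/
  residual : ℝ
  /-- `onDur n`: duration of the ON period that follows the `n`-th OFF period -/
  onDur : ℕ → ℝ
  /-- `clock (n, m, x)`: sojourn time after the `m`-th jump of the `n`-th OFF period, if the phase
  is then `x` -/
  clock : ℕ × ℕ × Φ → ℝ
  /-- `next (n, m, x)`: the state entered at the end of that sojourn -/
  next : ℕ × ℕ × Φ → ChannelState Φ
  /-- `lost (k, i)`: would packet `i` of the `k`-th window be lost by a random channel error? -/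
  lost : ℕ × ℕ → Bool

/-- Parameters of a TCP New Reno flow over an ON-OFF channel whose OFF periods are phase-type and
whose ON periods have a general law. -/
structure TcpModel (Φ : Type*) where
  /-- round trip time -/
  R : ℝ
  R_pos : 0 < R
  /-- minimal timeout duration -/
  Tmin : ℝ
  /-- the timeout can be doubled `b` times -/
  b : ℕ
  one_le_b : 1 ≤ b
  /-- maximal window size -/
  Wmax : ℕ
  one_le_Wmax : 1 ≤ Wmax
  /-- random loss probability of a packet sent while the channel is ON -/
  p : unitInterval
  p_lt_one : p < 1
  /-- law of an ON duration -/
  onLaw : Measure ℝ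
  onLaw_prob : IsProbabilityMeasure onLaw
  onLaw_nonneg : onLaw (Set.Iio 0) = 0
  /-- parameter of the exponential sojourn time in each OFF phase -/
  rate : Φ → ℝ
  rate_pos : ∀ x, 0 < rate x
  /-- law of the state entered when an OFF phase is left: the transition rate from `x` to `y ≠ x`
  is `rate x * jump x y` -/
  jump : Φ → PMF (ChannelState Φ)
  jump_self : ∀ x, jump x (.off x) = 0
  /-- the set of OFF phases is irreducible -/
  irreducible : ∀ x y, Relation.ReflTransGen (fun u v => jump u (.off v) ≠ 0) x y
  /-- the ON state is reachable from every OFF phase -/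
  exits : ∀ x, ∃ y, Relation.ReflTransGen (fun u v => jump u (.off v) ≠ 0) x y ∧ jump y .on ≠ 0
  /-- phase in which every OFF period starts -/
  i₀ : Φ

namespace TcpModel

variable {Φ : Type*}

noncomputable section

/-- First timeout duration. -/
def M (T : TcpModel Φ) : ℝ := max T.R T.Tmin

/-- Maximal timeout duration. -/
def Tmax (T : TcpModel Φ) : ℝ := 2 ^ T.b * T.M

/-! ### The channel -/

/-- OFF phase (or ON, once absorbed) after `m` jumps of the `n`-th OFF period. Every OFF period
starts in `i₀`, except one that is already in progress at time `0`. -/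
def phase (T : TcpModel Φ) (c : ChannelState Φ) (ω : Drive Φ) (n : ℕ) : ℕ → ChannelState Φ
  | 0 => match n, c with
    | 0, .off x => .off x
    | _, _ => .off T.i₀
  | m + 1 => match T.phase c ω n m with
    | .on => .on
    | .off x => ω.next (n, m, x)

/-- Sojourn time in OFF after `m` jumps of the `n`-th OFF period, `0` after absorption. -/
def hold (T : TcpModel Φ) (c : ChannelState Φ) (ω : Drive Φ) (n m : ℕ) : ℝ :=
  match T.phase c ω n m with
  | .on => 0
  | .off x => ω.clock (n, m, x)

/-- Time of the `m`-th jump, counted from the start of the `n`-th OFF period. -/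
def jumpTime (T : TcpModel Φ) (c : ChannelState Φ) (ω : Drive Φ) (n m : ℕ) : ℝ :=
  ∑ l ∈ Finset.range m, T.hold c ω n l

open Classical in
/-- The absorbed Markov jump process `X(s)`, `s ≥ 0`, of the `n`-th OFF period. -/
def offPath (T : TcpModel Φ) (c : ChannelState Φ) (ω : Drive Φ) (n : ℕ) (s : ℝ) :
    ChannelState Φ :=
  if ∃ m, s < T.jumpTime c ω n (m + 1) then
    T.phase c ω n (sInf {m | s < T.jumpTime c ω n (m + 1)})
  else .on

/-- Duration of the `n`-th OFF period: the time until `X` is absorbed. -/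
def offDur (T : TcpModel Φ) (c : ChannelState Φ) (ω : Drive Φ) (n : ℕ) : ℝ :=
  ∑' m, T.hold c ω n m

/-- Time at which the `n`-th OFF period starts, when the channel state at time `0` is `c`. -/
def offStart (T : TcpModel Φ) (c : ChannelState Φ) (ω : Drive Φ) : ℕ → ℝ
  | 0 => match c with
    | .on => ω.residual
    | .off _ => 0
  | n + 1 => T.offStart c ω n + T.offDur c ω n + ω.onDur n

open Classical in
/-- The channel state `S(t)`, `t ≥ 0`. -/
def channel (T : TcpModel Φ) (c : ChannelState Φ) (ω : Drive Φ) (t : ℝ) : ChannelState Φ :=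
  if t < T.offStart c ω 0 then .on
  else
    let n := sInf {n | t < T.offStart c ω (n + 1)}
    T.offPath c ω n (t - T.offStart c ω n)

/-! ### TCP -/

/-- Halving of the window, rounded down but never below one packet. -/
def half (w : ℕ) : ℕ := max 1 (w / 2)

open Classical in
/-- One step of TCP, from the state at an attempt to the state at the next one, where the channel
is found in state `s'`. `loss`: has a packet of the present window been lost by a channel error? -/
def step (T : TcpModel Φ) : TcpState Φ → ChannelState Φ → Prop → TcpState Φ
  -- timeout after a successful attempt
  | (.on, _, w, _), .off y, _ => (.off y, T.M, 1, half w)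
  -- timeout after a timeout
  | (.off _, j, w, _), .off y, _ => (.off y, min (2 * j) T.Tmax, 1, half w)
  -- successful retransmission of one packet after a timeout
  | (.off _, _, _, h), .on, _ => (.on, T.R, 1, h)
  -- channel still ON: fast retransmit, or additive increase, or slow start
  | (.on, _, w, h), .on, loss =>
    if loss then (.on, T.R, half w, half w)
    else if h ≤ w then (.on, T.R, min T.Wmax (w + 1), h)
    else (.on, T.R, min T.Wmax (2 * w), h)

/-- The time `U_k` of the `k`-th attempt and the state `(S_k, J_k, W_k, H_k)`. -/
def timeState (T : TcpModel Φ) (z : TcpStart Φ) (ω : Drive Φ) : ℕ → ℝ × TcpState Φ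
  | 0 => (0, z.1)
  | k + 1 =>
    let U := (T.timeState z ω k).1
    let X := (T.timeState z ω k).2
    (U + X.2.1, T.step X (T.channel z.1.1 ω (U + X.2.1)) (∃ i < X.2.2.1, ω.lost (k, i) = true))

/-- The process `(S_k, J_k, W_k, H_k)`. -/
def process (T : TcpModel Φ) (z : TcpStart Φ) (ω : Drive Φ) (k : ℕ) : TcpState Φ :=
  (T.timeState z ω k).2

/-! ### Laws -/

/-- Law of the remaining duration of the ON period in progress at time `0`, given its age: the law
of `Y_on - age` given `Y_on > age`. -/
def residualLaw (T : TcpModel Φ) (z : TcpStart Φ) : Measure ℝ :=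
  match z.1.1 with
  | .on => (cond T.onLaw (Set.Ioi z.2)).map (fun y => y - z.2)
  | .off _ => Measure.dirac 0

/-- `Drive` as a measurable space, through its five components. -/
def driveEquiv (Φ : Type*) :
    (ℝ × (ℕ → ℝ) × (ℕ × ℕ × Φ → ℝ) × (ℕ × ℕ × Φ → ChannelState Φ) × (ℕ × ℕ → Bool)) ≃ Drive Φ where
  toFun a := ⟨a.1, a.2.1, a.2.2.1, a.2.2.2.1, a.2.2.2.2⟩
  invFun d := (d.residual, d.onDur, d.clock, d.next, d.lost)
  left_inv _ := rfl
  right_inv _ := rfl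

instance (Φ : Type*) : MeasurableSpace (Drive Φ) :=
  MeasurableSpace.comap (driveEquiv Φ).symm inferInstance

/-- Law of the driving randomness for the initial condition `z`: all components independent. -/
def driveLaw (T : TcpModel Φ) (z : TcpStart Φ) : Measure (Drive Φ) :=
  ((T.residualLaw z).prod
    ((Measure.infinitePi fun _ : ℕ => T.onLaw).prod
      ((Measure.infinitePi fun i : ℕ × ℕ × Φ => expMeasure (T.rate i.2.2)).prod
        ((Measure.infinitePi fun i : ℕ × ℕ × Φ => (T.jump i.2.2).toMeasure).prod
          (Measure.infinitePi fun _ : ℕ × ℕ => bernoulliMeasure true false T.p))))).map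
    (driveEquiv Φ)

/-- The initial conditions that make sense in the model. -/
def Admissible (T : TcpModel Φ) (z : TcpStart Φ) : Prop :=
  (match z.1.1 with
    | .on => z.1.2.1 = T.R ∧ 0 ≤ z.2 ∧ 0 < T.onLaw (Set.Ioi z.2)
    | .off _ => (∃ i ≤ T.b, z.1.2.1 = 2 ^ i * T.M) ∧ z.1.2.2.1 = 1) ∧
  z.1.2.2.1 ∈ Set.Icc 1 T.Wmax ∧ z.1.2.2.2 ∈ Set.Icc 1 T.Wmax

/-- An initial law: a probability measure on admissible initial conditions. -/
def IsInitialLaw (T : TcpModel Φ) (ν : Measure (TcpStart Φ)) : Prop :=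
  IsProbabilityMeasure ν ∧ ∀ᵐ z ∂ν, T.Admissible z

/-- Probability that the process started at `k` attempts, `(X_k, X_{k+1}, …)`, lies in `B`, when
the initial condition has law `ν`. -/
def shiftProb (T : TcpModel Φ) (ν : Measure (TcpStart Φ)) (k : ℕ) (B : Set (ℕ → TcpState Φ)) :
    ℝ≥0∞ :=
  ∫⁻ z, T.driveLaw z {ω | (fun n => T.process z ω (k + n)) ∈ B} ∂ν

/-- Probability that `X_k` lies in `A`, when the initial condition has law `ν`. -/
def stateProb (T : TcpModel Φ) (ν : Measure (TcpStart Φ)) (k : ℕ) (A : Set (TcpState Φ)) : ℝ≥0∞ :=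
  ∫⁻ z, T.driveLaw z {ω | T.process z ω k ∈ A} ∂ν

/-- `μ` is a stationary distribution of the process `(S_k, J_k, W_k, H_k)`: for some initial law
the process is strictly stationary with one-dimensional marginal `μ`. -/
def IsStationaryDistribution (T : TcpModel Φ) (μ : Measure (TcpState Φ)) : Prop :=
  ∃ ν : Measure (TcpStart Φ), T.IsInitialLaw ν ∧
    (∀ k B, MeasurableSet B → T.shiftProb ν k B = T.shiftProb ν 0 B) ∧
    ∀ A, MeasurableSet A → T.stateProb ν 0 A = μ A

/-! ### Regeneration cycles -/

/-- The regeneration state `(i₀, 2M, 1, 1)`. -/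
def regenState (T : TcpModel Φ) : TcpState Φ := (.off T.i₀, 2 * T.M, 1, 1)

/-- The initial condition in which `k = 0` is a regeneration epoch. -/
def regenStart (T : TcpModel Φ) : TcpStart Φ := (T.regenState, 0)

/-- Length `N` of the regeneration cycle that starts at `k = 0`. -/
def cycleLength (T : TcpModel Φ) (ω : Drive Φ) : ℕ∞ :=
  ⨅ k ∈ {k : ℕ | 1 ≤ k ∧ T.process T.regenStart ω k = T.regenState}, (k : ℕ∞)

/-- Number of attempts `0 ≤ k < N` of the cycle at which the state lies in `A`. -/
def cycleVisits (T : TcpModel Φ) (A : Set (TcpState Φ)) (ω : Drive Φ) : ℝ≥0∞ :=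
  ∑' k : ℕ, Set.indicator {k : ℕ | (k : ℕ∞) < T.cycleLength ω ∧ T.process T.regenStart ω k ∈ A} 1 k

end

end TcpModel

/-!
The windows see the channel only through its states at the attempt times, and between attempts
only the age of a running ON period is remembered: OFF phases are memoryless. Hence the state
together with that age is a Markov chain, which restarts whenever the state is `regenState`,
because an OFF state carries no age. Everything then follows from a uniform lower bound on the
probability of reaching `regenState`.

*Markov property.* Decomposing a channel path at its first jump (`pathInt_eq`) turns the
expectation of a functional of the path after a fixed time `t` into a renewal equation. Its solution
is obtained by summing over the number of jumps before `t`, the sum being controlled by an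
exponential contraction (`exists_jumpKer_contraction`, `freshInt_eq_lintegral`). It shows that the
channel restarts at time `t` from its state and age (`ageInt_shift`). As the next attempt time is
determined by the current state, the law of the whole TCP sequence, `processKer`, restarts at the
next attempt (`Admissible.processKer_shift`, `isRegenerative`).

*Reaching the regeneration state.* From an ON state of any age, the ON period ends before the next
attempt with probability at least `ε₀`; if the channel then stays in `i₀` for a time `R + M`, the
next two attempts fail and leave the state `(i₀, 2M, 1, 1)` (`exists_le_processKer_on`). From an OFF
state the channel is ON at the next attempt with a probability bounded below, there being only
finitely many phases and waiting times (`exists_le_processKer_off`). Combined, `regenState` is hit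
after exactly six steps with probability at least some `ε > 0`, whatever the initial condition;
cycles of length `3` and of length `1` or `4` are possible (`exists_minorization`).

*Consequences.* The cycle length has a geometric tail (`measure_avoid_le`), which gives finiteness,
moments and exponential moments, and it is aperiodic since neither `1` nor `4` shares a factor
with `3`. The expected occupation measure of a cycle, on states with ages, is invariant
(`occupation_stationary`); normalised, it is a stationary initial law whose marginal is given by the
regenerative formula. After six steps the laws started from any two initial conditions have a
common part of mass `ε`, the process started from `regenState`, so their distance contracts by
`1 - ε` every six steps (`abs_sub_le`). This is the exponential convergence, and it forces
uniqueness of the stationary distribution.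
-/

open Set Filter
open scoped NNReal Topology

universe u

/-! ### Product measures and channel states -/

/-- Under a product measure, one coordinate and a re-indexed family of other coordinates are
independent, and the re-indexed family is again a product measure. -/
lemma measurePreserving_infinitePi_eval_comp {ι α X : Type*} [MeasurableSpace X]
    (P : ι → Measure X) [∀ i, IsProbabilityMeasure (P i)] (Q : α → Measure X)
    [∀ a, IsProbabilityMeasure (Q a)] {i₀ : ι} {e : α → ι} (he : Function.Injective e)
    (h₀ : ∀ a, e a ≠ i₀) (hQ : ∀ a, P (e a) = Q a) :
    MeasurePreserving (fun f : ι → X => (f i₀, fun a => f (e a)))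
      (Measure.infinitePi P) ((P i₀).prod (Measure.infinitePi Q)) := by
  classical
  obtain rfl : (fun a => P (e a)) = Q := funext hQ
  refine ⟨by fun_prop, ?_⟩
  set e' : Option α → ι := fun o => o.elim i₀ e with he'
  have hinj : Function.Injective e' := by
    rintro (_ | a) (_ | b) h
    · rfl
    · exact absurd h.symm (h₀ b)
    · exact absurd h (h₀ a)
    · exact congrArg some (he h)
  have hφm : Measurable fun (q : X × (α → X)) (o : Option α) => o.elim q.1 q.2 := by
    refine measurable_pi_lambda _ ?_
    rintro (_ | a)
    · exact measurable_fst
    · exact (measurable_pi_apply a).comp measurable_snd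
  have hφ : ((P i₀).prod (Measure.infinitePi fun a => P (e a))).map
      (fun (q : X × (α → X)) (o : Option α) => o.elim q.1 q.2)
      = Measure.infinitePi fun o => P (e' o) := by
    refine Measure.eq_infinitePi _ fun s t ht => ?_
    set t' : Option α → Set X := fun o => if o ∈ s then t o else Set.univ with ht'
    have ht'm : ∀ o, MeasurableSet (t' o) := by
      intro o; simp only [ht']; split_ifs; exacts [ht o, MeasurableSet.univ]
    have hset : (Set.pi (s : Set (Option α)) t)
        = Set.pi (insert none s : Finset (Option α)) t' := by
      ext f
      simp only [Set.mem_pi, Finset.mem_coe, Finset.mem_insert, ht']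
      constructor
      · intro h o _
        split_ifs with ho
        exacts [h o ho, trivial]
      · intro h o ho
        simpa [ho] using h o (Or.inr ho)
    have hprod : ∏ o ∈ s, P (e' o) (t o) = ∏ o ∈ insert none s, P (e' o) (t' o) := by
      rw [← Finset.prod_subset (Finset.subset_insert none s)]
      · exact Finset.prod_congr rfl fun o ho => by simp [ht', ho]
      · intro o _ ho
        simp [ht', ho]
    rw [hset, hprod, ← Finset.insertNone_eraseNone, Finset.prod_insertNone]
    have hpre : (fun (q : X × (α → X)) (o : Option α) => o.elim q.1 q.2) ⁻¹'
        (Set.pi (Finset.insertNone (Finset.eraseNone s) : Finset (Option α)) t')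
        = t' none ×ˢ Set.pi (Finset.eraseNone s : Finset α) (fun a => t' (some a)) := by
      ext q
      simp only [Set.mem_preimage, Set.mem_pi, Finset.mem_coe, Set.mem_prod]
      constructor
      · intro h
        exact ⟨h none (by simp), fun a ha => h (some a) (by simpa using ha)⟩
      · rintro ⟨h1, h2⟩ (_ | a) ha
        · exact h1
        · exact h2 a (by simpa using ha)
    rw [Measure.map_apply hφm (MeasurableSet.pi (Finset.countable_toSet _) fun o _ => ht'm o),
      hpre, Measure.prod_prod, Measure.infinitePi_pi _ (fun a _ => ht'm _)]
    rfl
  have h2 := Measure.map_infinitePi_infinitePi_of_inj (P := P) hinj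
  rw [← hφ] at h2
  have hψ : Measurable fun g : Option α → X => (g none, fun a => g (some a)) := by fun_prop
  have h3 := congrArg (Measure.map fun g : Option α → X => (g none, fun a => g (some a))) h2
  rw [Measure.map_map hψ (by fun_prop), Measure.map_map hψ hφm] at h3
  simpa [Function.comp_def, he'] using h3

lemma measurePreserving_prod_left_comm {α β γ : Type*} [MeasurableSpace α] [MeasurableSpace β]
    [MeasurableSpace γ] (μ : Measure α) (ν : Measure β) (τ : Measure γ) [SFinite μ] [SFinite ν]
    [SFinite τ] :
    MeasurePreserving (fun q : α × β × γ => (q.2.1, q.1, q.2.2)) (μ.prod (ν.prod τ))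
      (ν.prod (μ.prod τ)) := by
  have h1 := (measurePreserving_prodAssoc μ ν τ).symm
  have h2 := (Measure.measurePreserving_swap (μ := μ) (ν := ν)).prod (MeasurePreserving.id τ)
  have h3 := measurePreserving_prodAssoc ν μ τ
  exact (h3.comp h2).comp h1

/-- In a product of five blocks, pulling one coordinate out of the third and one out of the fourth
block preserves the product measure. -/
lemma measurePreserving_extract {α β γ δ ε γ₀ δ₀ : Type*} [MeasurableSpace α] [MeasurableSpace β]
    [MeasurableSpace γ] [MeasurableSpace δ] [MeasurableSpace ε] [MeasurableSpace γ₀]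
    [MeasurableSpace δ₀] (μ₁ : Measure α) (μ₂ : Measure β) (μ₃ : Measure γ) (μ₄ : Measure δ)
    (μ₅ : Measure ε) (ν₃ : Measure γ₀) (ν₄ : Measure δ₀) [SFinite μ₁] [SFinite μ₂] [SFinite μ₃]
    [SFinite μ₄] [SFinite μ₅] [SFinite ν₃] [SFinite ν₄] {f : γ → γ₀ × γ} {g : δ → δ₀ × δ}
    (hf : MeasurePreserving f μ₃ (ν₃.prod μ₃)) (hg : MeasurePreserving g μ₄ (ν₄.prod μ₄)) :
    MeasurePreserving
      (fun q : α × β × γ × δ × ε => ((f q.2.2.1).1, (g q.2.2.2.1).1, q.1, q.2.1, (f q.2.2.1).2,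
        (g q.2.2.2.1).2, q.2.2.2.2))
      (μ₁.prod (μ₂.prod (μ₃.prod (μ₄.prod μ₅))))
      (ν₃.prod (ν₄.prod (μ₁.prod (μ₂.prod (μ₃.prod (μ₄.prod μ₅)))))) := by
  have i1 := MeasurePreserving.id μ₁
  have i2 := MeasurePreserving.id μ₂
  have j3 := MeasurePreserving.id ν₃
  have a1 := (measurePreserving_prodAssoc ν₄ μ₄ μ₅).comp (hg.prod (MeasurePreserving.id μ₅))
  have a2 := (measurePreserving_prodAssoc ν₃ μ₃ (ν₄.prod (μ₄.prod μ₅))).comp (hf.prod a1)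
  have b1 := i1.prod (i2.prod ((j3.prod
    (measurePreserving_prod_left_comm μ₃ ν₄ (μ₄.prod μ₅))).comp a2))
  have b2 := (i1.prod (measurePreserving_prod_left_comm μ₂ ν₃ _)).comp b1
  have b3 := (measurePreserving_prod_left_comm μ₁ ν₃ _).comp b2
  have b4 := (j3.prod (i1.prod (measurePreserving_prod_left_comm μ₂ ν₄ _))).comp b3
  exact (j3.prod (measurePreserving_prod_left_comm μ₁ ν₄ _)).comp b4

namespace ChannelState

variable {Φ : Type*}

instance : DiscreteMeasurableSpace (ChannelState Φ) := ⟨fun _ => trivial⟩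

/-- A channel state is ON or one of the OFF phases. -/
def equivOption (Φ : Type*) : ChannelState Φ ≃ Option Φ where
  toFun | .on => none | .off x => some x
  invFun | none => .on | some x => .off x
  left_inv s := by cases s <;> rfl
  right_inv o := by cases o <;> rfl

instance [Finite Φ] : Finite (ChannelState Φ) := Finite.of_equiv _ (equivOption Φ).symm

end ChannelState

namespace TcpModel

variable {Φ : Type*}

attribute [instance] TcpModel.onLaw_prob

instance (T : TcpModel Φ) (x : Φ) : IsProbabilityMeasure (expMeasure (T.rate x)) :=
  isProbabilityMeasure_expMeasure (T.rate_pos x)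

lemma measurable_driveEquiv : Measurable (driveEquiv Φ) := by
  rintro _ ⟨s, hs, rfl⟩
  simpa [← Set.preimage_comp] using hs

lemma measurable_driveEquiv_symm : Measurable (driveEquiv Φ).symm :=
  comap_measurable _

lemma measurable_residual : Measurable (Drive.residual : Drive Φ → ℝ) :=
  measurable_fst.comp measurable_driveEquiv_symm
lemma measurable_onDur : Measurable (Drive.onDur : Drive Φ → ℕ → ℝ) :=
  measurable_fst.comp (measurable_snd.comp measurable_driveEquiv_symm)
lemma measurable_clock : Measurable (Drive.clock : Drive Φ → ℕ × ℕ × Φ → ℝ) :=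
  (measurable_fst.comp (measurable_snd.comp measurable_snd)).comp measurable_driveEquiv_symm
lemma measurable_next : Measurable (Drive.next : Drive Φ → ℕ × ℕ × Φ → ChannelState Φ) :=
  (measurable_fst.comp (measurable_snd.comp (measurable_snd.comp measurable_snd))).comp
    measurable_driveEquiv_symm
lemma measurable_lost : Measurable (Drive.lost : Drive Φ → ℕ × ℕ → Bool) :=
  (measurable_snd.comp (measurable_snd.comp (measurable_snd.comp measurable_snd))).comp
    measurable_driveEquiv_symm

noncomputable section

/-- Joint law of the durations of the later ON periods. -/
def onDurLaw (T : TcpModel Φ) : Measure (ℕ → ℝ) := Measure.infinitePi fun _ => T.onLaw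

/-- Joint law of the sojourn times. -/
def clockLaw (T : TcpModel Φ) : Measure (ℕ × ℕ × Φ → ℝ) :=
  Measure.infinitePi fun i => expMeasure (T.rate i.2.2)

/-- Joint law of the states entered at the jumps. -/
def nextLaw (T : TcpModel Φ) : Measure (ℕ × ℕ × Φ → ChannelState Φ) :=
  Measure.infinitePi fun i => (T.jump i.2.2).toMeasure

/-- Joint law of the losses in one window. -/
def windowLaw (T : TcpModel Φ) : Measure (ℕ → Bool) :=
  Measure.infinitePi fun _ => bernoulliMeasure true false T.p

/-- Joint law of all losses. -/
def lostLaw (T : TcpModel Φ) : Measure (ℕ × ℕ → Bool) :=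
  Measure.infinitePi fun _ => bernoulliMeasure true false T.p

instance (T : TcpModel Φ) : IsProbabilityMeasure T.onDurLaw := by unfold onDurLaw; infer_instance
instance (T : TcpModel Φ) : IsProbabilityMeasure T.clockLaw := by unfold clockLaw; infer_instance
instance (T : TcpModel Φ) : IsProbabilityMeasure T.nextLaw := by unfold nextLaw; infer_instance
instance (T : TcpModel Φ) : IsProbabilityMeasure T.windowLaw := by
  unfold windowLaw; infer_instance
instance (T : TcpModel Φ) : IsProbabilityMeasure T.lostLaw := by unfold lostLaw; infer_instance

/-- Law of the driving randomness when the remaining duration of the ON period in progress at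
time `0` has law `ρ`. -/
def driveLawOf (T : TcpModel Φ) (ρ : Measure ℝ) : Measure (Drive Φ) :=
  (ρ.prod (T.onDurLaw.prod (T.clockLaw.prod (T.nextLaw.prod T.lostLaw)))).map (driveEquiv Φ)

lemma driveLaw_eq (T : TcpModel Φ) (z : TcpStart Φ) :
    T.driveLaw z = T.driveLawOf (T.residualLaw z) := rfl

instance (T : TcpModel Φ) (ρ : Measure ℝ) [IsProbabilityMeasure ρ] :
    IsProbabilityMeasure (T.driveLawOf ρ) :=
  Measure.isProbabilityMeasure_map measurable_driveEquiv.aemeasurable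

instance (T : TcpModel Φ) (ρ : Measure ℝ) [SFinite ρ] : SFinite (T.driveLawOf ρ) := by
  unfold driveLawOf; infer_instance

/-- The drive seen after a jump from the first phase of the `0`-th OFF period to another OFF
phase. -/
def _root_.Drive.shiftOff (ω : Drive Φ) : Drive Φ where
  residual := ω.residual
  onDur := ω.onDur
  clock := fun i => ω.clock (i.1, if i.1 = 0 then i.2.1 + 1 else i.2.1, i.2.2)
  next := fun i => ω.next (i.1, if i.1 = 0 then i.2.1 + 1 else i.2.1, i.2.2)
  lost := ω.lost

/-- The drive seen from the end of the `0`-th OFF period. -/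
def _root_.Drive.shiftOn (ω : Drive Φ) : Drive Φ where
  residual := ω.onDur 0
  onDur := fun n => ω.onDur (n + 1)
  clock := fun i => ω.clock (i.1 + 1, i.2)
  next := fun i => ω.next (i.1 + 1, i.2)
  lost := ω.lost

/-- The drive whose first window of losses has been used up. -/
def _root_.Drive.shiftLost (ω : Drive Φ) : Drive Φ :=
  { ω with lost := fun i => ω.lost (i.1 + 1, i.2) }

lemma shiftOff_injective : Function.Injective
    fun i : ℕ × ℕ × Φ => (i.1, if i.1 = 0 then i.2.1 + 1 else i.2.1, i.2.2) := by
  rintro ⟨a, b, x⟩ ⟨c, d, y⟩ h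
  simp only [Prod.mk.injEq] at h
  obtain ⟨rfl, h, rfl⟩ := h
  split_ifs at h <;> simp_all

lemma shiftOn_injective : Function.Injective fun i : ℕ × ℕ × Φ => (i.1 + 1, i.2) := by
  rintro ⟨a, b, x⟩ ⟨c, d, y⟩ h
  simpa using h

lemma measurePreserving_driveEquiv (T : TcpModel Φ) (ρ : Measure ℝ) :
    MeasurePreserving (driveEquiv Φ)
      (ρ.prod (T.onDurLaw.prod (T.clockLaw.prod (T.nextLaw.prod T.lostLaw)))) (T.driveLawOf ρ) :=
  ⟨measurable_driveEquiv, rfl⟩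

lemma measurePreserving_driveEquiv_symm (T : TcpModel Φ) (ρ : Measure ℝ) :
    MeasurePreserving (driveEquiv Φ).symm (T.driveLawOf ρ)
      (ρ.prod (T.onDurLaw.prod (T.clockLaw.prod (T.nextLaw.prod T.lostLaw)))) := by
  refine ⟨measurable_driveEquiv_symm, ?_⟩
  rw [driveLawOf, Measure.map_map measurable_driveEquiv_symm measurable_driveEquiv]
  simp

lemma measurePreserving_clock (T : TcpModel Φ) (x : Φ) {e : ℕ × ℕ × Φ → ℕ × ℕ × Φ}
    (he : Function.Injective e) (h0 : ∀ i, e i ≠ (0, 0, x)) (hΦ : ∀ i, (e i).2.2 = i.2.2) :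
    MeasurePreserving (fun f : ℕ × ℕ × Φ → ℝ => (f (0, 0, x), fun i => f (e i))) T.clockLaw
      ((expMeasure (T.rate x)).prod T.clockLaw) := by
  have h := measurePreserving_infinitePi_eval_comp
    (fun i : ℕ × ℕ × Φ => expMeasure (T.rate i.2.2)) (fun i => expMeasure (T.rate i.2.2))
    he h0 (fun i => by simp only [hΦ])
  exact h

lemma measurePreserving_next (T : TcpModel Φ) (x : Φ) {e : ℕ × ℕ × Φ → ℕ × ℕ × Φ}
    (he : Function.Injective e) (h0 : ∀ i, e i ≠ (0, 0, x)) (hΦ : ∀ i, (e i).2.2 = i.2.2) :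
    MeasurePreserving (fun f : ℕ × ℕ × Φ → ChannelState Φ => (f (0, 0, x), fun i => f (e i)))
      T.nextLaw ((T.jump x).toMeasure.prod T.nextLaw) := by
  have h := measurePreserving_infinitePi_eval_comp
    (fun i : ℕ × ℕ × Φ => (T.jump i.2.2).toMeasure) (fun i => (T.jump i.2.2).toMeasure)
    he h0 (fun i => by simp only [hΦ])
  exact h

/-- The first sojourn time, the state entered after it, and the drive shifted past this jump are
independent, and the shifted drive has its original law. -/
lemma measurePreserving_shiftOff (T : TcpModel Φ) (ρ : Measure ℝ) [SFinite ρ] (x : Φ) :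
    MeasurePreserving (fun ω : Drive Φ => (ω.clock (0, 0, x), ω.next (0, 0, x), ω.shiftOff))
      (T.driveLawOf ρ)
      ((expMeasure (T.rate x)).prod ((T.jump x).toMeasure.prod (T.driveLawOf ρ))) := by
  have h0 : ∀ i : ℕ × ℕ × Φ, (i.1, if i.1 = 0 then i.2.1 + 1 else i.2.1, i.2.2) ≠ (0, 0, x) := by
    rintro ⟨a, b, y⟩ h
    simp only [Prod.mk.injEq] at h
    obtain ⟨rfl, h, rfl⟩ := h
    simp at h
  have hc := T.measurePreserving_clock x shiftOff_injective h0 (fun _ => rfl)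
  have hn := T.measurePreserving_next x shiftOff_injective h0 (fun _ => rfl)
  have h := measurePreserving_extract ρ T.onDurLaw _ _ T.lostLaw _ _ hc hn
  have : SFinite (ρ.prod (T.onDurLaw.prod (T.clockLaw.prod (T.nextLaw.prod T.lostLaw)))) :=
    inferInstance
  exact (((MeasurePreserving.id _).prod ((MeasurePreserving.id _).prod
    (T.measurePreserving_driveEquiv ρ))).comp h).comp (T.measurePreserving_driveEquiv_symm ρ)

/-- The first sojourn time, the state entered after it, and the drive seen from the end of the
first OFF period are independent. -/
lemma measurePreserving_shiftOn (T : TcpModel Φ) (ρ : Measure ℝ) [IsProbabilityMeasure ρ] (x : Φ) :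
    MeasurePreserving (fun ω : Drive Φ => (ω.clock (0, 0, x), ω.next (0, 0, x), ω.shiftOn))
      (T.driveLawOf ρ)
      ((expMeasure (T.rate x)).prod ((T.jump x).toMeasure.prod (T.driveLawOf T.onLaw))) := by
  have h0 : ∀ i : ℕ × ℕ × Φ, (i.1 + 1, i.2) ≠ (0, 0, x) := by
    rintro ⟨a, b, y⟩ h
    simp at h
  have hc := T.measurePreserving_clock x shiftOn_injective h0 (fun _ => rfl)
  have hn := T.measurePreserving_next x shiftOn_injective h0 (fun _ => rfl)
  have ho : MeasurePreserving (fun f : ℕ → ℝ => (f 0, fun n => f (n + 1))) T.onDurLaw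
      (T.onLaw.prod T.onDurLaw) :=
    measurePreserving_infinitePi_eval_comp (fun _ : ℕ => T.onLaw) (fun _ : ℕ => T.onLaw)
      (i₀ := 0) (e := fun n => n + 1) (fun a b h => by simpa using h) (by simp) (fun _ => rfl)
  have hr := (measurePreserving_prodAssoc T.onLaw T.onDurLaw _).comp
    ((ho.prod (MeasurePreserving.id (T.clockLaw.prod (T.nextLaw.prod T.lostLaw)))).comp
      (measurePreserving_snd (μ := ρ)))
  have h := measurePreserving_extract T.onLaw T.onDurLaw _ _ T.lostLaw _ _ hc hn
  exact (((MeasurePreserving.id _).prod ((MeasurePreserving.id _).prod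
    (T.measurePreserving_driveEquiv T.onLaw))).comp (h.comp hr)).comp
    (T.measurePreserving_driveEquiv_symm ρ)

/-- The losses in the first window are independent of the rest. -/
lemma measurePreserving_shiftLost (T : TcpModel Φ) (ρ : Measure ℝ) [SFinite ρ] :
    MeasurePreserving (fun ω : Drive Φ => ((fun i => ω.lost (0, i)), ω.shiftLost))
      (T.driveLawOf ρ) (T.windowLaw.prod (T.driveLawOf ρ)) := by
  have hl : MeasurePreserving (fun l : ℕ × ℕ → Bool =>
      ((fun i => l (0, i)), fun i : ℕ × ℕ => l (i.1 + 1, i.2))) T.lostLaw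
      (T.windowLaw.prod T.lostLaw) := by
    have hP : MeasurePreserving (fun g : ℕ → ℕ → Bool => (g 0, fun n => g (n + 1)))
        (Measure.infinitePi fun _ => T.windowLaw)
        (T.windowLaw.prod (Measure.infinitePi fun _ => T.windowLaw)) :=
      measurePreserving_infinitePi_eval_comp (fun _ : ℕ => T.windowLaw) (fun _ : ℕ => T.windowLaw)
        (i₀ := 0) (e := fun n => n + 1) (fun a b h => by simpa using h) (by simp) (fun _ => rfl)
    have hC : MeasurePreserving (MeasurableEquiv.curry ℕ ℕ Bool) T.lostLaw
        (Measure.infinitePi fun _ => T.windowLaw) :=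
      ⟨MeasurableEquiv.measurable _,
        Measure.infinitePi_map_curry fun _ _ : ℕ => bernoulliMeasure true false T.p⟩
    exact ((MeasurePreserving.id _).prod (hC.symm _)).comp (hP.comp hC)
  have a1 := (MeasurePreserving.id T.clockLaw).prod
    ((measurePreserving_prod_left_comm T.nextLaw T.windowLaw T.lostLaw).comp
      ((MeasurePreserving.id T.nextLaw).prod hl))
  have a2 := (MeasurePreserving.id T.onDurLaw).prod
    ((measurePreserving_prod_left_comm T.clockLaw T.windowLaw _).comp a1)
  have a3 := (MeasurePreserving.id ρ).prod
    ((measurePreserving_prod_left_comm T.onDurLaw T.windowLaw _).comp a2)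
  have a4 := (measurePreserving_prod_left_comm ρ T.windowLaw _).comp a3
  exact (((MeasurePreserving.id _).prod (T.measurePreserving_driveEquiv ρ)).comp a4).comp
    (T.measurePreserving_driveEquiv_symm ρ)

end

end TcpModel

/-! ### Measurability of the channel -/

lemma measurable_nat_sInf {A : Type*} [MeasurableSpace A] {p : A → ℕ → Prop}
    (hp : ∀ n, MeasurableSet {a | p a n}) : Measurable fun a => sInf {n | p a n} := by
  classical
  have hex : ∀ a, ∃ n, p a n ∨ ∀ m, ¬ p a m := fun a => by
    by_cases h : ∃ n, p a n
    · exact h.imp fun n hn => Or.inl hn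
    · exact ⟨0, Or.inr fun m hm => h ⟨m, hm⟩⟩
  have hm : Measurable fun a => Nat.find (hex a) := by
    refine measurable_find _ fun n => ?_
    have : {a | p a n ∨ ∀ m, ¬ p a m} = {a | p a n} ∪ ⋂ m, {a | p a m}ᶜ := by
      ext a; simp
    rw [this]
    exact (hp n).union (MeasurableSet.iInter fun m => (hp m).compl)
  convert hm using 2 with a
  by_cases h : ∃ n, p a n
  · refine le_antisymm (Nat.sInf_le ?_)
      (Nat.find_min' _ (Or.inl (Nat.sInf_mem (s := {n | p a n}) h)))
    rcases Nat.find_spec (hex a) with h' | h'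
    · exact h'
    · exact absurd h.choose_spec (h' _)
  · have h0 : {n | p a n} = ∅ := by
      ext n; simpa using fun hn => h ⟨n, hn⟩
    rw [h0, Nat.sInf_empty]
    exact ((Nat.find_eq_zero (hex a)).2 (Or.inr fun m hm => h ⟨m, hm⟩)).symm

/-- Measurability of a function that depends on a random index with countably many values. -/
lemma measurable_apply_countable {A B D : Type*} [MeasurableSpace A] [MeasurableSpace B]
    [MeasurableSpace D] [Countable D] [MeasurableSingletonClass D] {f : D → A → B} {g : A → D}
    (hf : ∀ d, Measurable (f d)) (hg : Measurable g) : Measurable fun a => f (g a) a :=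
  (measurable_from_prod_countable_right (f := fun q : D × A => f q.1 q.2) hf).comp
    (hg.prodMk measurable_id)

namespace TcpModel

variable {Φ : Type*}

section Measurability

variable [Finite Φ] (T : TcpModel Φ) (c : ChannelState Φ)

lemma measurable_phase (n m : ℕ) : Measurable fun ω : Drive Φ => T.phase c ω n m := by
  induction m with
  | zero => exact measurable_const
  | succ m ih =>
    refine measurable_apply_countable (f := fun s (ω : Drive Φ) => match s with
      | .on => ChannelState.on
      | .off x => ω.next (n, m, x)) (fun s => ?_) ih
    cases s with
    | on => exact measurable_const
    | off x => exact (measurable_pi_apply _).comp measurable_next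

lemma measurable_hold (n m : ℕ) : Measurable fun ω : Drive Φ => T.hold c ω n m := by
  refine measurable_apply_countable (f := fun s (ω : Drive Φ) => match s with
      | .on => (0 : ℝ)
      | .off x => ω.clock (n, m, x)) (fun s => ?_) (T.measurable_phase c n m)
  cases s with
  | on => exact measurable_const
  | off x => exact (measurable_pi_apply _).comp measurable_clock

lemma measurable_jumpTime (n m : ℕ) : Measurable fun ω : Drive Φ => T.jumpTime c ω n m :=
  Finset.measurable_sum _ fun l _ => T.measurable_hold c n l

lemma measurable_offDur (n : ℕ) : Measurable fun ω : Drive Φ => T.offDur c ω n :=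
  Measurable.tsum fun l => T.measurable_hold c n l

lemma measurable_offStart (n : ℕ) : Measurable fun ω : Drive Φ => T.offStart c ω n := by
  induction n with
  | zero =>
    cases c with
    | on => exact measurable_residual
    | off x => exact measurable_const
  | succ n ih =>
    exact (ih.add (T.measurable_offDur c n)).add ((measurable_pi_apply n).comp measurable_onDur)

lemma measurable_offPath (n : ℕ) : Measurable fun q : Drive Φ × ℝ => T.offPath c q.1 n q.2 := by
  have h (m : ℕ) : MeasurableSet {q : Drive Φ × ℝ | q.2 < T.jumpTime c q.1 n (m + 1)} :=
    measurableSet_lt measurable_snd ((T.measurable_jumpTime c n _).comp measurable_fst)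
  refine Measurable.ite ?_ ?_ measurable_const
  · rw [show {q : Drive Φ × ℝ | ∃ m, q.2 < T.jumpTime c q.1 n (m + 1)}
      = ⋃ m, {q : Drive Φ × ℝ | q.2 < T.jumpTime c q.1 n (m + 1)} by ext; simp]
    exact MeasurableSet.iUnion h
  · exact measurable_apply_countable
      (f := fun m (q : Drive Φ × ℝ) => T.phase c q.1 n m)
      (fun m => (T.measurable_phase c n m).comp measurable_fst) (measurable_nat_sInf h)

lemma measurable_channel : Measurable fun q : Drive Φ × ℝ => T.channel c q.1 q.2 := by
  refine Measurable.ite ?_ measurable_const ?_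
  · exact measurableSet_lt measurable_snd ((T.measurable_offStart c 0).comp measurable_fst)
  · refine measurable_apply_countable
      (f := fun n (q : Drive Φ × ℝ) => T.offPath c q.1 n (q.2 - T.offStart c q.1 n))
      (fun n => ?_) (measurable_nat_sInf fun n => ?_)
    · exact (T.measurable_offPath c n).comp (measurable_fst.prodMk
        (measurable_snd.sub ((T.measurable_offStart c n).comp measurable_fst)))
    · exact measurableSet_lt measurable_snd ((T.measurable_offStart c (n + 1)).comp measurable_fst)

end Measurability

/-! ### The channel restarts at its first jump -/

section FirstJump

variable (T : TcpModel Φ) (ω : Drive Φ) (x y : Φ)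

lemma phase_on (n m : ℕ) : T.phase .on ω n m = T.phase (.off T.i₀) ω n m := by
  induction m with
  | zero => cases n <;> rfl
  | succ m ih => simp only [phase, ih]

lemma phase_shiftOff_zero (h : ω.next (0, 0, x) = .off y) (m : ℕ) :
    T.phase (.off x) ω 0 (m + 1) = T.phase (.off y) ω.shiftOff 0 m := by
  induction m with
  | zero => simpa [phase] using h
  | succ m ih =>
    rw [phase, ih]
    conv_rhs => rw [phase]
    cases T.phase (.off y) ω.shiftOff 0 m <;> simp [Drive.shiftOff]

lemma phase_shiftOff_succ (n m : ℕ) :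
    T.phase (.off x) ω (n + 1) m = T.phase (.off y) ω.shiftOff (n + 1) m := by
  induction m with
  | zero => rfl
  | succ m ih =>
    rw [phase, ih]
    conv_rhs => rw [phase]
    cases T.phase (.off y) ω.shiftOff (n + 1) m <;> simp [Drive.shiftOff]

lemma phase_shiftOn (n m : ℕ) :
    T.phase (.off x) ω (n + 1) m = T.phase .on ω.shiftOn n m := by
  induction m with
  | zero => cases n <;> rfl
  | succ m ih =>
    rw [phase, ih]
    conv_rhs => rw [phase]
    cases T.phase .on ω.shiftOn n m <;> simp [Drive.shiftOn]

lemma phase_eq_on_of_le {c : ChannelState Φ} {n m l : ℕ} (h : T.phase c ω n m = .on)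
    (hl : m ≤ l) : T.phase c ω n l = .on := by
  induction l, hl using Nat.le_induction with
  | base => exact h
  | succ l _ ih => simp [phase, ih]

lemma hold_shiftOff_zero (h : ω.next (0, 0, x) = .off y) (m : ℕ) :
    T.hold (.off x) ω 0 (m + 1) = T.hold (.off y) ω.shiftOff 0 m := by
  rw [hold, T.phase_shiftOff_zero ω x y h, hold]
  cases T.phase (.off y) ω.shiftOff 0 m <;> simp [Drive.shiftOff]

lemma hold_shiftOff_succ (n m : ℕ) :
    T.hold (.off x) ω (n + 1) m = T.hold (.off y) ω.shiftOff (n + 1) m := by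
  rw [hold, T.phase_shiftOff_succ ω x y, hold]
  cases T.phase (.off y) ω.shiftOff (n + 1) m <;> simp [Drive.shiftOff]

lemma hold_shiftOn (n m : ℕ) :
    T.hold (.off x) ω (n + 1) m = T.hold .on ω.shiftOn n m := by
  rw [hold, T.phase_shiftOn ω x, hold]
  cases T.phase .on ω.shiftOn n m <;> simp [Drive.shiftOn]

lemma hold_on (n m : ℕ) : T.hold .on ω n m = T.hold (.off T.i₀) ω n m := by
  rw [hold, hold, phase_on]

lemma offPath_of_exists {c : ChannelState Φ} {n : ℕ} {s : ℝ}
    (h : ∃ m, s < T.jumpTime c ω n (m + 1)) :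
    T.offPath c ω n s = T.phase c ω n (sInf {m | s < T.jumpTime c ω n (m + 1)}) := if_pos h

lemma offPath_of_not_exists {c : ChannelState Φ} {n : ℕ} {s : ℝ}
    (h : ¬ ∃ m, s < T.jumpTime c ω n (m + 1)) : T.offPath c ω n s = .on := if_neg h

lemma offPath_congr {c c' : ChannelState Φ} {ω' : Drive Φ} {n n' : ℕ}
    (hp : ∀ m, T.phase c ω n m = T.phase c' ω' n' m)
    (hh : ∀ m, T.hold c ω n m = T.hold c' ω' n' m) (s : ℝ) :
    T.offPath c ω n s = T.offPath c' ω' n' s := by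
  have hj (m : ℕ) : T.jumpTime c ω n m = T.jumpTime c' ω' n' m := by simp only [jumpTime, hh]
  by_cases h : ∃ m, s < T.jumpTime c ω n (m + 1)
  · rw [T.offPath_of_exists ω h, T.offPath_of_exists ω' (by simpa only [hj] using h), hp]
    simp only [hj]
  · rw [T.offPath_of_not_exists ω h, T.offPath_of_not_exists ω' (by simpa only [hj] using h)]

lemma offDur_congr {c c' : ChannelState Φ} {ω' : Drive Φ} {n n' : ℕ}
    (hh : ∀ m, T.hold c ω n m = T.hold c' ω' n' m) : T.offDur c ω n = T.offDur c' ω' n' := by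
  simp only [offDur, hh]

lemma channel_on (t : ℝ) : T.channel .on ω t =
    if t < ω.residual then .on else T.channel (.off T.i₀) ω (t - ω.residual) := by
  have hs (n : ℕ) : T.offStart .on ω n = ω.residual + T.offStart (.off T.i₀) ω n := by
    induction n with
    | zero => simp [offStart]
    | succ n ih =>
      simp only [offStart, ih, T.offDur_congr ω (T.hold_on ω n)]
      ring
  by_cases ht : t < ω.residual
  · simp [channel, offStart, ht]
  · rw [if_neg ht, channel, if_neg (by simpa [offStart] using ht), channel,
      if_neg (by simpa [offStart] using ht)]
    have (n : ℕ) : t < ω.residual + T.offStart (.off T.i₀) ω (n + 1) ↔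
      t - ω.residual < T.offStart (.off T.i₀) ω (n + 1) := sub_lt_iff_lt_add'.symm
    simp only [hs, this]
    rw [T.offPath_congr ω (T.phase_on ω _) (T.hold_on ω _)]
    congr 1
    ring

/-- The deterministic properties of the drive that make the channel started from `c` regular: all
durations are nonnegative, the first OFF period ends, and the OFF periods do not accumulate. -/
structure _root_.Drive.Regular (ω : Drive Φ) (T : TcpModel Φ) (c : ChannelState Φ) : Prop where
  clock_pos : ∀ i, 0 < ω.clock i
  onDur_nonneg : ∀ n, 0 ≤ ω.onDur n
  absorbed : ∃ m, T.phase c ω 0 m = .on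
  offStart_unbounded : ∀ t, ∃ n, t < T.offStart c ω (n + 1)

variable {T ω} {c : ChannelState Φ}

lemma hold_nonneg (hω : ∀ i, 0 < ω.clock i) (n m : ℕ) : 0 ≤ T.hold c ω n m := by
  rw [hold]
  cases T.phase c ω n m
  · exact le_rfl
  · exact (hω _).le

lemma summable_hold_of_absorbed {n : ℕ} (h : ∃ m, T.phase c ω n m = .on) :
    Summable (T.hold c ω n) := by
  obtain ⟨m, hm⟩ := h
  refine summable_of_ne_finset_zero (s := Finset.range m) fun l hl => ?_
  rw [hold, T.phase_eq_on_of_le ω hm (by simpa using hl)]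

lemma offStart_off_zero : T.offStart (.off x) ω 0 = 0 := rfl

lemma offStart_succ (n : ℕ) :
    T.offStart c ω (n + 1) = T.offStart c ω n + T.offDur c ω n + ω.onDur n := rfl

lemma hold_zero : T.hold (.off x) ω 0 0 = ω.clock (0, 0, x) := rfl

lemma jumpTime_succ (n m : ℕ) :
    T.jumpTime c ω n (m + 1) = T.hold c ω n 0 + ∑ l ∈ Finset.range m, T.hold c ω n (l + 1) := by
  rw [jumpTime, Finset.sum_range_succ', add_comm]

lemma channel_of_lt_clock (hω : ω.Regular T (.off x)) {t : ℝ} (h0 : 0 ≤ t)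
    (ht : t < ω.clock (0, 0, x)) : T.channel (.off x) ω t = .off x := by
  have hd : ω.clock (0, 0, x) ≤ T.offDur (.off x) ω 0 :=
    (summable_hold_of_absorbed hω.absorbed).le_tsum 0 fun m _ => hold_nonneg hω.clock_pos 0 m
  have hn : sInf {n | t < T.offStart (.off x) ω (n + 1)} = 0 := by
    refine Nat.sInf_eq_zero.2 (Or.inl ?_)
    have := hω.onDur_nonneg 0
    change t < 0 + T.offDur (.off x) ω 0 + ω.onDur 0
    linarith
  rw [channel, if_neg (by simpa [offStart] using h0)]
  simp only [hn, offStart_off_zero, sub_zero]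
  have h1 : t < T.jumpTime (.off x) ω 0 (0 + 1) := by simpa [jumpTime, hold_zero] using ht
  rw [T.offPath_of_exists ω ⟨0, h1⟩,
    show sInf {m | t < T.jumpTime (.off x) ω 0 (m + 1)} = 0 from Nat.sInf_eq_zero.2 (Or.inl h1)]
  rfl

lemma sInf_succ_of_not {p : ℕ → Prop} (h0 : ¬ p 0) (h : ∃ n, p (n + 1)) :
    sInf {n | p n} = sInf {n | p (n + 1)} + 1 := by
  refine (Nat.sInf_add (n := 1) (p := p) ?_).symm
  refine le_csInf ⟨_, h.choose_spec⟩ fun n hn => Nat.one_le_iff_ne_zero.2 ?_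
  rintro rfl
  exact h0 hn

/-- After a first jump to another OFF phase `y`, the channel is the one started in `y` and driven
by the shifted drive. -/
lemma channel_shiftOff (hω : ω.Regular T (.off x)) (h : ω.next (0, 0, x) = .off y) {t : ℝ}
    (ht : ω.clock (0, 0, x) ≤ t) :
    T.channel (.off x) ω t = T.channel (.off y) ω.shiftOff (t - ω.clock (0, 0, x)) := by
  have hc := hω.clock_pos (0, 0, x)
  have hd : T.offDur (.off x) ω 0 = ω.clock (0, 0, x) + T.offDur (.off y) ω.shiftOff 0 := by
    rw [offDur, (summable_hold_of_absorbed hω.absorbed).tsum_eq_zero_add, hold_zero, offDur]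
    simp only [T.hold_shiftOff_zero ω x y h]
  have hs (n : ℕ) : T.offStart (.off x) ω (n + 1)
      = ω.clock (0, 0, x) + T.offStart (.off y) ω.shiftOff (n + 1) := by
    induction n with
    | zero =>
      simp only [offStart, hd, Drive.shiftOff]
      ring
    | succ n ih =>
      rw [offStart, ih, T.offDur_congr ω (T.hold_shiftOff_succ ω x y n),
        offStart_succ (n + 1), show ω.shiftOff.onDur = ω.onDur from rfl]
      ring
  rw [channel, if_neg (by simpa [offStart] using hc.le.trans ht), channel,
    if_neg (by simpa [offStart] using ht)]
  have (n : ℕ) : t < ω.clock (0, 0, x) + T.offStart (.off y) ω.shiftOff (n + 1) ↔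
      t - ω.clock (0, 0, x) < T.offStart (.off y) ω.shiftOff (n + 1) := sub_lt_iff_lt_add'.symm
  simp only [hs, this]
  cases sInf {n | t - ω.clock (0, 0, x) < T.offStart (.off y) ω.shiftOff (n + 1)} with
  | succ n =>
    rw [T.offPath_congr ω (T.phase_shiftOff_succ ω x y n) (T.hold_shiftOff_succ ω x y n), hs]
    congr 1
    ring
  | zero =>
    simp only [offStart_off_zero, sub_zero]
    have hj (m : ℕ) : T.jumpTime (.off x) ω 0 (m + 1)
        = ω.clock (0, 0, x) + T.jumpTime (.off y) ω.shiftOff 0 m := by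
      rw [jumpTime_succ, hold_zero, jumpTime]
      simp only [T.hold_shiftOff_zero ω x y h]
    have hj' (m : ℕ) : t < T.jumpTime (.off x) ω 0 (m + 1) ↔
        t - ω.clock (0, 0, x) < T.jumpTime (.off y) ω.shiftOff 0 m := by
      rw [hj]; exact sub_lt_iff_lt_add'.symm
    have h0 : ¬ t - ω.clock (0, 0, x) < T.jumpTime (.off y) ω.shiftOff 0 0 := by
      simpa [jumpTime] using ht
    by_cases hex : ∃ m, t - ω.clock (0, 0, x) < T.jumpTime (.off y) ω.shiftOff 0 (m + 1)
    · have hex' : ∃ m, t < T.jumpTime (.off x) ω 0 (m + 1) :=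
        ⟨_, (hj' _).2 hex.choose_spec⟩
      rw [T.offPath_of_exists _ hex, T.offPath_of_exists _ hex', ← T.phase_shiftOff_zero ω x y h]
      simp only [hj']
      rw [sInf_succ_of_not (p := fun m => t - ω.clock (0, 0, x) <
        T.jumpTime (.off y) ω.shiftOff 0 m) h0 hex]
    · rw [T.offPath_of_not_exists _ hex, T.offPath_of_not_exists]
      rintro ⟨m | m, hm⟩
      exacts [h0 ((hj' _).1 hm), hex ⟨m, (hj' _).1 hm⟩]

/-- After a first jump to ON, the channel is the one started in ON and driven by the shifted
drive. -/
lemma channel_shiftOn (hω : ω.Regular T (.off x)) (h : ω.next (0, 0, x) = .on) {t : ℝ}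
    (ht : ω.clock (0, 0, x) ≤ t) :
    T.channel (.off x) ω t = T.channel .on ω.shiftOn (t - ω.clock (0, 0, x)) := by
  have hc := hω.clock_pos (0, 0, x)
  have hp1 (m : ℕ) : T.phase (.off x) ω 0 (m + 1) = .on :=
    T.phase_eq_on_of_le ω (m := 1) (by simpa [phase] using h) (by omega)
  have hh (m : ℕ) : T.hold (.off x) ω 0 (m + 1) = 0 := by rw [hold, hp1]
  have hd : T.offDur (.off x) ω 0 = ω.clock (0, 0, x) := by
    rw [offDur, (summable_hold_of_absorbed hω.absorbed).tsum_eq_zero_add, hold_zero]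
    simp [hh]
  have hs (n : ℕ) : T.offStart (.off x) ω (n + 1)
      = ω.clock (0, 0, x) + T.offStart .on ω.shiftOn n := by
    induction n with
    | zero =>
      simp only [offStart, hd, Drive.shiftOn]
      ring
    | succ n ih =>
      rw [offStart, ih, T.offDur_congr ω (T.hold_shiftOn ω x n), offStart]
      simp only [Drive.shiftOn]
      ring
  have hiff (n : ℕ) : t < T.offStart (.off x) ω (n + 1) ↔
      t - ω.clock (0, 0, x) < T.offStart .on ω.shiftOn n := by
    rw [hs]; exact sub_lt_iff_lt_add'.symm
  rw [channel, if_neg (by simpa [offStart] using hc.le.trans ht), channel]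
  by_cases h0 : t - ω.clock (0, 0, x) < T.offStart .on ω.shiftOn 0
  · have hn : sInf {n | t < T.offStart (.off x) ω (n + 1)} = 0 :=
      Nat.sInf_eq_zero.2 (Or.inl ((hiff 0).2 h0))
    rw [if_pos h0]
    simp only [hn, offStart_off_zero, sub_zero]
    refine T.offPath_of_not_exists ω fun ⟨m, hm⟩ => ?_
    rw [jumpTime_succ, hold_zero] at hm
    simp only [hh, Finset.sum_const_zero, add_zero] at hm
    exact absurd hm (not_lt.2 ht)
  · rw [if_neg h0]
    have hex : ∃ n, t - ω.clock (0, 0, x) < T.offStart .on ω.shiftOn (n + 1) := by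
      obtain ⟨n, hn⟩ := hω.offStart_unbounded t
      rw [hiff] at hn
      cases n with
      | zero => exact absurd hn h0
      | succ n => exact ⟨n, hn⟩
    have := sInf_succ_of_not
      (p := fun n => t - ω.clock (0, 0, x) < T.offStart .on ω.shiftOn n) h0 hex
    simp only [hiff, this]
    rw [T.offPath_congr ω (T.phase_shiftOn ω x _) (T.hold_shiftOn ω x _), hs]
    congr 1
    ring

end FirstJump

end TcpModel

/-! ### Exponential laws -/

lemma expMeasure_Iic {r : ℝ} (hr : 0 < r) {t : ℝ} (ht : 0 ≤ t) :
    expMeasure r (Iic t) = ENNReal.ofReal (1 - Real.exp (-(r * t))) := by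
  have := isProbabilityMeasure_expMeasure hr
  have h := cdf_expMeasure_eq hr t
  rw [if_pos ht, cdf_eq_real] at h
  rw [← h, ofReal_measureReal]

lemma expMeasure_Ioi {r : ℝ} (hr : 0 < r) {t : ℝ} (ht : 0 ≤ t) :
    expMeasure r (Ioi t) = ENNReal.ofReal (Real.exp (-(r * t))) := by
  have := isProbabilityMeasure_expMeasure hr
  rw [← compl_Iic, prob_compl_eq_one_sub measurableSet_Iic, expMeasure_Iic hr ht,
    ← ENNReal.ofReal_one, ← ENNReal.ofReal_sub _ (by
      simpa using mul_nonneg hr.le ht)]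
  simp

lemma expMeasure_Iic_zero {r : ℝ} (hr : 0 < r) : expMeasure r (Iic 0) = 0 := by
  simp [expMeasure_Iic hr le_rfl]

/-- The exponential law has no memory. -/
lemma expMeasure_memoryless {r : ℝ} (hr : 0 < r) {t : ℝ} (ht : 0 ≤ t) :
    ((expMeasure r).restrict (Ioi t)).map (fun y => y - t)
      = expMeasure r (Ioi t) • expMeasure r := by
  have := isProbabilityMeasure_expMeasure hr
  have hm : Measurable fun y : ℝ => y - t := by fun_prop
  refine Measure.ext_of_Iic _ _ fun s => ?_
  have hset : (fun y : ℝ => y - t) ⁻¹' Iic s ∩ Ioi t = Iic (s + t) \ Iic t := by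
    ext y
    simp [and_comm]
  rw [Measure.map_apply hm measurableSet_Iic, Measure.restrict_apply (hm measurableSet_Iic), hset,
    Measure.smul_apply, smul_eq_mul]
  rcases le_or_gt 0 s with hs | hs
  · rw [measure_sdiff (Iic_subset_Iic.2 (by linarith)) measurableSet_Iic.nullMeasurableSet
      (measure_ne_top _ _), expMeasure_Iic hr (by positivity), expMeasure_Iic hr ht,
      expMeasure_Ioi hr ht, expMeasure_Iic hr hs, ← ENNReal.ofReal_mul (Real.exp_pos _).le,
      ← ENNReal.ofReal_sub _ (by simpa using mul_nonneg hr.le ht), mul_sub, ← Real.exp_add]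
    congr 1
    ring_nf
  · rw [sdiff_eq_empty.2 (Iic_subset_Iic.2 (by linarith)), measure_empty,
      measure_mono_null (Iic_subset_Iic.2 hs.le) (expMeasure_Iic_zero hr), mul_zero]

/-! ### Almost sure regularity of the channel -/

namespace TcpModel

variable {Φ : Type*} (T : TcpModel Φ) (ρ : Measure ℝ)

/-- The residual ON duration is independent of the rest of the drive. -/
lemma measurePreserving_residual [SFinite ρ] :
    MeasurePreserving (fun ω : Drive Φ => (ω.residual, { ω with residual := 0 }))
      (T.driveLawOf ρ) (ρ.prod (T.driveLawOf (Measure.dirac 0))) := by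
  have h0 : MeasurePreserving (fun b : (ℕ → ℝ) × (ℕ × ℕ × Φ → ℝ) × (ℕ × ℕ × Φ → ChannelState Φ) ×
      (ℕ × ℕ → Bool) => ((0 : ℝ), b)) (T.onDurLaw.prod (T.clockLaw.prod (T.nextLaw.prod T.lostLaw)))
      ((Measure.dirac 0).prod (T.onDurLaw.prod (T.clockLaw.prod (T.nextLaw.prod T.lostLaw)))) :=
    ⟨by fun_prop, (Measure.dirac_prod _).symm⟩
  have h1 := (MeasurePreserving.id ρ).prod ((T.measurePreserving_driveEquiv _).comp h0)
  exact h1.comp (T.measurePreserving_driveEquiv_symm ρ)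

lemma measurePreserving_clock_component [IsProbabilityMeasure ρ] :
    MeasurePreserving Drive.clock (T.driveLawOf ρ) T.clockLaw :=
  measurePreserving_fst.comp (measurePreserving_snd.comp
    (measurePreserving_snd.comp (T.measurePreserving_driveEquiv_symm ρ)))

lemma measurePreserving_onDur_component [IsProbabilityMeasure ρ] :
    MeasurePreserving Drive.onDur (T.driveLawOf ρ) T.onDurLaw :=
  measurePreserving_fst.comp (measurePreserving_snd.comp (T.measurePreserving_driveEquiv_symm ρ))

variable [IsProbabilityMeasure ρ]

lemma ae_clock_pos [Finite Φ] : ∀ᵐ ω ∂T.driveLawOf ρ, ∀ i, 0 < ω.clock i := by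
  refine ae_all_iff.2 fun i => ?_
  have h : ∀ᵐ f ∂T.clockLaw, 0 < f i := by
    have h1 : ∀ᵐ y ∂expMeasure (T.rate i.2.2), 0 < y := by
      rw [ae_iff]
      simpa [← Iic_def] using expMeasure_Iic_zero (T.rate_pos i.2.2)
    exact (measurePreserving_eval_infinitePi (fun i : ℕ × ℕ × Φ => expMeasure (T.rate i.2.2))
      i).quasiMeasurePreserving.ae h1
  exact (T.measurePreserving_clock_component ρ).quasiMeasurePreserving.ae h

lemma ae_onDur_nonneg : ∀ᵐ ω ∂T.driveLawOf ρ, ∀ n, 0 ≤ ω.onDur n := by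
  refine ae_all_iff.2 fun n => ?_
  have h : ∀ᵐ f ∂T.onDurLaw, 0 ≤ f n := by
    have h1 : ∀ᵐ y ∂T.onLaw, 0 ≤ y := by
      rw [ae_iff]
      simpa [← Iio_def] using T.onLaw_nonneg
    exact (measurePreserving_eval_infinitePi (fun _ : ℕ => T.onLaw)
      n).quasiMeasurePreserving.ae h1
  exact (T.measurePreserving_onDur_component ρ).quasiMeasurePreserving.ae h

/-- The probability never to leave the first OFF period is harmonic for the jump chain and
vanishes at the ON state, so by the maximum principle it is zero. -/
lemma ae_absorbed_zero [Finite Φ] (x : Φ) :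
    ∀ᵐ ω ∂T.driveLawOf ρ, ∃ m, T.phase (.off x) ω 0 m = .on := by
  set q : ChannelState Φ → ℝ≥0∞ := fun c =>
    T.driveLawOf ρ {ω | c ≠ .on ∧ ∀ m, T.phase c ω 0 m ≠ .on} with hq
  have hqon : q .on = 0 := by simp [hq]
  -- condition on the first jump
  have hharm (x : Φ) : q (.off x) = ∑' c, T.jump x c * q c := by
    have hpre : {ω : Drive Φ | ∀ m, T.phase (.off x) ω 0 m ≠ .on}
        = (fun ω : Drive Φ => (ω.clock (0, 0, x), ω.next (0, 0, x), ω.shiftOff)) ⁻¹'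
          {v | v.2.1 ≠ .on ∧ ∀ m, T.phase v.2.1 v.2.2 0 m ≠ .on} := by
      ext ω
      simp only [mem_preimage]
      change (∀ m, _) ↔ (_ ∧ ∀ m, _)
      cases hn : ω.next (0, 0, x) with
      | on => simpa using ⟨1, by simpa [phase] using hn⟩
      | off y =>
        simp only [← T.phase_shiftOff_zero ω x y hn, ne_eq, reduceCtorEq, not_false_eq_true,
          true_and]
        refine ⟨fun h m => h _, fun h m => ?_⟩
        cases m with
        | zero => simp [phase]
        | succ m => exact h m
    have hms : MeasurableSet {v : ℝ × ChannelState Φ × Drive Φ |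
        v.2.1 ≠ .on ∧ ∀ m, T.phase v.2.1 v.2.2 0 m ≠ .on} := by
      have : {v : ℝ × ChannelState Φ × Drive Φ |
          v.2.1 ≠ .on ∧ ∀ m, T.phase v.2.1 v.2.2 0 m ≠ .on}
          = (fun v : ℝ × ChannelState Φ × Drive Φ => v.2.1) ⁻¹' {ChannelState.on}ᶜ ∩
            ⋂ m, (fun v : ℝ × ChannelState Φ × Drive Φ => T.phase v.2.1 v.2.2 0 m) ⁻¹'
              {ChannelState.on}ᶜ := by ext; simp
      rw [this]
      refine (measurable_fst.comp measurable_snd MeasurableSet.of_discrete).inter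
        (MeasurableSet.iInter fun m => ?_)
      refine measurable_apply_countable
        (f := fun c (v : ℝ × ChannelState Φ × Drive Φ) => T.phase c v.2.2 0 m)
        (fun c => (T.measurable_phase c 0 m).comp (measurable_snd.comp measurable_snd))
        (measurable_fst.comp measurable_snd) MeasurableSet.of_discrete
    have h1 : q (.off x) = T.driveLawOf ρ {ω | ∀ m, T.phase (.off x) ω 0 m ≠ .on} := by
      simp [hq]
    rw [h1, hpre, (T.measurePreserving_shiftOff ρ x).measure_preimage hms.nullMeasurableSet,
      Measure.prod_apply hms]
    have h2 (τ : ℝ) : ((T.jump x).toMeasure.prod (T.driveLawOf ρ)) (Prod.mk τ ⁻¹'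
        {v : ℝ × ChannelState Φ × Drive Φ |
        v.2.1 ≠ .on ∧ ∀ m, T.phase v.2.1 v.2.2 0 m ≠ .on}) = ∑' c, T.jump x c * q c := by
      rw [Measure.prod_apply (measurable_prodMk_left hms), lintegral_countable']
      refine tsum_congr fun c => ?_
      rw [PMF.toMeasure_apply_singleton _ _ MeasurableSet.of_discrete, mul_comm]
      rfl
    simp only [h2, lintegral_const, measure_univ, mul_one]
  have hle (c : ChannelState Φ) : q c ≤ 1 := prob_le_one
  -- the maximum of `q` spreads along the jumps, hence reaches ON
  have : Nonempty (ChannelState Φ) := ⟨.on⟩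
  obtain ⟨c₀, hc₀⟩ := Finite.exists_max q
  have hprop {u : Φ} (hu : q (.off u) = q c₀) (c : ChannelState Φ) (hc : T.jump u c ≠ 0) :
      q c = q c₀ := by
    by_contra hne
    have hlt : q c < q c₀ := lt_of_le_of_ne (hc₀ c) hne
    have : ∑' c, T.jump u c * q c < ∑' c, T.jump u c * q c₀ := by
      refine ENNReal.tsum_lt_tsum (i := c) ?_ (fun d => by gcongr; exact hc₀ d) ?_
      · rw [← hharm]; exact ((hle _).trans_lt ENNReal.one_lt_top).ne
      · exact ENNReal.mul_lt_mul_right hc ((T.jump u).apply_ne_top c) hlt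
    rw [← hharm, ENNReal.tsum_mul_right, PMF.tsum_coe, one_mul, hu] at this
    exact lt_irrefl _ this
  have hzero : q c₀ = 0 := by
    cases hc : c₀ with
    | on => exact hqon
    | off u =>
      obtain ⟨y, hy, hyon⟩ := T.exits u
      have : q (.off y) = q c₀ := by
        clear hyon
        induction hy with
        | refl => rw [hc]
        | tail _ h ih => exact hprop ih _ h
      rw [← hc, ← hprop this .on hyon, hqon]
  have hx : q (.off x) = 0 := le_antisymm ((hc₀ _).trans hzero.le) bot_le
  rw [ae_iff]
  simpa [hq] using hx

lemma ae_absorbed [Finite Φ] (n : ℕ) (x : Φ) :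
    ∀ᵐ ω ∂T.driveLawOf ρ, ∃ m, T.phase (.off x) ω n m = .on := by
  induction n generalizing ρ x with
  | zero => exact T.ae_absorbed_zero ρ x
  | succ n ih =>
    have h := ((measurePreserving_snd.comp (measurePreserving_snd.comp
      (T.measurePreserving_shiftOn ρ x))).quasiMeasurePreserving).ae (ih T.onLaw T.i₀)
    filter_upwards [h] with ω hω
    obtain ⟨m, hm⟩ := hω
    exact ⟨m, by rw [T.phase_shiftOn ω x, T.phase_on]; exact hm⟩

/-- Infinitely many OFF periods stay in `i₀` for more than one unit of time, by the second
Borel–Cantelli lemma. -/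
lemma ae_frequently_one_lt_clock :
    ∀ᵐ ω ∂T.driveLawOf ρ, ∃ᶠ n in atTop, 1 < ω.clock (n + 1, 0, T.i₀) := by
  have h : ∀ᵐ f ∂T.clockLaw, ∃ᶠ n in atTop, 1 < f (n + 1, 0, T.i₀) := by
    set s : ℕ → Set (ℕ × ℕ × Φ → ℝ) := fun n => {f | f (n + 1, 0, T.i₀) ∈ Ioi 1} with hs
    have hsm (n : ℕ) : MeasurableSet (s n) := measurable_pi_apply _ measurableSet_Ioi
    have hμ (n : ℕ) : T.clockLaw (s n) = expMeasure (T.rate T.i₀) (Ioi 1) :=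
      (measurePreserving_eval_infinitePi (fun i : ℕ × ℕ × Φ => expMeasure (T.rate i.2.2))
        (n + 1, 0, T.i₀)).measure_preimage measurableSet_Ioi.nullMeasurableSet
    have hind : iIndepFun (fun (n : ℕ) (f : ℕ × ℕ × Φ → ℝ) => f (n + 1, 0, T.i₀)) T.clockLaw := by
      have h : iIndepFun (fun (i : ℕ × ℕ × Φ) (f : ℕ × ℕ × Φ → ℝ) => f i) T.clockLaw :=
        iIndepFun_infinitePi (P := fun i : ℕ × ℕ × Φ => expMeasure (T.rate i.2.2))
          (X := fun _ y => y) (fun _ => measurable_id)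
      exact h.precomp (g := fun n : ℕ => ((n + 1, 0, T.i₀) : ℕ × ℕ × Φ))
        (fun a b hab => by simpa using hab)
    have hset : iIndepSet s T.clockLaw :=
      (iIndepSet_iff_meas_biInter hsm).2 fun S =>
        hind.measure_inter_preimage_eq_mul S (fun _ _ => measurableSet_Ioi)
    have hpos : expMeasure (T.rate T.i₀) (Ioi 1) ≠ 0 := by
      rw [expMeasure_Ioi (T.rate_pos _) zero_le_one]
      simpa using Real.exp_pos _
    have h1 := measure_limsup_eq_one hsm hset (by
      simp only [hμ]; exact ENNReal.tsum_const_eq_top_of_ne_zero hpos)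
    have h2 : ∀ᵐ f ∂T.clockLaw, f ∈ limsup s atTop :=
      (prob_compl_eq_zero_iff (MeasurableSet.measurableSet_limsup hsm)).2 h1
    filter_upwards [h2] with f hf
    exact mem_limsup_iff_frequently_mem.1 hf
  exact (T.measurePreserving_clock_component ρ).quasiMeasurePreserving.ae h

/-- Almost surely the channel is defined for all times: the OFF periods end, and infinitely many of
them last longer than `1`, so that their starting times are unbounded. -/
lemma ae_regular [Finite Φ] (x : Φ) : ∀ᵐ ω ∂T.driveLawOf ρ, ω.Regular T (.off x) := by
  filter_upwards [T.ae_clock_pos ρ, T.ae_onDur_nonneg ρ, ae_all_iff.2 fun n => T.ae_absorbed ρ n x,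
    T.ae_frequently_one_lt_clock ρ] with ω h1 h2 h3 h4
  refine ⟨h1, h2, h3 0, fun t => ?_⟩
  by_contra! hcon
  have hstep (n : ℕ) : T.offStart (.off x) ω n + T.hold (.off x) ω n 0
      ≤ T.offStart (.off x) ω (n + 1) := by
    have hd : T.hold (.off x) ω n 0 ≤ T.offDur (.off x) ω n :=
      (summable_hold_of_absorbed (h3 n)).le_tsum 0 fun m _ => hold_nonneg h1 n m
    have := h2 n
    rw [offStart_succ]
    linarith
  have hmono : Monotone fun n => T.offStart (.off x) ω (n + 1) :=
    monotone_nat_of_le_succ fun n => by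
      have := hold_nonneg (T := T) (c := .off x) h1 (n + 1) 0
      linarith [hstep (n + 1)]
  have hlim := tendsto_atTop_ciSup hmono ⟨t, by rintro _ ⟨n, rfl⟩; exact hcon n⟩
  have hdiff := ((tendsto_add_atTop_iff_nat 1).2 hlim).sub hlim
  rw [sub_self] at hdiff
  refine h4 ?_
  filter_upwards [hdiff.eventually (gt_mem_nhds zero_lt_one)] with n hn
  have h5 : T.hold (.off x) ω (n + 1) 0 = ω.clock (n + 1, 0, T.i₀) := rfl
  have := hstep (n + 1)
  rw [h5] at this
  linarith

end TcpModel

/-! ### Path functionals and the first jump -/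

/-- A nonnegative functional of a channel path and of the losses that is measurable along every
jointly measurable family of paths. This is what is needed to integrate it over the law of the
channel, and it avoids choosing a `σ`-algebra on the space of paths. -/
def PathMeasurable {Φ : Type u} (G : (ℝ≥0 → ChannelState Φ) → (ℕ × ℕ → Bool) → ℝ≥0∞) : Prop :=
  ∀ (A : Type u) [MeasurableSpace A] (γ : A → ℝ≥0 → ChannelState Φ) (l : A → ℕ × ℕ → Bool),
    Measurable (Function.uncurry γ) → Measurable l → Measurable fun a => G (γ a) (l a)

namespace TcpModel

variable {Φ : Type u}

noncomputable section

/-- The channel as a path indexed by nonnegative times. -/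
def path (T : TcpModel Φ) (c : ChannelState Φ) (ω : Drive Φ) : ℝ≥0 → ChannelState Φ :=
  fun t => T.channel c ω t

/-- The path that stays in `c` until time `τ` and then follows `γ`. -/
def glue (c : ChannelState Φ) (τ : ℝ) (γ : ℝ≥0 → ChannelState Φ) : ℝ≥0 → ChannelState Φ :=
  fun s => if (s : ℝ) < τ then c else γ (s - τ).toNNReal

/-- Law of the sojourn time in a state, when an ON period lasts `ρ`. -/
def sojournLaw (T : TcpModel Φ) (ρ : Measure ℝ) : ChannelState Φ → Measure ℝ
  | .on => ρ
  | .off x => expMeasure (T.rate x)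

/-- Law of the state entered when a state is left. -/
def nextState (T : TcpModel Φ) : ChannelState Φ → PMF (ChannelState Φ)
  | .on => PMF.pure (.off T.i₀)
  | .off x => T.jump x

instance (T : TcpModel Φ) (ρ : Measure ℝ) [IsProbabilityMeasure ρ] (c : ChannelState Φ) :
    IsProbabilityMeasure (T.sojournLaw ρ c) := by
  cases c <;> simp only [sojournLaw] <;> infer_instance

/-- Expectation of a path functional over the channel started in `c`, when a first ON period
lasts `ρ`. -/
def pathInt (T : TcpModel Φ) (ρ : Measure ℝ) (c : ChannelState Φ)
    (G : (ℝ≥0 → ChannelState Φ) → (ℕ × ℕ → Bool) → ℝ≥0∞) : ℝ≥0∞ :=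
  ∫⁻ ω, G (T.path c ω) ω.lost ∂T.driveLawOf ρ

variable (T : TcpModel Φ) {G : (ℝ≥0 → ChannelState Φ) → (ℕ × ℕ → Bool) → ℝ≥0∞}

lemma measurable_path [Finite Φ] {A : Type*} [MeasurableSpace A] {c : A → ChannelState Φ}
    {ω : A → Drive Φ} {t : A → ℝ≥0} (hc : Measurable c) (hω : Measurable ω) (ht : Measurable t) :
    Measurable fun a => T.path (c a) (ω a) (t a) :=
  measurable_apply_countable (f := fun d a => T.path d (ω a) (t a))
    (fun d => (T.measurable_channel d).comp (hω.prodMk ht.coe_nnreal_real)) hc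

lemma _root_.PathMeasurable.comp_path [Finite Φ] (hG : PathMeasurable G) {A : Type u}
    [MeasurableSpace A] {c : A → ChannelState Φ} {ω : A → Drive Φ} (hc : Measurable c)
    (hω : Measurable ω) : Measurable fun a => G (T.path (c a) (ω a)) (ω a).lost :=
  hG A _ _ (T.measurable_path (hc.comp measurable_fst) (hω.comp measurable_fst) measurable_snd)
    (measurable_lost.comp hω)

lemma _root_.PathMeasurable.glue (hG : PathMeasurable G) (c : ChannelState Φ) (τ : ℝ) :
    PathMeasurable fun γ l => G (glue c τ γ) l := by
  intro A _ γ l hγ hl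
  refine hG A _ l (Measurable.ite ?_ measurable_const ?_) hl
  · exact measurableSet_lt measurable_snd.coe_nnreal_real measurable_const
  · exact hγ.comp (measurable_fst.prodMk
      (measurable_snd.coe_nnreal_real.sub measurable_const).real_toNNReal)

lemma _root_.PathMeasurable.shift (hG : PathMeasurable G) (t : ℝ≥0) :
    PathMeasurable fun γ l => G (fun s => γ (t + s)) l := by
  intro A _ γ l hγ hl
  refine hG A _ l ?_ hl
  exact hγ.comp (measurable_fst.prodMk (measurable_const.add measurable_snd))

lemma _root_.PathMeasurable.comp_glue [Finite Φ] (hG : PathMeasurable G) (c : ChannelState Φ) :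
    Measurable fun v : ℝ × ChannelState Φ × Drive Φ =>
      G (TcpModel.glue c v.1 (T.path v.2.1 v.2.2)) v.2.2.lost := by
  refine hG _ (fun v => TcpModel.glue c v.1 (T.path v.2.1 v.2.2)) _
    (Measurable.ite ?_ measurable_const ?_)
    (measurable_lost.comp (measurable_snd.comp measurable_snd))
  · exact measurableSet_lt measurable_snd.coe_nnreal_real (measurable_fst.comp measurable_fst)
  · exact T.measurable_path
      ((measurable_fst.comp measurable_snd).comp measurable_fst)
      ((measurable_snd.comp measurable_snd).comp measurable_fst)
      (measurable_snd.coe_nnreal_real.sub (measurable_fst.comp measurable_fst)).real_toNNReal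

lemma phase_residual (c : ChannelState Φ) (ω : Drive Φ) (r : ℝ) (n m : ℕ) :
    T.phase c { ω with residual := r } n m = T.phase c ω n m := by
  induction m with
  | zero => rfl
  | succ m ih => rw [phase, ih, phase]

/-- The residual ON duration is irrelevant to a channel that starts OFF. -/
lemma path_off_residual (x : Φ) (ω : Drive Φ) (r : ℝ) :
    T.path (.off x) { ω with residual := r } = T.path (.off x) ω := by
  have hh (n m : ℕ) : T.hold (.off x) { ω with residual := r } n m = T.hold (.off x) ω n m := by
    rw [hold, phase_residual]; rfl
  have hs (n : ℕ) : T.offStart (.off x) { ω with residual := r } n = T.offStart (.off x) ω n := by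
    induction n with
    | zero => rfl
    | succ n ih => rw [offStart_succ, ih, T.offDur_congr _ (hh n)]; rfl
  funext t
  simp only [path, channel, hs]
  split_ifs
  · rfl
  · exact T.offPath_congr _ (T.phase_residual _ _ _ _) (hh _) _

/-- A channel started in ON is the channel started in `i₀`, delayed by the residual ON duration. -/
lemma pathInt_on (ρ : Measure ℝ) [SFinite ρ] [Finite Φ] (hG : PathMeasurable G) :
    T.pathInt ρ .on G = ∫⁻ τ, T.pathInt (Measure.dirac 0) (.off T.i₀)
      (fun γ l => G (glue .on τ γ) l) ∂ρ := by
  have hpath (ω : Drive Φ) : T.path .on ω =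
      glue .on ω.residual (T.path (.off T.i₀) { ω with residual := 0 }) := by
    rw [path_off_residual]
    funext t
    simp only [path, glue, T.channel_on]
    split_ifs with h
    · rfl
    · rw [Real.coe_toNNReal _ (by simpa using h)]
  have hm := (hG.comp_glue T .on).comp (measurable_fst.prodMk
    (measurable_const (a := ChannelState.off T.i₀) |>.prodMk measurable_snd) :
      Measurable fun q : ℝ × Drive Φ => (q.1, ChannelState.off T.i₀, q.2))
  have h1 := (T.measurePreserving_residual ρ).lintegral_comp hm
  simp only [Function.comp_def] at h1
  rw [pathInt]
  simp only [hpath]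
  rw [h1]
  exact lintegral_prod _ hm.aemeasurable

lemma pathInt_off_residual (ρ ρ' : Measure ℝ) [IsProbabilityMeasure ρ] [IsProbabilityMeasure ρ']
    [Finite Φ] (hG : PathMeasurable G) (x : Φ) :
    T.pathInt ρ (.off x) G = T.pathInt ρ' (.off x) G := by
  have key (ρ : Measure ℝ) [IsProbabilityMeasure ρ] :
      T.pathInt ρ (.off x) G = T.pathInt (Measure.dirac 0) (.off x) G := by
    have hm := hG.comp_path T (A := Drive Φ) (measurable_const (a := ChannelState.off x))
      measurable_id
    have h1 := (measurePreserving_snd.comp (T.measurePreserving_residual ρ)).lintegral_comp hm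
    simp only [Function.comp_def, id, path_off_residual] at h1
    exact h1
  rw [key ρ, key ρ']

/-- First-jump decomposition of the law of the channel. -/
lemma pathInt_eq (ρ : Measure ℝ) [IsProbabilityMeasure ρ] [Finite Φ] (hG : PathMeasurable G)
    (c : ChannelState Φ) :
    T.pathInt ρ c G = ∫⁻ τ, ∫⁻ c', T.pathInt T.onLaw c' (fun γ l => G (glue c τ γ) l)
      ∂(T.nextState c).toMeasure ∂T.sojournLaw ρ c := by
  cases c with
  | on =>
    rw [pathInt_on T ρ hG]
    refine lintegral_congr fun τ => ?_
    rw [nextState, PMF.toMeasure_pure, lintegral_dirac,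
      T.pathInt_off_residual _ T.onLaw (hG.glue _ _)]
  | off x =>
    rw [T.pathInt_off_residual ρ T.onLaw hG]
    set F : ℝ × ChannelState Φ × Drive Φ → ℝ≥0∞ := fun v =>
      G (glue (.off x) v.1 (T.path v.2.1 v.2.2)) v.2.2.lost with hF
    have hFm : Measurable F := hG.comp_glue T _
    set S : Set (ℝ × ChannelState Φ × Drive Φ) := {v | v.2.1 = .on} with hS
    have hSm : MeasurableSet S := (measurable_fst.comp measurable_snd)
      (MeasurableSet.of_discrete (s := {ChannelState.on}))
    have hae : ∀ᵐ ω ∂T.driveLawOf T.onLaw, G (T.path (.off x) ω) ω.lost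
        = S.indicator F (ω.clock (0, 0, x), ω.next (0, 0, x), ω.shiftOn)
          + Sᶜ.indicator F (ω.clock (0, 0, x), ω.next (0, 0, x), ω.shiftOff) := by
      filter_upwards [T.ae_regular T.onLaw x] with ω hω
      have hlt (t : ℝ≥0) (h : (t : ℝ) < ω.clock (0, 0, x)) :
          T.channel (.off x) ω t = .off x := channel_of_lt_clock x hω t.2 h
      cases hn : ω.next (0, 0, x) with
      | on =>
        rw [indicator_of_mem (by simp [hS]), indicator_of_notMem (by simp [hS]), add_zero]
        simp only [hF]
        congr 1
        funext t
        simp only [path, glue]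
        split_ifs with h
        · exact hlt t h
        · rw [Real.coe_toNNReal _ (by simpa using h), channel_shiftOn x hω hn (by simpa using h)]
      | off y =>
        rw [indicator_of_notMem (by simp [hS]), indicator_of_mem (by simp [hS]), zero_add]
        simp only [hF]
        congr 1
        funext t
        simp only [path, glue]
        split_ifs with h
        · exact hlt t h
        · rw [Real.coe_toNNReal _ (by simpa using h), channel_shiftOff x y hω hn (by simpa using h)]
    have hOn := (T.measurePreserving_shiftOn T.onLaw x)
    have hOff := (T.measurePreserving_shiftOff T.onLaw x)
    have hmOn : Measurable fun ω : Drive Φ =>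
        S.indicator F (ω.clock (0, 0, x), ω.next (0, 0, x), ω.shiftOn) :=
      (hFm.indicator hSm).comp hOn.measurable
    rw [pathInt, lintegral_congr_ae hae, lintegral_add_left hmOn,
      hOn.lintegral_comp (hFm.indicator hSm),
      hOff.lintegral_comp (hFm.indicator hSm.compl), ← lintegral_add_left (hFm.indicator hSm)]
    simp only [indicator_self_add_compl_apply]
    rw [lintegral_prod _ hFm.aemeasurable]
    refine lintegral_congr fun τ => ?_
    exact lintegral_prod _ (hFm.comp measurable_prodMk_left).aemeasurable

end

end TcpModel

/-! ### The Markov property of the channel at a fixed time -/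

/-- Law of `Y - a` on the event `Y > a`, not normalised, when `Y` has law `μ`. -/
noncomputable def tailShift (μ : Measure ℝ) (a : ℝ) : Measure ℝ :=
  (μ.restrict (Ioi a)).map fun y => y - a

lemma tailShift_apply (μ : Measure ℝ) (a : ℝ) {s : Set ℝ} (hs : MeasurableSet s) :
    tailShift μ a s = μ {y | y - a ∈ s ∧ a < y} := by
  have hm : Measurable fun y : ℝ => y - a := by fun_prop
  rw [tailShift, Measure.map_apply hm hs, Measure.restrict_apply (hm hs)]
  rfl

lemma tailShift_tailShift (μ : Measure ℝ) (a : ℝ) {t : ℝ} (ht : 0 ≤ t) :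
    tailShift (tailShift μ a) t = tailShift μ (a + t) := by
  ext s hs
  have hm : Measurable fun y : ℝ => y - t := by fun_prop
  rw [tailShift_apply _ _ hs, tailShift_apply _ _ hs,
    show {y : ℝ | y - t ∈ s ∧ t < y} = (fun y => y - t) ⁻¹' s ∩ Ioi t from rfl,
    tailShift_apply _ _ ((hm hs).inter measurableSet_Ioi)]
  congr 1
  ext y
  constructor
  · rintro ⟨⟨h1, h2⟩, h3⟩
    have h2 : t < y - a := h2
    exact ⟨by rw [← sub_sub]; exact h1, by linarith⟩
  · rintro ⟨h1, h2⟩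
    refine ⟨⟨?_, ?_⟩, by linarith⟩
    · rw [← sub_sub] at h1; exact h1
    · change t < y - a
      linarith

lemma tailShift_smul (μ : Measure ℝ) (k : ℝ≥0∞) (a : ℝ) :
    tailShift (k • μ) a = k • tailShift μ a := by
  rw [tailShift, Measure.restrict_smul, Measure.map_smul, tailShift]

lemma tailShift_univ (μ : Measure ℝ) (a : ℝ) : tailShift μ a univ = μ (Ioi a) := by
  rw [tailShift_apply _ _ MeasurableSet.univ]
  simp [Ioi_def]

namespace TcpModel

variable {Φ : Type u}

noncomputable section

/-- Law of the residual ON duration in state `c` at age `a`. -/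
def ageLaw (T : TcpModel Φ) (q : ChannelState Φ × ℝ) : Measure ℝ :=
  match q.1 with
  | .on => (cond T.onLaw (Set.Ioi q.2)).map (fun y => y - q.2)
  | .off _ => Measure.dirac 0

lemma residualLaw_eq (T : TcpModel Φ) (z : TcpStart Φ) :
    T.residualLaw z = T.ageLaw (z.1.1, z.2) := rfl

variable (T : TcpModel Φ) {G : (ℝ≥0 → ChannelState Φ) → (ℕ × ℕ → Bool) → ℝ≥0∞}

lemma ageLaw_on (a : ℝ) : T.ageLaw (.on, a) = (T.onLaw (Ioi a))⁻¹ • tailShift T.onLaw a := by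
  simp [ageLaw, ProbabilityTheory.cond, tailShift, Measure.map_smul]

lemma isProbabilityMeasure_ageLaw {q : ChannelState Φ × ℝ}
    (hq : q.1 = .on → 0 < T.onLaw (Ioi q.2)) :
    IsProbabilityMeasure (T.ageLaw q) := by
  obtain ⟨_ | x, a⟩ := q
  · have := cond_isProbabilityMeasure (μ := T.onLaw) (hq rfl).ne'
    exact Measure.isProbabilityMeasure_map (by fun_prop)
  · simp only [ageLaw]; infer_instance

/-- Expectation of a path functional over the channel started in state `q.1` at age `q.2`. -/
def ageInt (q : ChannelState Φ × ℝ)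
    (G : (ℝ≥0 → ChannelState Φ) → (ℕ × ℕ → Bool) → ℝ≥0∞) : ℝ≥0∞ :=
  T.pathInt (T.ageLaw q) q.1 G

lemma tailShift_onLaw (t : ℝ) :
    tailShift T.onLaw t = T.onLaw (Ioi t) • T.ageLaw (.on, t) := by
  rw [ageLaw_on, smul_smul]
  by_cases h : T.onLaw (Ioi t) = 0
  · rw [h, zero_mul, zero_smul, ← Measure.measure_univ_eq_zero, tailShift_univ, h]
  · rw [ENNReal.mul_inv_cancel h (measure_ne_top _ _), one_smul]

lemma tailShift_ageLaw (a : ℝ) {t : ℝ} (ht : 0 ≤ t) :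
    tailShift (T.ageLaw (.on, a)) t = T.ageLaw (.on, a) (Ioi t) • T.ageLaw (.on, a + t) := by
  rw [ageLaw_on, tailShift_smul, tailShift_tailShift _ _ ht, tailShift_onLaw, smul_smul,
    Measure.smul_apply, smul_eq_mul]
  congr 2
  rw [← tailShift_univ, ← tailShift_univ, tailShift_tailShift _ _ ht]

lemma glue_of_lt (c : ChannelState Φ) {τ : ℝ} {s : ℝ≥0} (h : (s : ℝ) < τ)
    (γ : ℝ≥0 → ChannelState Φ) : glue c τ γ s = c := if_pos h

lemma glue_of_le (c : ChannelState Φ) {τ : ℝ} {s : ℝ≥0} (h : τ ≤ s)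
    (γ : ℝ≥0 → ChannelState Φ) : glue c τ γ s = γ (s - τ).toNNReal := if_neg (not_lt.2 h)

lemma shift_glue (c : ChannelState Φ) {τ : ℝ} {t : ℝ≥0} (γ : ℝ≥0 → ChannelState Φ) :
    (fun s => glue c τ γ (t + s)) = glue c (τ - t) γ := by
  funext s
  rcases lt_or_ge ((t + s : ℝ≥0) : ℝ) τ with h | h
  · rw [glue_of_lt c h, glue_of_lt c (by rw [NNReal.coe_add] at h; linarith)]
  · rw [glue_of_le c h, glue_of_le c (by rw [NNReal.coe_add] at h; linarith), NNReal.coe_add]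
    congr 2
    ring

lemma shift_glue_of_le (c : ChannelState Φ) {τ : ℝ} {t : ℝ≥0} (h : τ ≤ t)
    (γ : ℝ≥0 → ChannelState Φ) :
    (fun s => glue c τ γ (t + s)) = fun s => γ ((t - τ).toNNReal + s) := by
  funext s
  have hs : τ ≤ ((t + s : ℝ≥0) : ℝ) := h.trans (by simp)
  rw [glue_of_le c hs]
  congr 1
  rw [← NNReal.coe_inj, Real.coe_toNNReal _ (by linarith), NNReal.coe_add, NNReal.coe_add,
    Real.coe_toNNReal _ (by linarith)]
  ring

section FixedTime

variable [Finite Φ]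

lemma measurable_glueInt (hG : PathMeasurable G) (c : ChannelState Φ) :
    Measurable fun q : ℝ × ChannelState Φ =>
      T.pathInt T.onLaw q.2 fun γ l => G (glue c q.1 γ) l := by
  have h := (hG.comp_glue T c).comp
    (MeasurableEquiv.prodAssoc (α := ℝ) (β := ChannelState Φ) (γ := Drive Φ)).measurable
  exact h.lintegral_prod_right'

/-- The law of the channel seen from time `t`: either the first sojourn is not over, or the channel
starts afresh at its first jump. -/
lemma pathInt_shift (hG : PathMeasurable G) (ρ : Measure ℝ) [IsProbabilityMeasure ρ]
    (c : ChannelState Φ) (t : ℝ≥0) {a : ℝ}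
    (ha : c = .on → tailShift ρ t = ρ (Ioi t) • T.ageLaw (.on, a)) :
    T.pathInt ρ c (fun γ l => G (fun s => γ (t + s)) l)
      = T.sojournLaw ρ c (Ioi t) * T.ageInt (c, a) G
        + ∫⁻ τ in Iic (t : ℝ), ∫⁻ c', T.pathInt T.onLaw c'
          (fun γ l => G (fun s => γ ((t - τ).toNNReal + s)) l)
          ∂(T.nextState c).toMeasure ∂T.sojournLaw ρ c := by
  rw [T.pathInt_eq ρ (hG.shift t), ← lintegral_add_compl _ (measurableSet_Ioi (a := (t : ℝ))),
    compl_Ioi]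
  congr 1
  · set g : ℝ → ℝ≥0∞ := fun τ => ∫⁻ c', T.pathInt T.onLaw c' (fun γ l => G (glue c τ γ) l)
      ∂(T.nextState c).toMeasure with hg
    have hgm : Measurable g := (T.measurable_glueInt hG c).lintegral_prod_right'
    have h1 : ∫⁻ τ in Ioi (t : ℝ), ∫⁻ c', T.pathInt T.onLaw c'
        (fun γ l => G (fun s => glue c τ γ (t + s)) l)
        ∂(T.nextState c).toMeasure ∂T.sojournLaw ρ c
        = ∫⁻ τ, g τ ∂tailShift (T.sojournLaw ρ c) t := by
      rw [tailShift, lintegral_map hgm (by fun_prop)]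
      refine setLIntegral_congr_fun measurableSet_Ioi fun τ hτ => ?_
      simp only [shift_glue c, hg]
    rw [h1]
    cases c with
    | on =>
      have h2 : g = fun τ => T.pathInt (Measure.dirac 0) (.off T.i₀)
          (fun γ l => G (glue .on τ γ) l) := by
        funext τ
        simp only [hg, nextState, PMF.toMeasure_pure, lintegral_dirac]
        exact T.pathInt_off_residual _ _ (hG.glue _ _) _
      have : SFinite (T.ageLaw (.on, a)) := by
        rw [ageLaw_on]; unfold tailShift; infer_instance
      rw [sojournLaw, ha rfl, lintegral_smul_measure, smul_eq_mul, h2, ageInt, pathInt_on T _ hG]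
    | off x =>
      have : IsProbabilityMeasure (T.ageLaw (.off x, a)) :=
        T.isProbabilityMeasure_ageLaw (by simp)
      rw [sojournLaw, tailShift, expMeasure_memoryless (T.rate_pos x) t.coe_nonneg,
        lintegral_smul_measure, smul_eq_mul, ageInt, T.pathInt_eq _ hG]
      rfl
  · refine setLIntegral_congr_fun measurableSet_Iic fun τ hτ => ?_
    simp only [shift_glue_of_le c hτ]

end FixedTime

end

end TcpModel

/-! ### Transition kernel of the channel with its age -/

namespace TcpModel

variable {Φ : Type u}

noncomputable section

section StayLeave

variable {I B : Type*} [MeasurableSpace I] [MeasurableSpace B]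

/-- The part of the transition kernel for which the first sojourn outlasts the remaining time `t`;
`κ` is the joint law of the first sojourn time and the next state. -/
def stayKer (κ : Kernel I (ℝ × ChannelState Φ)) (g : I × ℝ≥0 → B) : Kernel (I × ℝ≥0) B :=
  ((Kernel.id ×ₖ (κ.comap Prod.fst measurable_fst)).restrict
    (s := {v : (I × ℝ≥0) × ℝ × ChannelState Φ | (v.1.2 : ℝ) < v.2.1})
    (measurableSet_lt (measurable_snd.comp measurable_fst).coe_nnreal_real
      (measurable_fst.comp measurable_snd))).map fun v => g v.1

/-- The state entered at the first jump and the time then remaining, if that jump happens within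
the remaining time `t`. -/
def leaveKer (κ : Kernel I (ℝ × ChannelState Φ)) : Kernel (I × ℝ≥0) (ChannelState Φ × ℝ≥0) :=
  ((Kernel.id ×ₖ (κ.comap Prod.fst measurable_fst)).restrict
    (s := {v : (I × ℝ≥0) × ℝ × ChannelState Φ | v.2.1 ≤ (v.1.2 : ℝ)})
    (measurableSet_le (measurable_fst.comp measurable_snd)
      (measurable_snd.comp measurable_fst).coe_nnreal_real)).map
    fun v => (v.2.2, ((v.1.2 : ℝ) - v.2.1).toNNReal)

variable (κ : Kernel I (ℝ × ChannelState Φ)) [IsSFiniteKernel κ]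

lemma lintegral_stayKer {g : I × ℝ≥0 → B} (hg : Measurable g) {f : B → ℝ≥0∞} (hf : Measurable f)
    (i : I) (t : ℝ≥0) :
    ∫⁻ b, f b ∂stayKer κ g (i, t) = f (g (i, t)) * κ i {v | (t : ℝ) < v.1} := by
  have hm : MeasurableSet {v : (I × ℝ≥0) × ℝ × ChannelState Φ | (v.1.2 : ℝ) < v.2.1} :=
    measurableSet_lt (measurable_snd.comp measurable_fst).coe_nnreal_real
      (measurable_fst.comp measurable_snd)
  have hgm : Measurable fun v : (I × ℝ≥0) × ℝ × ChannelState Φ => g v.1 := hg.comp measurable_fst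
  have hgf : Measurable fun v : (I × ℝ≥0) × ℝ × ChannelState Φ => f (g v.1) := hf.comp hgm
  rw [stayKer, Kernel.lintegral_map _ hgm _ hf, Kernel.lintegral_restrict,
    ← lintegral_indicator hm, Kernel.lintegral_id_prod (hgf.indicator hm)]
  have : (fun v : ℝ × ChannelState Φ =>
      {v : (I × ℝ≥0) × ℝ × ChannelState Φ | (v.1.2 : ℝ) < v.2.1}.indicator
      (fun v => f (g v.1)) ((i, t), v)) = {v : ℝ × ChannelState Φ | (t : ℝ) < v.1}.indicator
      fun _ => f (g (i, t)) := by
    ext v; simp [indicator]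
  rw [this, lintegral_indicator (measurableSet_lt measurable_const measurable_fst),
    setLIntegral_const]
  rfl

lemma lintegral_leaveKer {f : ChannelState Φ × ℝ≥0 → ℝ≥0∞} (hf : Measurable f) (i : I) (t : ℝ≥0) :
    ∫⁻ b, f b ∂leaveKer κ (i, t)
      = ∫⁻ v in {v | v.1 ≤ (t : ℝ)}, f (v.2, ((t : ℝ) - v.1).toNNReal) ∂κ i := by
  have hm : MeasurableSet {v : (I × ℝ≥0) × ℝ × ChannelState Φ | v.2.1 ≤ (v.1.2 : ℝ)} :=
    measurableSet_le (measurable_fst.comp measurable_snd)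
      (measurable_snd.comp measurable_fst).coe_nnreal_real
  have hg : Measurable fun v : (I × ℝ≥0) × ℝ × ChannelState Φ =>
      (v.2.2, ((v.1.2 : ℝ) - v.2.1).toNNReal) :=
    (measurable_snd.comp measurable_snd).prodMk
      ((measurable_snd.comp measurable_fst).coe_nnreal_real.sub
        (measurable_fst.comp measurable_snd)).real_toNNReal
  have hfg : Measurable fun v : (I × ℝ≥0) × ℝ × ChannelState Φ =>
      f (v.2.2, ((v.1.2 : ℝ) - v.2.1).toNNReal) := hf.comp hg
  rw [leaveKer, Kernel.lintegral_map _ hg _ hf, Kernel.lintegral_restrict,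
    ← lintegral_indicator hm, Kernel.lintegral_id_prod (hfg.indicator hm),
    ← lintegral_indicator (measurableSet_le measurable_fst measurable_const)]
  rfl

end StayLeave

variable (T : TcpModel Φ)

lemma ageLaw_univ_le (q : ChannelState Φ × ℝ) : T.ageLaw q univ ≤ 1 := by
  by_cases h : q.1 = .on → 0 < T.onLaw (Ioi q.2)
  · have := T.isProbabilityMeasure_ageLaw h
    exact prob_le_one
  · push Not at h
    obtain ⟨c, a⟩ := q
    obtain rfl : c = .on := h.1
    have h0 : T.onLaw (Ioi a) = 0 := le_antisymm h.2 bot_le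
    rw [ageLaw_on, Measure.smul_apply, tailShift_univ, h0]
    simp

lemma setLIntegral_prod_fst_le {α : Type*} [MeasurableSpace α] (μ : Measure ℝ) (ν : Measure α)
    [SFinite μ] [SFinite ν] (t : ℝ) {f : ℝ × α → ℝ≥0∞} (hf : Measurable f) :
    ∫⁻ v in {v | v.1 ≤ t}, f v ∂μ.prod ν = ∫⁻ τ in Iic t, ∫⁻ y, f (τ, y) ∂ν ∂μ := by
  have : {v : ℝ × α | v.1 ≤ t} = Iic t ×ˢ univ := by ext; simp
  rw [this, ← Measure.prod_restrict, Measure.restrict_univ, lintegral_prod _ hf.aemeasurable]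

lemma prod_fst_gt {α : Type*} [MeasurableSpace α] (μ : Measure ℝ) (ν : Measure α)
    [SFinite μ] [IsProbabilityMeasure ν] (t : ℝ) :
    μ.prod ν {v | t < v.1} = μ (Ioi t) := by
  have : {v : ℝ × α | t < v.1} = Ioi t ×ˢ univ := by ext; simp
  rw [this, Measure.prod_prod, measure_univ, mul_one]

variable [Finite Φ]

/-- Kernel giving the first sojourn time and the next state of a channel that enters a state. -/
def freshKer : Kernel (ChannelState Φ) (ℝ × ChannelState Φ) :=
  Kernel.ofFunOfCountable fun c => (T.sojournLaw T.onLaw c).prod (T.nextState c).toMeasure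

instance : IsMarkovKernel T.freshKer :=
  ⟨fun c => by
    simp only [freshKer, Kernel.ofFunOfCountable]
    exact inferInstanceAs (IsProbabilityMeasure (Measure.prod _ _))⟩

lemma measurable_ageLaw : Measurable T.ageLaw := by
  refine measurable_from_prod_countable_right fun c => ?_
  cases c with
  | off x => exact measurable_const
  | on =>
    refine Measure.measurable_of_measurable_coe _ fun s hs => ?_
    simp only [ageLaw_on, Measure.smul_apply, smul_eq_mul]
    refine Measurable.mul ?_ ?_
    · exact (measurable_measure_prodMk_left (ν := T.onLaw) (s := {q : ℝ × ℝ | q.1 < q.2})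
        (measurableSet_lt measurable_fst measurable_snd)).inv
    · simp only [tailShift_apply _ _ hs]
      refine measurable_measure_prodMk_left (ν := T.onLaw)
        (s := {q : ℝ × ℝ | q.2 - q.1 ∈ s ∧ q.1 < q.2}) ?_
      exact ((measurable_snd.sub measurable_fst) hs).inter
        (measurableSet_lt measurable_fst measurable_snd)

/-- `ageLaw` as a kernel. -/
def ageKer : Kernel (ChannelState Φ × ℝ) ℝ := ⟨T.ageLaw, T.measurable_ageLaw⟩

instance : IsFiniteKernel T.ageKer := ⟨1, ENNReal.one_lt_top, T.ageLaw_univ_le⟩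

/-- First sojourn law of a channel in a state with an age. -/
def agedSojournKer : Kernel (ChannelState Φ × ℝ) ℝ where
  toFun q := T.sojournLaw (T.ageLaw q) q.1
  measurable' := by
    refine measurable_from_prod_countable_right fun c => ?_
    cases c with
    | off x => exact measurable_const
    | on => exact T.measurable_ageLaw.comp measurable_prodMk_left

instance : IsFiniteKernel T.agedSojournKer := by
  refine ⟨1, ENNReal.one_lt_top, fun q => ?_⟩
  obtain ⟨_ | x, a⟩ := q
  · exact T.ageLaw_univ_le _
  · exact (measure_univ (μ := expMeasure (T.rate x))).le

/-- Kernel giving the remaining sojourn time and the next state of a channel in a state with an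
age. -/
def agedKer : Kernel (ChannelState Φ × ℝ) (ℝ × ChannelState Φ) :=
  T.agedSojournKer ×ₖ
    ((Kernel.ofFunOfCountable fun c => (T.nextState c).toMeasure).comap Prod.fst measurable_fst)

instance : IsMarkovKernel (Kernel.ofFunOfCountable fun c => (T.nextState c).toMeasure) :=
  ⟨fun c => by
    simp only [Kernel.ofFunOfCountable]
    exact inferInstanceAs (IsProbabilityMeasure (PMF.toMeasure _))⟩

instance : IsSFiniteKernel T.agedKer := by unfold agedKer; infer_instance

lemma agedKer_apply (q : ChannelState Φ × ℝ) :
    T.agedKer q = (T.sojournLaw (T.ageLaw q) q.1).prod (T.nextState q.1).toMeasure := by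
  rw [agedKer, Kernel.prod_apply]
  rfl

/-- One jump of the channel within the remaining time. -/
def jumpKer : Kernel (ChannelState Φ × ℝ≥0) (ChannelState Φ × ℝ≥0) := leaveKer T.freshKer

/-- `n` jumps of the channel within the remaining time. -/
def jumpsKer : ℕ → Kernel (ChannelState Φ × ℝ≥0) (ChannelState Φ × ℝ≥0)
  | 0 => Kernel.id
  | n + 1 => T.jumpKer ∘ₖ jumpsKer n

/-- State and age, after a given time, of a channel that has just entered a state: the sum over
the number of jumps. -/
def freshTransKer : Kernel (ChannelState Φ × ℝ≥0) (ChannelState Φ × ℝ) :=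
  Kernel.sum fun n => stayKer T.freshKer (fun q => (q.1, (q.2 : ℝ))) ∘ₖ T.jumpsKer n

/-- State and age, after a given time, of a channel with a given initial state and age. -/
def transKer : Kernel ((ChannelState Φ × ℝ) × ℝ≥0) (ChannelState Φ × ℝ) :=
  stayKer T.agedKer (fun q => (q.1.1, q.1.2 + q.2)) + T.freshTransKer ∘ₖ leaveKer T.agedKer

lemma freshKer_apply (c : ChannelState Φ) :
    T.freshKer c = (T.sojournLaw T.onLaw c).prod (T.nextState c).toMeasure := rfl

/-- The law of the drive as a kernel. -/
def driveKer : Kernel (ChannelState Φ × ℝ) (Drive Φ) :=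
  (T.ageKer ×ₖ Kernel.const _ (T.onDurLaw.prod (T.clockLaw.prod (T.nextLaw.prod T.lostLaw)))).map
    (driveEquiv Φ)

instance : IsFiniteKernel T.driveKer := by unfold driveKer; infer_instance

lemma driveKer_apply (q : ChannelState Φ × ℝ) : T.driveKer q = T.driveLawOf (T.ageLaw q) := by
  rw [driveKer, Kernel.map_apply _ measurable_driveEquiv, Kernel.prod_apply]
  rfl

variable {G : (ℝ≥0 → ChannelState Φ) → (ℕ × ℕ → Bool) → ℝ≥0∞}

lemma measurable_ageInt (hG : PathMeasurable G) : Measurable fun q => T.ageInt q G := by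
  have h : Measurable fun v : (ChannelState Φ × ℝ) × Drive Φ => G (T.path v.1.1 v.2) v.2.lost :=
    hG.comp_path T (measurable_fst.comp measurable_fst) measurable_snd
  have := h.lintegral_kernel_prod_right' (κ := T.driveKer)
  simp only [driveKer_apply] at this
  exact this

/-- Expectation of a path functional over the channel that enters `q.1`, seen from time `q.2`. -/
def freshInt (G : (ℝ≥0 → ChannelState Φ) → (ℕ × ℕ → Bool) → ℝ≥0∞)
    (q : ChannelState Φ × ℝ≥0) : ℝ≥0∞ :=
  T.pathInt T.onLaw q.1 fun γ l => G (fun s => γ (q.2 + s)) l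

lemma measurable_freshInt (hG : PathMeasurable G) : Measurable (T.freshInt G) := by
  refine measurable_from_prod_countable_right fun c => ?_
  have h : Measurable fun v : ℝ≥0 × Drive Φ =>
      G (fun s => T.path c v.2 (v.1 + s)) v.2.lost :=
    hG _ (fun v s => T.path c v.2 (v.1 + s)) _
      (T.measurable_path measurable_const (measurable_snd.comp measurable_fst)
        ((measurable_fst.comp measurable_fst).add measurable_snd))
      (measurable_lost.comp measurable_snd)
  exact h.lintegral_prod_right'

lemma lintegral_jumpKer {f : ChannelState Φ × ℝ≥0 → ℝ≥0∞} (hf : Measurable f)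
    (c : ChannelState Φ) (t : ℝ≥0) : ∫⁻ b, f b ∂T.jumpKer (c, t)
      = ∫⁻ τ in Iic (t : ℝ), ∫⁻ c', f (c', (t - τ).toNNReal) ∂(T.nextState c).toMeasure
        ∂T.sojournLaw T.onLaw c := by
  have h : Measurable fun v : ℝ × ChannelState Φ => f (v.2, ((t : ℝ) - v.1).toNNReal) :=
    hf.comp (measurable_snd.prodMk (measurable_const.sub measurable_fst).real_toNNReal)
  rw [jumpKer, lintegral_leaveKer _ hf, freshKer_apply, setLIntegral_prod_fst_le _ _ _ h]

/-- Renewal equation for a channel that has just entered a state. -/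
lemma freshInt_eq (hG : PathMeasurable G) (q : ChannelState Φ × ℝ≥0) :
    T.freshInt G q
      = ∫⁻ q', T.ageInt q' G ∂stayKer T.freshKer (fun q => (q.1, (q.2 : ℝ))) q
        + ∫⁻ q', T.freshInt G q' ∂T.jumpKer q := by
  obtain ⟨c, t⟩ := q
  rw [T.lintegral_jumpKer (T.measurable_freshInt hG), lintegral_stayKer _ (by fun_prop)
    (T.measurable_ageInt hG), freshKer_apply, prod_fst_gt, mul_comm, freshInt,
    T.pathInt_shift hG T.onLaw c t (a := t) (fun _ => T.tailShift_onLaw t)]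
  rfl

/-- In each state the sojourn time has a discounted mean at most `r²`, `r < 1`, unless the state
is ON, and two visits to ON are separated by an OFF phase. Hence the weight `e ^ t`, increased by
the factor `r⁻¹` at ON, contracts by `r` at each jump. -/
lemma exists_jumpKer_contraction : ∃ r : ℝ≥0∞, r < 1 ∧ ∃ w : ChannelState Φ × ℝ≥0 → ℝ≥0∞,
    Measurable w ∧ (∀ q, 1 ≤ w q) ∧ (∀ q, w q ≠ ⊤) ∧
    ∀ q, ∫⁻ q', w q' ∂T.jumpKer q ≤ r * w q := by
  have hm : Measurable fun τ : ℝ => ENNReal.ofReal (Real.exp (-τ)) := by fun_prop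
  have hlap (x : Φ) : ∫⁻ τ, ENNReal.ofReal (Real.exp (-τ)) ∂expMeasure (T.rate x) < 1 := by
    have h1 : ∀ᵐ τ ∂expMeasure (T.rate x), 0 < τ := by
      rw [ae_iff]
      simpa [← Iic_def] using expMeasure_Iic_zero (T.rate_pos x)
    calc _ < ∫⁻ _, 1 ∂expMeasure (T.rate x) := by
          refine lintegral_strict_mono (IsProbabilityMeasure.ne_zero _) aemeasurable_const ?_ ?_
          · refine (lt_of_le_of_lt (lintegral_mono_ae (g := fun _ => 1) ?_) (by simp)).ne
            filter_upwards [h1] with τ hτ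
            simpa using hτ.le
          · filter_upwards [h1] with τ hτ
            simpa using hτ
      _ = 1 := by simp
  have : Nonempty Φ := ⟨T.i₀⟩
  obtain ⟨x₀, hx₀⟩ := Finite.exists_max fun x : Φ =>
    ∫⁻ τ, ENNReal.ofReal (Real.exp (-τ)) ∂expMeasure (T.rate x)
  set θ := (∫⁻ τ, ENNReal.ofReal (Real.exp (-τ)) ∂expMeasure (T.rate x₀)).toReal with hθ
  have hθ0 : 0 ≤ θ := ENNReal.toReal_nonneg
  have hθ1 : θ < 1 := by
    rw [hθ, ← ENNReal.toReal_one]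
    exact (ENNReal.toReal_lt_toReal (hlap x₀).ne_top ENNReal.one_ne_top).2 (hlap x₀)
  have hθx (x : Φ) : ∫⁻ τ, ENNReal.ofReal (Real.exp (-τ)) ∂expMeasure (T.rate x)
      ≤ ENNReal.ofReal θ := by
    rw [hθ, ENNReal.ofReal_toReal (hlap x₀).ne_top]
    exact hx₀ x
  set r : ℝ := (1 + θ) / 2 with hr
  have hr0 : 0 < r := by positivity
  have hr1 : r < 1 := by linarith
  set k : ChannelState Φ → ℝ := fun c => match c with
    | .on => r⁻¹
    | .off _ => 1 with hk
  have hk1 (c : ChannelState Φ) : 1 ≤ k c := by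
    cases c
    · exact (one_le_inv₀ hr0).2 hr1.le
    · exact le_rfl
  have hk2 (c : ChannelState Φ) : k c ≤ r⁻¹ := by
    cases c
    · exact le_rfl
    · exact (one_le_inv₀ hr0).2 hr1.le
  have hwm : Measurable fun q : ChannelState Φ × ℝ≥0 =>
      ENNReal.ofReal (k q.1 * Real.exp q.2) :=
    (((measurable_of_countable k).comp measurable_fst).mul
      (Real.measurable_exp.comp measurable_snd.coe_nnreal_real)).ennreal_ofReal
  refine ⟨ENNReal.ofReal r, by simpa using hr1, fun q => ENNReal.ofReal (k q.1 * Real.exp q.2),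
    hwm, fun q => ?_, fun q => ENNReal.ofReal_ne_top, fun q => ?_⟩
  · rw [← ENNReal.ofReal_one]
    exact ENNReal.ofReal_le_ofReal (one_le_mul_of_one_le_of_one_le (hk1 _) (by simp))
  obtain ⟨c, t⟩ := q
  rw [T.lintegral_jumpKer hwm, ← ENNReal.ofReal_mul hr0.le]
  cases c with
  | on =>
    have hae : ∀ᵐ τ ∂T.onLaw.restrict (Iic (t : ℝ)), ∫⁻ c', ENNReal.ofReal
        (k c' * Real.exp (((t : ℝ) - τ).toNNReal : ℝ)) ∂(T.nextState .on).toMeasure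
        ≤ ENNReal.ofReal (Real.exp t) := by
      have h0 : ∀ᵐ τ ∂T.onLaw, 0 ≤ τ := by
        rw [ae_iff]
        simpa [← Iio_def] using T.onLaw_nonneg
      filter_upwards [ae_restrict_of_ae h0, ae_restrict_mem measurableSet_Iic] with τ h1 h2
      rw [nextState, PMF.toMeasure_pure, lintegral_dirac,
        Real.coe_toNNReal _ (by simpa using h2)]
      refine ENNReal.ofReal_le_ofReal ?_
      simpa [hk] using h1
    calc _ ≤ ∫⁻ _ in Iic (t : ℝ), ENNReal.ofReal (Real.exp t) ∂T.onLaw := lintegral_mono_ae hae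
      _ ≤ ENNReal.ofReal (Real.exp t) * 1 := by
          rw [setLIntegral_const]; gcongr; exact prob_le_one
      _ = _ := by
          rw [mul_one]
          congr 1
          simp only [hk]
          field_simp
  | off x =>
    have hae : ∀ τ ∈ Iic (t : ℝ), ∫⁻ c', ENNReal.ofReal
        (k c' * Real.exp (((t : ℝ) - τ).toNNReal : ℝ)) ∂(T.nextState (.off x)).toMeasure
        ≤ ENNReal.ofReal (r⁻¹ * Real.exp t) * ENNReal.ofReal (Real.exp (-τ)) := by
      intro τ hτ
      calc _ ≤ ∫⁻ _, ENNReal.ofReal (r⁻¹ * Real.exp t * Real.exp (-τ))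
            ∂(T.nextState (.off x)).toMeasure := by
            refine lintegral_mono fun c' => ENNReal.ofReal_le_ofReal ?_
            rw [Real.coe_toNNReal _ (by simpa using hτ), mul_assoc, ← Real.exp_add,
              ← sub_eq_add_neg]
            gcongr
            exact hk2 c'
        _ = _ := by
            rw [lintegral_const, measure_univ, mul_one, ENNReal.ofReal_mul (by positivity)]
    calc _ ≤ ∫⁻ τ in Iic (t : ℝ), ENNReal.ofReal (r⁻¹ * Real.exp t) * ENNReal.ofReal (Real.exp (-τ))
          ∂expMeasure (T.rate x) := setLIntegral_mono' measurableSet_Iic hae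
      _ ≤ ∫⁻ τ, ENNReal.ofReal (r⁻¹ * Real.exp t) * ENNReal.ofReal (Real.exp (-τ))
          ∂expMeasure (T.rate x) := setLIntegral_le_lintegral _ _
      _ ≤ ENNReal.ofReal (r⁻¹ * Real.exp t) * ENNReal.ofReal θ := by
          rw [lintegral_const_mul _ hm]
          gcongr
          exact hθx x
      _ ≤ _ := by
          rw [← ENNReal.ofReal_mul (by positivity)]
          refine ENNReal.ofReal_le_ofReal ?_
          have hsq : θ ≤ r * r := by rw [hr]; nlinarith [sq_nonneg (1 - θ)]
          calc r⁻¹ * Real.exp t * θ ≤ r⁻¹ * Real.exp t * (r * r) := by gcongr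
            _ = _ := by simp only [hk]; field_simp

lemma lintegral_jumpsKer_succ (n : ℕ) {f : ChannelState Φ × ℝ≥0 → ℝ≥0∞} (hf : Measurable f)
    (q : ChannelState Φ × ℝ≥0) : ∫⁻ q', f q' ∂T.jumpsKer (n + 1) q
      = ∫⁻ q', ∫⁻ q'', f q'' ∂T.jumpKer q' ∂T.jumpsKer n q := by
  rw [jumpsKer, Kernel.lintegral_comp _ _ _ hf]

/-- Finitely many jumps happen in finite time. -/
lemma tendsto_jumpsKer (q : ChannelState Φ × ℝ≥0) :
    Tendsto (fun n => T.jumpsKer n q univ) atTop (𝓝 0) := by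
  obtain ⟨r, hr, w, hwm, hw1, hw, hJ⟩ := T.exists_jumpKer_contraction
  have hb (n : ℕ) : ∫⁻ q', w q' ∂T.jumpsKer n q ≤ r ^ n * w q := by
    induction n with
    | zero => simp [jumpsKer, Kernel.id_apply, lintegral_dirac' _ hwm]
    | succ n ih =>
      rw [T.lintegral_jumpsKer_succ n hwm]
      calc _ ≤ ∫⁻ q', r * w q' ∂T.jumpsKer n q := lintegral_mono hJ
        _ = r * ∫⁻ q', w q' ∂T.jumpsKer n q := lintegral_const_mul _ hwm
        _ ≤ r * (r ^ n * w q) := by gcongr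
        _ = _ := by ring
  have h0 : Tendsto (fun n => r ^ n * w q) atTop (𝓝 0) := by
    simpa using ENNReal.Tendsto.mul_const (ENNReal.tendsto_pow_atTop_nhds_zero_of_lt_one hr)
      (Or.inr (hw q))
  refine tendsto_of_tendsto_of_tendsto_of_le_of_le tendsto_const_nhds h0 (fun _ => bot_le)
    fun n => le_trans ?_ (hb n)
  rw [← lintegral_one]
  exact lintegral_mono fun q' => hw1 q'

/-- Solving the renewal equation: the state and age at a fixed time determine the law of the
rest of the path. -/
lemma freshInt_eq_lintegral (hG : PathMeasurable G) (hG1 : ∀ γ l, G γ l ≤ 1)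
    (q : ChannelState Φ × ℝ≥0) :
    T.freshInt G q = ∫⁻ q', T.ageInt q' G ∂T.freshTransKer q := by
  have hA := T.measurable_ageInt hG
  have hH := T.measurable_freshInt hG
  set A : ChannelState Φ × ℝ≥0 → ℝ≥0∞ := fun q =>
    ∫⁻ q', T.ageInt q' G ∂stayKer T.freshKer (fun q => (q.1, (q.2 : ℝ))) q with hAdef
  have hAm : Measurable A := hA.lintegral_kernel
  have hiter (n : ℕ) : T.freshInt G q = ∑ m ∈ Finset.range n, ∫⁻ q', A q' ∂T.jumpsKer m q
      + ∫⁻ q', T.freshInt G q' ∂T.jumpsKer n q := by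
    induction n with
    | zero => simp [jumpsKer, Kernel.id_apply, lintegral_dirac' _ hH]
    | succ n ih =>
      rw [ih, Finset.sum_range_succ, add_assoc, T.lintegral_jumpsKer_succ n hH,
        ← lintegral_add_left hAm]
      congr 1
      exact lintegral_congr fun q' => T.freshInt_eq hG q'
  have hle (n : ℕ) : ∫⁻ q', T.freshInt G q' ∂T.jumpsKer n q ≤ T.jumpsKer n q univ := by
    rw [← lintegral_one]
    refine lintegral_mono fun q' => ?_
    calc T.freshInt G q' ≤ ∫⁻ _, 1 ∂T.driveLawOf T.onLaw := lintegral_mono fun ω => hG1 _ _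
      _ = 1 := by simp
  have hrem : Tendsto (fun n => ∫⁻ q', T.freshInt G q' ∂T.jumpsKer n q) atTop (𝓝 0) :=
    tendsto_of_tendsto_of_tendsto_of_le_of_le tendsto_const_nhds (T.tendsto_jumpsKer q)
      (fun _ => bot_le) hle
  have hsum : Tendsto (fun n => ∑ m ∈ Finset.range n, ∫⁻ q', A q' ∂T.jumpsKer m q) atTop
      (𝓝 (∑' m, ∫⁻ q', A q' ∂T.jumpsKer m q)) := ENNReal.tendsto_nat_tsum _
  have hlim := hsum.add hrem
  simp only [← hiter, add_zero] at hlim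
  rw [tendsto_nhds_unique tendsto_const_nhds hlim, freshTransKer, Kernel.sum_apply,
    lintegral_sum_measure]
  exact tsum_congr fun m => (Kernel.lintegral_comp _ _ _ hA).symm

/-- **Markov property of the channel at a fixed time.** -/
lemma ageInt_shift (hG : PathMeasurable G) (hG1 : ∀ γ l, G γ l ≤ 1)
    {q : ChannelState Φ × ℝ} (hq : q.1 = .on → 0 < T.onLaw (Ioi q.2)) (t : ℝ≥0) :
    T.ageInt q (fun γ l => G (fun s => γ (t + s)) l)
      = ∫⁻ q', T.ageInt q' G ∂T.transKer (q, t) := by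
  have := T.isProbabilityMeasure_ageLaw hq
  obtain ⟨c, a⟩ := q
  have hA := T.measurable_ageInt hG
  have hH := T.measurable_freshInt hG
  have h : Measurable fun v : ℝ × ChannelState Φ =>
      T.freshInt G (v.2, ((t : ℝ) - v.1).toNNReal) :=
    hH.comp (measurable_snd.prodMk (measurable_const.sub measurable_fst).real_toNNReal)
  rw [ageInt, T.pathInt_shift hG _ c t (a := a + t)
    (by rintro rfl; exact T.tailShift_ageLaw a t.coe_nonneg), transKer, add_apply,
    lintegral_add_measure, lintegral_stayKer _ (by fun_prop) hA, agedKer_apply, prod_fst_gt,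
    mul_comm, Kernel.lintegral_comp _ _ _ hA]
  simp only [← T.freshInt_eq_lintegral hG hG1]
  rw [lintegral_leaveKer _ hH, agedKer_apply, setLIntegral_prod_fst_le _ _ _ h]
  rfl

end

end TcpModel

/-! ### The TCP process as a Markov chain -/

namespace TcpModel

variable {Φ : Type u}

noncomputable section

variable (T : TcpModel Φ)

/-- Attempt times and states of TCP along a given channel path and given losses, started in an
arbitrary state. Times are truncated to nonnegative reals, as paths are indexed by these. -/
def tcpTimeState (X₀ : TcpState Φ) (γ : ℝ≥0 → ChannelState Φ) (l : ℕ × ℕ → Bool) :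
    ℕ → ℝ≥0 × TcpState Φ
  | 0 => (0, X₀)
  | k + 1 =>
    let U := (tcpTimeState X₀ γ l k).1
    let X := (tcpTimeState X₀ γ l k).2
    (U + X.2.1.toNNReal, T.step X (γ (U + X.2.1.toNNReal)) (∃ i < X.2.2.1, l (k, i) = true))

/-- States of TCP along a given channel path and given losses. -/
def tcpSeq (X₀ : TcpState Φ) (γ : ℝ≥0 → ChannelState Φ) (l : ℕ × ℕ → Bool) (k : ℕ) : TcpState Φ :=
  (T.tcpTimeState X₀ γ l k).2

lemma tcpTimeState_succ (X₀ : TcpState Φ) (γ : ℝ≥0 → ChannelState Φ) (l : ℕ × ℕ → Bool) (k : ℕ) :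
    T.tcpTimeState X₀ γ l (k + 1) =
      let S := T.tcpTimeState (T.step X₀ (γ X₀.2.1.toNNReal) (∃ i < X₀.2.2.1, l (0, i) = true))
        (fun s => γ (X₀.2.1.toNNReal + s)) (fun i => l (i.1 + 1, i.2)) k
      (X₀.2.1.toNNReal + S.1, S.2) := by
  induction k with
  | zero => simp [tcpTimeState]
  | succ k ih =>
    rw [tcpTimeState, ih]
    simp only [tcpTimeState, add_assoc]

lemma tcpSeq_succ (X₀ : TcpState Φ) (γ : ℝ≥0 → ChannelState Φ) (l : ℕ × ℕ → Bool) (k : ℕ) :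
    T.tcpSeq X₀ γ l (k + 1) =
      T.tcpSeq (T.step X₀ (γ (X₀.2.1.toNNReal + 0)) (∃ i < X₀.2.2.1, l (0, i) = true))
        (fun s => γ (X₀.2.1.toNNReal + s)) (fun i => l (i.1 + 1, i.2)) k := by
  rw [tcpSeq, tcpTimeState_succ, add_zero, tcpSeq]

/-- The states that make sense in the model. -/
def StateAdmissible (X : TcpState Φ) : Prop :=
  (match X.1 with
    | .on => X.2.1 = T.R
    | .off _ => (∃ i ≤ T.b, X.2.1 = 2 ^ i * T.M) ∧ X.2.2.1 = 1) ∧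
  X.2.2.1 ∈ Set.Icc 1 T.Wmax ∧ X.2.2.2 ∈ Set.Icc 1 T.Wmax

/-- The ages that have a residual law. -/
def AgeAdmissible (q : ChannelState Φ × ℝ) : Prop :=
  q.1 = .on → 0 ≤ q.2 ∧ 0 < T.onLaw (Ioi q.2)

lemma admissible_iff (z : TcpStart Φ) :
    T.Admissible z ↔ T.StateAdmissible z.1 ∧ T.AgeAdmissible (z.1.1, z.2) := by
  obtain ⟨⟨c, j, w, h⟩, a⟩ := z
  cases c <;> simp [Admissible, StateAdmissible, AgeAdmissible, and_assoc, and_left_comm, and_comm]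

lemma M_pos : 0 < T.M := lt_max_of_lt_left T.R_pos

variable {T}

lemma StateAdmissible.pos {X : TcpState Φ} (h : T.StateAdmissible X) : 0 < X.2.1 := by
  obtain ⟨c, j, w, hh⟩ := X
  cases c with
  | on => exact (show j = T.R from h.1) ▸ T.R_pos
  | off x =>
    obtain ⟨i, _, hi⟩ := h.1.1
    exact hi ▸ mul_pos (by positivity) T.M_pos

lemma half_mem {w : ℕ} (hw : w ∈ Icc 1 T.Wmax) : half w ∈ Icc 1 T.Wmax := by
  have := hw.2
  have := T.one_le_Wmax
  simp only [half, mem_Icc]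
  omega

lemma StateAdmissible.step {X : TcpState Φ} (h : T.StateAdmissible X) (s : ChannelState Φ)
    (p : Prop) : T.StateAdmissible (T.step X s p) := by
  obtain ⟨c, j, w, hh⟩ := X
  have hW := T.one_le_Wmax
  obtain ⟨h1, h2, h3⟩ := h
  have h2' : w ∈ Icc 1 T.Wmax := h2
  have h3' : hh ∈ Icc 1 T.Wmax := h3
  have one : 1 ∈ Icc 1 T.Wmax := ⟨le_rfl, hW⟩
  have hhalf := half_mem h2'
  cases c with
  | on =>
    cases s with
    | on =>
      simp only [TcpModel.step]
      split_ifs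
      · exact ⟨rfl, hhalf, hhalf⟩
      · refine ⟨rfl, ?_, h3'⟩
        simp only [mem_Icc] at *
        omega
      · refine ⟨rfl, ?_, h3'⟩
        simp only [mem_Icc] at *
        omega
    | off y => exact ⟨⟨⟨0, by omega, by simp [TcpModel.step]⟩, rfl⟩, one, hhalf⟩
  | off x =>
    cases s with
    | on => exact ⟨rfl, one, h3'⟩
    | off y =>
      refine ⟨⟨?_, rfl⟩, one, hhalf⟩
      obtain ⟨i, hi, hj⟩ := h1.1
      have hj : j = 2 ^ i * T.M := hj
      have hM := T.M_pos
      change ∃ k ≤ T.b, min (2 * j) T.Tmax = 2 ^ k * T.M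
      rcases lt_or_eq_of_le hi with hlt | rfl
      · refine ⟨i + 1, hlt, ?_⟩
        rw [min_eq_left]
        · rw [hj]; ring
        · rw [hj, Tmax, ← mul_assoc, ← pow_succ']
          gcongr
          · norm_num
          · exact hlt
      · refine ⟨T.b, le_rfl, ?_⟩
        rw [min_eq_right, Tmax]
        rw [hj, Tmax]
        have : 0 < 2 ^ T.b * T.M := by positivity
        linarith

lemma step_fst (X : TcpState Φ) (s : ChannelState Φ) (p : Prop) : (T.step X s p).1 = s := by
  obtain ⟨c, j, w, hh⟩ := X
  cases c <;> cases s <;> simp only [step] <;> split_ifs <;> rfl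

lemma StateAdmissible.tcpSeq {X : TcpState Φ} (h : T.StateAdmissible X)
    (γ : ℝ≥0 → ChannelState Φ) (l : ℕ × ℕ → Bool) (k : ℕ) :
    T.StateAdmissible (T.tcpSeq X γ l k) := by
  induction k with
  | zero => exact h
  | succ k ih => exact ih.step _ _

/-- The process runs TCP along the channel path. Attempt times of admissible states are nonnegative,
so the truncation in `tcpTimeState` has no effect. -/
lemma process_eq {z : TcpStart Φ} (h : T.StateAdmissible z.1) (ω : Drive Φ) (k : ℕ) :
    T.process z ω k = T.tcpSeq z.1 (T.path z.1.1 ω) ω.lost k := by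
  have key : T.timeState z ω k = (((T.tcpTimeState z.1 (T.path z.1.1 ω) ω.lost k).1 : ℝ),
      (T.tcpTimeState z.1 (T.path z.1.1 ω) ω.lost k).2) := by
    induction k with
    | zero => rfl
    | succ k ih =>
      have hp := (h.tcpSeq (T.path z.1.1 ω) ω.lost k).pos
      rw [tcpSeq] at hp
      simp only [timeState, ih, tcpTimeState, NNReal.coe_add, Real.coe_toNNReal _ hp.le, path]
  rw [process, key, tcpSeq]

variable (T)

lemma measurableSet_ageAdmissible : MeasurableSet {q : ChannelState Φ × ℝ | T.AgeAdmissible q} := by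
  have hanti : Antitone fun a : ℝ => T.onLaw (Ioi a) := fun a b h => measure_mono (Ioi_subset_Ioi h)
  have h1 : MeasurableSet {q : ChannelState Φ × ℝ | q.1 ≠ .on} :=
    measurable_fst (MeasurableSet.of_discrete (s := {c : ChannelState Φ | c ≠ .on}))
  have h2 : MeasurableSet {q : ChannelState Φ × ℝ | 0 ≤ q.2} :=
    measurableSet_le measurable_const measurable_snd
  have h3 : MeasurableSet {q : ChannelState Φ × ℝ | 0 < T.onLaw (Ioi q.2)} :=
    measurableSet_lt measurable_const (hanti.measurable.comp measurable_snd)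
  convert h1.union (h2.inter h3) using 1
  ext q
  simp only [AgeAdmissible, mem_ofPred_eq, mem_union, mem_inter_iff]
  tauto

lemma path_shiftLost (c : ChannelState Φ) (ω : Drive Φ) :
    T.path c ω.shiftLost = T.path c ω := by
  have hp (n m : ℕ) : T.phase c ω.shiftLost n m = T.phase c ω n m := by
    induction m with
    | zero => rfl
    | succ m ih => rw [phase, ih, phase]; rfl
  have hh (n m : ℕ) : T.hold c ω.shiftLost n m = T.hold c ω n m := by
    rw [hold, hp]; rfl
  have hs (n : ℕ) : T.offStart c ω.shiftLost n = T.offStart c ω n := by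
    induction n with
    | zero => cases c <;> rfl
    | succ n ih => rw [offStart_succ, ih, T.offDur_congr _ (hh n)]; rfl
  funext t
  simp only [path, channel, hs]
  split_ifs
  · rfl
  · exact T.offPath_congr _ (hp _) (hh _) _

section Measurability

variable [Finite Φ]

lemma measurable_step {A : Type*} [MeasurableSpace A] {X : A → TcpState Φ} {s : A → ChannelState Φ}
    {p : A → Prop} (hX : Measurable X) (hs : Measurable s) (hp : Measurable p) :
    Measurable fun a => T.step (X a) (s a) (p a) := by
  refine measurable_apply_countable (D := ChannelState Φ × ℕ × ℕ × ChannelState Φ × Prop)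
    (f := fun d a => T.step (d.1, (X a).2.1, d.2.1, d.2.2.1) d.2.2.2.1 d.2.2.2.2)
    (g := fun a => ((X a).1, (X a).2.2.1, (X a).2.2.2, s a, p a)) ?_ (by fun_prop)
  rintro ⟨c, w, h, s, p⟩
  have hj : Measurable fun a => (X a).2.1 := by fun_prop
  cases c <;> cases s <;> simp only [step] <;> (try split_ifs) <;> fun_prop

lemma measurable_loss {A : Type*} [MeasurableSpace A] {w : A → ℕ} {l : A → ℕ → Bool}
    (hw : Measurable w) (hl : Measurable l) : Measurable fun a => ∃ i < w a, l a i = true := by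
  refine measurable_apply_countable (f := fun (w : ℕ) a => ∃ i < w, l a i = true) (fun w => ?_) hw
  refine measurableSet_setOfPred.1 ?_
  rw [show {a | ∃ i < w, l a i = true} = ⋃ i, ⋃ (_ : i < w), {a | l a i = true} by ext; simp]
  refine MeasurableSet.iUnion fun i => MeasurableSet.iUnion fun _ => ?_
  exact ((measurable_pi_apply i).comp hl) (MeasurableSet.of_discrete (s := {true}))

lemma measurable_tcpTimeState {A : Type*} [MeasurableSpace A] {X : A → TcpState Φ}
    {γ : A → ℝ≥0 → ChannelState Φ} {l : A → ℕ × ℕ → Bool} (hX : Measurable X)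
    (hγ : Measurable (Function.uncurry γ)) (hl : Measurable l) (k : ℕ) :
    Measurable fun a => T.tcpTimeState (X a) (γ a) (l a) k := by
  induction k with
  | zero => exact measurable_const.prodMk hX
  | succ k ih =>
    have hU : Measurable fun a => (T.tcpTimeState (X a) (γ a) (l a) k).1 +
        (T.tcpTimeState (X a) (γ a) (l a) k).2.2.1.toNNReal := by fun_prop
    refine hU.prodMk (T.measurable_step (by fun_prop) ?_ (measurable_loss (by fun_prop) ?_))
    · exact hγ.comp (measurable_id.prodMk hU)
    · exact measurable_pi_lambda _ fun i => (measurable_pi_apply (k, i)).comp hl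

lemma measurable_tcpSeq {A : Type*} [MeasurableSpace A] {X : A → TcpState Φ}
    {γ : A → ℝ≥0 → ChannelState Φ} {l : A → ℕ × ℕ → Bool} (hX : Measurable X)
    (hγ : Measurable (Function.uncurry γ)) (hl : Measurable l) :
    Measurable fun a => T.tcpSeq (X a) (γ a) (l a) :=
  measurable_pi_lambda _ fun k => measurable_snd.comp (T.measurable_tcpTimeState hX hγ hl k)

lemma measurable_process_uncurry :
    Measurable fun v : TcpStart Φ × Drive Φ =>
      T.tcpSeq v.1.1 (T.path v.1.1.1 v.2) v.2.lost :=
  T.measurable_tcpSeq (by fun_prop)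
    (T.measurable_path (by fun_prop) (by fun_prop) measurable_snd)
    (measurable_lost.comp measurable_snd)

/-- Law of the sequence of states, as a kernel from the initial conditions. -/
def processKer : Kernel (TcpStart Φ) (ℕ → TcpState Φ) :=
  (Kernel.id ×ₖ T.driveKer.comap (fun z : TcpStart Φ => (z.1.1, z.2)) (by fun_prop)).map
    fun v => T.tcpSeq v.1.1 (T.path v.1.1.1 v.2) v.2.lost

lemma processKer_apply (z : TcpStart Φ) {B : Set (ℕ → TcpState Φ)} (hB : MeasurableSet B) :
    T.processKer z B = T.ageInt (z.1.1, z.2) (fun γ l => B.indicator 1 (T.tcpSeq z.1 γ l)) := by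
  have hm := T.measurable_process_uncurry
  have hi : Measurable (B.indicator (1 : (ℕ → TcpState Φ) → ℝ≥0∞)) := measurable_one.indicator hB
  have hmB : Measurable fun v : TcpStart Φ × Drive Φ =>
      B.indicator (1 : (ℕ → TcpState Φ) → ℝ≥0∞) (T.tcpSeq v.1.1 (T.path v.1.1.1 v.2) v.2.lost) :=
    hi.comp hm
  rw [processKer, ← lintegral_indicator_one hB, Kernel.lintegral_map _ hm _ hi,
    Kernel.lintegral_id_prod hmB]
  simp only [Kernel.comap_apply, driveKer_apply]
  rfl

lemma processKer_eq_driveLaw {z : TcpStart Φ} (hz : T.StateAdmissible z.1)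
    {B : Set (ℕ → TcpState Φ)} (hB : MeasurableSet B) :
    T.processKer z B = T.driveLaw z {ω | T.process z ω ∈ B} := by
  have hm : Measurable fun ω : Drive Φ => T.tcpSeq z.1 (T.path z.1.1 ω) ω.lost :=
    T.measurable_process_uncurry.comp measurable_prodMk_left
  have h : ∀ ω, T.process z ω = T.tcpSeq z.1 (T.path z.1.1 ω) ω.lost := fun ω =>
    funext (process_eq hz ω)
  simp only [h]
  rw [T.processKer_apply z hB, ageInt, pathInt, driveLaw_eq, residualLaw_eq]
  exact lintegral_indicator_one (hm hB)

instance {I B : Type*} [MeasurableSpace I] [MeasurableSpace B]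
    (κ : Kernel I (ℝ × ChannelState Φ)) [IsSFiniteKernel κ] (g : I × ℝ≥0 → B) :
    IsSFiniteKernel (stayKer κ g) := by
  unfold stayKer; infer_instance

instance {I : Type*} [MeasurableSpace I] (κ : Kernel I (ℝ × ChannelState Φ)) [IsSFiniteKernel κ] :
    IsSFiniteKernel (leaveKer κ) := by
  unfold leaveKer; infer_instance

instance (n : ℕ) : IsSFiniteKernel (T.jumpsKer n) := by
  induction n with
  | zero => unfold jumpsKer; infer_instance
  | succ n ih => unfold jumpsKer jumpKer; infer_instance

instance : IsSFiniteKernel T.transKer := by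
  unfold transKer freshTransKer; infer_instance

/-- Transition kernel of the Markov chain formed by the state and the age of the ON period. -/
def stepKer : Kernel (TcpStart Φ) (TcpStart Φ) :=
  (Kernel.id ×ₖ ((T.transKer.comap (fun z : TcpStart Φ => ((z.1.1, z.2), z.1.2.1.toNNReal))
    (by fun_prop)) ×ₖ Kernel.const _ T.windowLaw)).map
    fun v => (T.step v.1.1 v.2.1.1 (∃ i < v.1.1.2.2.1, v.2.2 i = true), v.2.1.2)

lemma lintegral_stepKer (z : TcpStart Φ) {f : TcpStart Φ → ℝ≥0∞} (hf : Measurable f) :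
    ∫⁻ z', f z' ∂T.stepKer z = ∫⁻ q, ∫⁻ l, f (T.step z.1 q.1 (∃ i < z.1.2.2.1, l i = true), q.2)
      ∂T.windowLaw ∂T.transKer ((z.1.1, z.2), z.1.2.1.toNNReal) := by
  have hm : Measurable fun v : TcpStart Φ × (ChannelState Φ × ℝ) × (ℕ → Bool) =>
      (T.step v.1.1 v.2.1.1 (∃ i < v.1.1.2.2.1, v.2.2 i = true), v.2.1.2) :=
    (T.measurable_step (by fun_prop) (by fun_prop)
      (measurable_loss (by fun_prop) (by fun_prop))).prodMk (by fun_prop)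
  have hfm : Measurable fun v : TcpStart Φ × (ChannelState Φ × ℝ) × (ℕ → Bool) =>
      f (T.step v.1.1 v.2.1.1 (∃ i < v.1.1.2.2.1, v.2.2 i = true), v.2.1.2) := hf.comp hm
  rw [stepKer, Kernel.lintegral_map _ hm _ hf, Kernel.lintegral_id_prod hfm,
    Kernel.prod_apply]
  exact lintegral_prod _ (hfm.comp measurable_prodMk_left).aemeasurable

/-! ### Ages that remain admissible, and the Markov property of the chain -/

lemma ae_freshTransKer (q : ChannelState Φ × ℝ≥0) :
    ∀ᵐ q' ∂T.freshTransKer q, T.AgeAdmissible q' := by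
  have hS := T.measurableSet_ageAdmissible.compl
  have hf : Measurable ({q | T.AgeAdmissible q}ᶜ.indicator (1 : ChannelState Φ × ℝ → ℝ≥0∞)) :=
    measurable_one.indicator hS
  rw [ae_iff, ← compl_ofPred, ← lintegral_indicator_one hS, freshTransKer, Kernel.sum_apply,
    lintegral_sum_measure, ENNReal.tsum_eq_zero]
  intro n
  rw [Kernel.lintegral_comp _ _ _ hf]
  refine (lintegral_congr fun q' => ?_).trans lintegral_zero
  obtain ⟨c, t⟩ := q'
  rw [lintegral_stayKer _ (by fun_prop) hf, freshKer_apply, prod_fst_gt]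
  cases c with
  | off x => simp [AgeAdmissible]
  | on =>
    rcases eq_or_ne (T.onLaw (Ioi (t : ℝ))) 0 with h | h
    · simp [sojournLaw, h]
    · simp [AgeAdmissible, pos_iff_ne_zero.2 h]

variable {T} in
lemma AgeAdmissible.ae_transKer {q : ChannelState Φ × ℝ} (hq : T.AgeAdmissible q) (t : ℝ≥0) :
    ∀ᵐ q' ∂T.transKer (q, t), T.AgeAdmissible q' := by
  have := T.isProbabilityMeasure_ageLaw fun h => (hq h).2
  have hS := T.measurableSet_ageAdmissible.compl
  have hf : Measurable ({q | T.AgeAdmissible q}ᶜ.indicator (1 : ChannelState Φ × ℝ → ℝ≥0∞)) :=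
    measurable_one.indicator hS
  have h2 : ∫⁻ q', {q | T.AgeAdmissible q}ᶜ.indicator 1 q'
      ∂(T.freshTransKer ∘ₖ leaveKer T.agedKer) (q, t) = 0 := by
    rw [Kernel.lintegral_comp _ _ _ hf]
    refine (lintegral_congr fun q' => ?_).trans lintegral_zero
    rw [lintegral_indicator_one hS, compl_ofPred, ← ae_iff]
    exact T.ae_freshTransKer q'
  rw [ae_iff, ← compl_ofPred, ← lintegral_indicator_one hS, transKer, add_apply,
    lintegral_add_measure, h2, add_zero, lintegral_stayKer _ (by fun_prop) hf, agedKer_apply,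
    prod_fst_gt]
  obtain ⟨c, a⟩ := q
  cases c with
  | off x => simp [AgeAdmissible]
  | on =>
    have ha := (hq rfl).1
    rcases eq_or_ne (T.onLaw (Ioi (a + t))) 0 with h | h
    · have : T.ageLaw (.on, a) (Ioi (t : ℝ)) = 0 := by
        rw [← tailShift_univ, ageLaw_on, tailShift_smul, tailShift_tailShift _ _ t.coe_nonneg,
          Measure.smul_apply, tailShift_univ, h, smul_zero]
      simp [sojournLaw, this]
    · have : 0 ≤ a + t := add_nonneg ha t.coe_nonneg
      simp [AgeAdmissible, pos_iff_ne_zero.2 h, this]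

variable {T} in
/-- A channel stays in its initial state for a positive time, so two functionals that agree on the
paths with that property have the same expectation. -/
lemma AgeAdmissible.ageInt_congr {q : ChannelState Φ × ℝ} (hq : T.AgeAdmissible q)
    {G G' : (ℝ≥0 → ChannelState Φ) → (ℕ × ℕ → Bool) → ℝ≥0∞} (hG : PathMeasurable G)
    (hG' : PathMeasurable G')
    (h : ∀ τ : ℝ, 0 < τ → ∀ γ l, G (glue q.1 τ γ) l = G' (glue q.1 τ γ) l) :
    T.ageInt q G = T.ageInt q G' := by
  obtain ⟨c, a⟩ := q
  have := T.isProbabilityMeasure_ageLaw (q := (c, a)) fun hc => (hq hc).2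
  rw [ageInt, ageInt, T.pathInt_eq _ hG, T.pathInt_eq _ hG']
  have hpos : ∀ᵐ τ ∂T.sojournLaw (T.ageLaw (c, a)) c, 0 < τ := by
    rw [ae_iff]
    simp only [not_lt]
    cases c with
    | off x => exact expMeasure_Iic_zero (T.rate_pos x)
    | on =>
      change T.ageLaw (.on, a) (Iic 0) = 0
      rw [ageLaw_on, Measure.smul_apply, tailShift_apply _ _ measurableSet_Iic]
      rw [show {y : ℝ | y - a ∈ Iic 0 ∧ a < y} = ∅ by ext y; simp, measure_empty, smul_zero]
  refine lintegral_congr_ae ?_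
  filter_upwards [hpos] with τ hτ
  simp only [h τ hτ]

variable {T} in
/-- **Markov property** of the process, with the age of the ON period as part of the state. -/
lemma Admissible.processKer_shift {z : TcpStart Φ} (hz : T.Admissible z)
    {B : Set (ℕ → TcpState Φ)} (hB : MeasurableSet B) :
    T.processKer z {x | (fun n => x (n + 1)) ∈ B} = ∫⁻ z', T.processKer z' B ∂T.stepKer z := by
  obtain ⟨hX, hq⟩ := (T.admissible_iff z).1 hz
  have hi : Measurable (B.indicator (1 : (ℕ → TcpState Φ) → ℝ≥0∞)) := measurable_one.indicator hB
  have hsh : MeasurableSet {x : ℕ → TcpState Φ | (fun n => x (n + 1)) ∈ B} :=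
    (measurable_pi_lambda _ fun n => measurable_pi_apply (n + 1)) hB
  set G : (ℝ≥0 → ChannelState Φ) → (ℕ × ℕ → Bool) → ℝ≥0∞ := fun γ l =>
    B.indicator 1 (T.tcpSeq (T.step z.1 (γ 0) (∃ i < z.1.2.2.1, l (0, i) = true)) γ
      fun i => l (i.1 + 1, i.2)) with hGdef
  have hG : PathMeasurable G := by
    intro A _ γ l hγ hl
    refine hi.comp (T.measurable_tcpSeq (T.measurable_step measurable_const
      (hγ.comp (measurable_id.prodMk measurable_const)) (measurable_loss measurable_const ?_)) hγ ?_)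
    · exact measurable_pi_lambda _ fun i => (measurable_pi_apply (0, i)).comp hl
    · exact measurable_pi_lambda _ fun i => (measurable_pi_apply (i.1 + 1, i.2)).comp hl
  have hG1 (γ l) : G γ l ≤ 1 := indicator_le_self' (fun _ _ => zero_le) _
  have h1 : T.processKer z {x | (fun n => x (n + 1)) ∈ B}
      = T.ageInt (z.1.1, z.2) fun γ l => G (fun s => γ (z.1.2.1.toNNReal + s)) l := by
    rw [T.processKer_apply z hsh]
    congr 1
    funext γ l
    change B.indicator 1 (fun n => T.tcpSeq z.1 γ l (n + 1)) = _
    exact congrArg (B.indicator 1) (funext fun n => T.tcpSeq_succ z.1 γ l n)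
  rw [h1, T.ageInt_shift hG hG1 (fun h => (hq h).2),
    T.lintegral_stepKer z (T.processKer.measurable_coe hB)]
  refine lintegral_congr_ae ?_
  filter_upwards [hq.ae_transKer _] with q' hq'
  have hG' : PathMeasurable fun γ l => B.indicator (1 : (ℕ → TcpState Φ) → ℝ≥0∞)
      (T.tcpSeq (T.step z.1 q'.1 (∃ i < z.1.2.2.1, l (0, i) = true)) γ
        fun i => l (i.1 + 1, i.2)) := by
    intro A _ γ l hγ hl
    refine hi.comp (T.measurable_tcpSeq (T.measurable_step measurable_const
      measurable_const (measurable_loss measurable_const ?_)) hγ ?_)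
    · exact measurable_pi_lambda _ fun i => (measurable_pi_apply (0, i)).comp hl
    · exact measurable_pi_lambda _ fun i => (measurable_pi_apply (i.1 + 1, i.2)).comp hl
  rw [hq'.ageInt_congr hG hG' fun τ hτ γ l => by
    simp only [hGdef, glue_of_lt q'.1 (s := 0) (by simpa using hτ)]]
  have := T.isProbabilityMeasure_ageLaw fun h => (hq' h).2
  have hm : Measurable fun v : (ℕ → Bool) × Drive Φ => B.indicator (1 : (ℕ → TcpState Φ) → ℝ≥0∞)
      (T.tcpSeq (T.step z.1 q'.1 (∃ i < z.1.2.2.1, v.1 i = true)) (T.path q'.1 v.2) v.2.lost) :=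
    hi.comp (T.measurable_tcpSeq (T.measurable_step measurable_const
      measurable_const (measurable_loss measurable_const measurable_fst))
        (T.measurable_path measurable_const (by fun_prop) (by fun_prop))
        (measurable_lost.comp measurable_snd))
  calc _ = ∫⁻ v, B.indicator (1 : (ℕ → TcpState Φ) → ℝ≥0∞)
          (T.tcpSeq (T.step z.1 q'.1 (∃ i < z.1.2.2.1, v.1 i = true)) (T.path q'.1 v.2) v.2.lost)
        ∂T.windowLaw.prod (T.driveLawOf (T.ageLaw q')) := by
        rw [← (measurePreserving_shiftLost T (T.ageLaw q')).lintegral_comp hm]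
        simp only [path_shiftLost]
        rfl
    _ = _ := by
        rw [lintegral_prod _ hm.aemeasurable]
        refine lintegral_congr fun l => ?_
        rw [T.processKer_apply _ hB, step_fst]
        rfl

end Measurability

end

end TcpModel

/-! ### Regenerative processes with a Markov coding -/

section Regenerative

variable {Z X : Type*} [MeasurableSpace Z] [MeasurableSpace X]

/-- `Q z` is the law of a random sequence in `X` for the initial condition `z`; the initial
conditions in `D` are stable under the transition kernel `P`, which restarts the sequence after
one step; the first term of the sequence is the `X`-valued part `s z` of the initial condition, and
at the value `s z₀` that part determines the law of the sequence. -/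
structure IsRegenerative (P : Kernel Z Z) (Q : Kernel Z (ℕ → X)) (D : Set Z) (s : Z → X)
    (z₀ : Z) : Prop where
  measurable_state : Measurable s
  measurableSet : MeasurableSet D
  start_mem : z₀ ∈ D
  isProb : ∀ z ∈ D, IsProbabilityMeasure (Q z)
  ae_mem : ∀ z ∈ D, ∀ᵐ z' ∂P z, z' ∈ D
  ae_start : ∀ z ∈ D, ∀ᵐ x ∂Q z, x 0 = s z
  markov : ∀ z ∈ D, ∀ B, MeasurableSet B →
    Q z {x | (fun n => x (1 + n)) ∈ B} = ∫⁻ z', Q z' B ∂P z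
  regen : ∀ z ∈ D, s z = s z₀ → Q z = Q z₀

/-- The `n`-step transition kernel. -/
noncomputable def iterKer (P : Kernel Z Z) : ℕ → Kernel Z Z
  | 0 => Kernel.id
  | n + 1 => iterKer P n ∘ₖ P

lemma measurableSet_tail (k : ℕ) {B : Set (ℕ → X)} (hB : MeasurableSet B) :
    MeasurableSet {x : ℕ → X | (fun n => x (k + n)) ∈ B} :=
  (measurable_pi_lambda _ fun n => measurable_pi_apply (k + n)) hB

lemma measurableSet_coord (k : ℕ) {A : Set X} (hA : MeasurableSet A) :
    MeasurableSet {x : ℕ → X | x k ∈ A} := measurable_pi_apply k hA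

namespace IsRegenerative

variable {P : Kernel Z Z} {Q : Kernel Z (ℕ → X)} {D : Set Z} {s : Z → X} {z₀ : Z}
  (h : IsRegenerative P Q D s z₀)
include h

lemma ae_mem_iter {z : Z} (hz : z ∈ D) (k : ℕ) : ∀ᵐ z' ∂iterKer P k z, z' ∈ D := by
  induction k generalizing z with
  | zero => exact (ae_dirac_iff h.measurableSet).2 hz
  | succ k ih =>
    refine Kernel.ae_comp_of_ae_ae h.measurableSet ?_
    filter_upwards [h.ae_mem z hz] with z' hz' using ih hz'

/-- The Markov property after `k` steps. -/
lemma markov_iter {z : Z} (hz : z ∈ D) (k : ℕ) {B : Set (ℕ → X)} (hB : MeasurableSet B) :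
    Q z {x | (fun n => x (k + n)) ∈ B} = ∫⁻ z', Q z' B ∂iterKer P k z := by
  induction k generalizing z with
  | zero =>
    simp only [zero_add, iterKer, Kernel.id_apply, lintegral_dirac' _ (Q.measurable_coe hB)]
    rfl
  | succ k ih =>
    have := h.markov z hz _ (measurableSet_tail k hB)
    rw [iterKer, Kernel.lintegral_comp _ _ _ (Q.measurable_coe hB)]
    refine Eq.trans ?_ (this.trans (lintegral_congr_ae ?_))
    · simp only [mem_ofPred_eq]
      congr! 4 with x
      ext n
      congr 1
      omega
    · filter_upwards [h.ae_mem z hz] with z' hz' using ih hz'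

lemma start_inter {z : Z} (hz : z ∈ D) (A : Set X) (B : Set (ℕ → X)) :
    Q z {x | x 0 ∈ A ∧ x ∈ B} = (s ⁻¹' A).indicator (fun z => Q z B) z := by
  by_cases hA : s z ∈ A
  · rw [indicator_of_mem (show z ∈ s ⁻¹' A from hA)]
    refine measure_congr ?_
    filter_upwards [h.ae_start z hz] with x hx
    exact propext ⟨fun h => h.2, fun h => ⟨hx ▸ hA, h⟩⟩
  · rw [indicator_of_notMem (show z ∉ s ⁻¹' A from hA)]
    refine measure_mono_null (fun x hx => ?_) (ae_iff.1 (h.ae_start z hz))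
    exact fun heq => hA (heq ▸ hx.1)

lemma measure_tail {z : Z} (hz : z ∈ D) (k : ℕ) {A : Set X} (hA : MeasurableSet A)
    {B : Set (ℕ → X)} (hB : MeasurableSet B) :
    Q z {x | x k ∈ A ∧ (fun n => x (k + n)) ∈ B}
      = ∫⁻ z' in s ⁻¹' A, Q z' B ∂iterKer P k z := by
  rw [← lintegral_indicator (h.measurable_state hA)]
  refine (h.markov_iter hz k (B := {x | x 0 ∈ A ∧ x ∈ B})
    ((measurableSet_coord 0 hA).inter hB)).trans (lintegral_congr_ae ?_)
  filter_upwards [h.ae_mem_iter hz k] with z' hz' using h.start_inter hz' A B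

lemma measure_coord {z : Z} (hz : z ∈ D) (k : ℕ) {A : Set X} (hA : MeasurableSet A) :
    Q z {x | x k ∈ A} = iterKer P k z (s ⁻¹' A) := by
  have := h.measure_tail hz k hA MeasurableSet.univ
  simp only [mem_univ, and_true] at this
  rw [this, ← setLIntegral_one]
  refine setLIntegral_congr_fun_ae (h.measurable_state hA) ?_
  filter_upwards [h.ae_mem_iter hz k] with z' hz' _
  have := h.isProb z' hz'
  exact measure_univ

lemma isProb_iter {z : Z} (hz : z ∈ D) (k : ℕ) : IsProbabilityMeasure (iterKer P k z) := by
  have := h.isProb z hz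
  have h1 := h.measure_coord hz k MeasurableSet.univ
  simp only [mem_univ, preimage_univ] at h1
  exact ⟨h1.symm.trans measure_univ⟩

/-- If the future from time `k` on lies in `B` with probability at least `η` whatever state in `A`
is found then, the corresponding lower bound holds at the start. -/
lemma mul_le_measure_tail {z : Z} (hz : z ∈ D) (k : ℕ) {A : Set X} (hA : MeasurableSet A)
    {B : Set (ℕ → X)} (hB : MeasurableSet B) {η : ℝ≥0∞} (hη : ∀ z ∈ D, s z ∈ A → η ≤ Q z B) :
    η * Q z {x | x k ∈ A} ≤ Q z {x | x k ∈ A ∧ (fun n => x (k + n)) ∈ B} := by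
  rw [h.measure_coord hz k hA, h.measure_tail hz k hA hB, ← setLIntegral_const]
  refine setLIntegral_mono_ae (Q.measurable_coe hB).aemeasurable ?_
  filter_upwards [h.ae_mem_iter hz k] with z' hz' hA' using hη z' hz' hA'

lemma toReal_lintegral_mem_Icc {ν : Measure Z} [IsProbabilityMeasure ν] (hν : ∀ᵐ z ∂ν, z ∈ D)
    {B : Set (ℕ → X)} (hB : MeasurableSet B) {a b : ℝ} (hab : ∀ z ∈ D, (Q z).real B ∈ Icc a b) :
    (∫⁻ z, Q z B ∂ν).toReal ∈ Icc a b := by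
  have hgm : Measurable fun z => (Q z).real B := (Q.measurable_coe hB).ennreal_toReal
  have hgi : Integrable (fun z => (Q z).real B) ν := by
    refine Integrable.of_mem_Icc a b hgm.aemeasurable ?_
    filter_upwards [hν] with z hz using hab z hz
  have hint : (∫⁻ z, Q z B ∂ν).toReal = ∫ z, (Q z).real B ∂ν := by
    refine (integral_toReal (Q.measurable_coe hB).aemeasurable ?_).symm
    filter_upwards [hν] with z hz
    have := h.isProb z hz
    exact measure_lt_top _ _
  rw [hint]
  constructor
  · calc a = ∫ _, a ∂ν := by simp
      _ ≤ _ := integral_mono_ae (integrable_const _) hgi (by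
        filter_upwards [hν] with z hz using (hab z hz).1)
  · calc _ ≤ ∫ _, b ∂ν := integral_mono_ae hgi (integrable_const _) (by
        filter_upwards [hν] with z hz using (hab z hz).2)
      _ = b := by simp

variable [MeasurableSingletonClass X]

/-- If the regeneration state is hit after `m` steps with probability at least `ε`, the hitting
time of that state has a geometric tail. -/
lemma measure_avoid_le {m : ℕ} {ε : ℝ≥0∞} (hε : ∀ z ∈ D, ε ≤ Q z {x | x m = s z₀}) (n : ℕ)
    {z : Z} (hz : z ∈ D) :
    Q z {x | ∀ j < n, x (m * (j + 1)) ≠ s z₀} ≤ (1 - ε) ^ n := by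
  induction n generalizing z with
  | zero =>
    have := h.isProb z hz
    simp
  | succ n ih =>
    have hA : MeasurableSet ({s z₀}ᶜ : Set X) := (measurableSet_singleton _).compl
    have hB : MeasurableSet {x : ℕ → X | ∀ j < n, x (m * (j + 1)) ≠ s z₀} := by
      simp only [ofPred_forall]
      exact MeasurableSet.iInter fun j => MeasurableSet.iInter fun _ => measurableSet_coord _ hA
    have hset : {x : ℕ → X | ∀ j < n + 1, x (m * (j + 1)) ≠ s z₀}
        = {x | x m ∈ ({s z₀}ᶜ : Set X) ∧
          (fun i => x (m + i)) ∈ {x : ℕ → X | ∀ j < n, x (m * (j + 1)) ≠ s z₀}} := by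
      ext x
      have : (∀ j < n + 1, x (m * (j + 1)) ≠ s z₀) ↔
          x (m * (0 + 1)) ≠ s z₀ ∧ ∀ j < n, x (m * (j + 1 + 1)) ≠ s z₀ :=
        ⟨fun H => ⟨H 0 (by omega), fun j hj => H (j + 1) (by omega)⟩,
          fun H j hj => by
            cases j with
            | zero => exact H.1
            | succ j => exact H.2 j (by omega)⟩
      simp only [mem_ofPred_eq, this, zero_add, mul_one, mem_compl_iff, mem_singleton_iff]
      simp only [show ∀ j, m * (j + 1 + 1) = m + m * (j + 1) by intro j; ring, ne_eq]
    have := h.isProb z hz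
    rw [hset, h.measure_tail hz m hA hB]
    calc _ ≤ ∫⁻ z' in s ⁻¹' {s z₀}ᶜ, (1 - ε) ^ n ∂iterKer P m z := by
          refine setLIntegral_mono_ae measurable_const.aemeasurable ?_
          filter_upwards [h.ae_mem_iter hz m] with z' hz' _ using ih hz'
      _ = (1 - ε) ^ n * Q z {x | x m ∈ ({s z₀}ᶜ : Set X)} := by
          rw [setLIntegral_const, h.measure_coord hz m hA]
      _ ≤ (1 - ε) ^ n * (1 - ε) := by
          gcongr
          have hm : MeasurableSet {x : ℕ → X | x m = s z₀} :=
            measurableSet_coord m (measurableSet_singleton (s z₀))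
          exact (prob_compl_eq_one_sub hm).trans_le (tsub_le_tsub_left (hε z hz) 1)
      _ = _ := (pow_succ _ _).symm

/-- Two initial laws give the same law to the state at time `k`, up to an error that is geometric
in `k`: the oscillation over the initial conditions contracts by `1 - ε` in `m` steps. -/
lemma exists_bounds {m : ℕ} {ε : ℝ} (hε : ∀ z ∈ D, ε ≤ (Q z).real {x | x m = s z₀})
    {A : Set X} (hA : MeasurableSet A) (l n : ℕ) :
    ∃ a b : ℝ, b - a ≤ (1 - ε) ^ n ∧ ∀ z ∈ D, (Q z).real {x | x (m * n + l) ∈ A} ∈ Icc a b := by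
  have hε1 : ε ≤ 1 := by
    have := h.isProb z₀ h.start_mem
    exact (hε z₀ h.start_mem).trans measureReal_le_one
  induction n with
  | zero =>
    refine ⟨0, 1, by simp, fun z hz => ?_⟩
    have := h.isProb z hz
    exact ⟨measureReal_nonneg, measureReal_le_one⟩
  | succ n ih =>
    obtain ⟨a, b, hab, hbd⟩ := ih
    set i := m * n + l with hi
    set g : Z → ℝ := fun z => (Q z).real {x | x i ∈ A} with hg
    set c := g z₀ with hc
    have hc1 := hbd z₀ h.start_mem
    have hE : MeasurableSet (s ⁻¹' {s z₀}) := h.measurable_state (measurableSet_singleton _)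
    have hgm : Measurable g := (Q.measurable_coe (measurableSet_coord i hA)).ennreal_toReal
    refine ⟨a + (c - a) * ε, b - (b - c) * ε, ?_, fun z hz => ?_⟩
    · rw [pow_succ]
      nlinarith
    have := h.isProb z hz
    have := h.isProb_iter hz m
    have hD := h.ae_mem_iter hz m
    have hgi : Integrable g (iterKer P m z) := by
      refine Integrable.of_mem_Icc a b hgm.aemeasurable ?_
      filter_upwards [hD] with z' hz' using hbd z' hz'
    have hint : (Q z).real {x | x (m * (n + 1) + l) ∈ A} = ∫ z', g z' ∂iterKer P m z := by
      have := h.markov_iter hz m (measurableSet_coord i hA)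
      rw [show m * (n + 1) + l = m + i by rw [hi]; ring, Measure.real]
      simp only [mem_ofPred_eq] at this
      rw [this, hg]
      refine (integral_toReal (Q.measurable_coe (measurableSet_coord i hA)).aemeasurable ?_).symm
      filter_upwards [hD] with z' hz'
      have := h.isProb z' hz'
      exact measure_lt_top _ _
    have hp : ε ≤ (iterKer P m z).real (s ⁻¹' {s z₀}) := by
      refine (hε z hz).trans_eq ?_
      exact congrArg ENNReal.toReal (h.measure_coord hz m (measurableSet_singleton (s z₀)))
    have hgc {z' : Z} (hz' : z' ∈ D) (hs : z' ∈ s ⁻¹' {s z₀}) : g z' = c := by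
      simp only [hc, hg, h.regen z' hz' hs]
    have hind (u v : ℝ) : ∫ z', (u + (s ⁻¹' {s z₀}).indicator (fun _ => v) z') ∂iterKer P m z
        = u + v * (iterKer P m z).real (s ⁻¹' {s z₀}) := by
      rw [integral_add (integrable_const _) ((integrable_const _).indicator hE),
        integral_indicator_const _ hE]
      simp [mul_comm]
    have hii (u v : ℝ) : Integrable (fun z' => u + (s ⁻¹' {s z₀}).indicator (fun _ => v) z')
        (iterKer P m z) := (integrable_const _).add ((integrable_const _).indicator hE)
    rw [hint]
    constructor
    · calc a + (c - a) * ε ≤ a + (c - a) * (iterKer P m z).real (s ⁻¹' {s z₀}) := by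
            have := hc1.1
            gcongr
        _ = _ := (hind a (c - a)).symm
        _ ≤ _ := by
            refine integral_mono_ae (hii _ _) hgi ?_
            filter_upwards [hD] with z' hz'
            by_cases hs : z' ∈ s ⁻¹' {s z₀}
            · simp only [indicator_of_mem hs, hgc hz' hs]; linarith
            · simp only [indicator_of_notMem hs, add_zero]; exact (hbd z' hz').1
    · calc _ ≤ _ := by
            refine integral_mono_ae hgi (hii b (c - b)) ?_
            filter_upwards [hD] with z' hz'
            by_cases hs : z' ∈ s ⁻¹' {s z₀}
            · simp only [indicator_of_mem hs, hgc hz' hs]; linarith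
            · simp only [indicator_of_notMem hs, add_zero]; exact (hbd z' hz').2
        _ = _ := hind b (c - b)
        _ ≤ b - (b - c) * ε := by
            have := hc1.2
            nlinarith

lemma abs_sub_le {m : ℕ} {ε : ℝ} (hε : ∀ z ∈ D, ε ≤ (Q z).real {x | x m = s z₀})
    {ν ν' : Measure Z} [IsProbabilityMeasure ν] [IsProbabilityMeasure ν'] (hν : ∀ᵐ z ∂ν, z ∈ D)
    (hν' : ∀ᵐ z ∂ν', z ∈ D) {A : Set X} (hA : MeasurableSet A) (k : ℕ) :
    |(∫⁻ z, Q z {x | x k ∈ A} ∂ν).toReal - (∫⁻ z, Q z {x | x k ∈ A} ∂ν').toReal|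
      ≤ (1 - ε) ^ (k / m) := by
  obtain ⟨a, b, hab, hbd⟩ := h.exists_bounds hε hA (k % m) (k / m)
  rw [Nat.div_add_mod] at hbd
  have h1 := h.toReal_lintegral_mem_Icc hν (measurableSet_coord k hA) hbd
  have h2 := h.toReal_lintegral_mem_Icc hν' (measurableSet_coord k hA) hbd
  rw [abs_le]
  constructor <;> linarith [h1.1, h1.2, h2.1, h2.2]

end IsRegenerative

end Regenerative

/-! ### Return times and the occupation measure of a cycle -/

section Return

variable {X : Type*}

/-- First positive time at which the sequence `x` takes the value `r`. -/
noncomputable def returnTime (r : X) (x : ℕ → X) : ℕ∞ :=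
  ⨅ k ∈ {k : ℕ | 1 ≤ k ∧ x k = r}, (k : ℕ∞)

lemma lt_returnTime_iff {r : X} {x : ℕ → X} {k : ℕ} :
    (k : ℕ∞) < returnTime r x ↔ ∀ j, 1 ≤ j → j ≤ k → x j ≠ r := by
  rw [← not_le, ← not_iff_not, not_not]
  push Not
  constructor
  · intro hle
    by_contra! hcon
    have : ((k + 1 : ℕ) : ℕ∞) ≤ returnTime r x := by
      refine le_iInf₂ fun j hj => ?_
      have : ¬ j ≤ k := fun hjk => hcon j hj.1 hjk hj.2
      exact_mod_cast (by omega : k + 1 ≤ j)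
    have := this.trans hle
    have : k + 1 ≤ k := by exact_mod_cast this
    omega
  · rintro ⟨j, h1, h2, h3⟩
    exact (iInf₂_le j ⟨h1, h3⟩).trans (by exact_mod_cast h2)

lemma returnTime_eq_coe {r : X} {x : ℕ → X} {k : ℕ} (hk : x (k + 1) = r)
    (h : ∀ j, 1 ≤ j → j ≤ k → x j ≠ r) : returnTime r x = (k + 1 : ℕ) := by
  refine le_antisymm (iInf₂_le (k + 1) ⟨by omega, hk⟩) ?_
  have := lt_returnTime_iff.2 h
  rw [Nat.cast_add, Nat.cast_one]
  exact Order.add_one_le_of_lt this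

/-- Number of visits to `A` before the first return to `r`. -/
noncomputable def visits (r : X) (A : Set X) (x : ℕ → X) : ℝ≥0∞ :=
  ∑' k : ℕ, indicator {k : ℕ | (k : ℕ∞) < returnTime r x ∧ x k ∈ A} 1 k

lemma tsum_indicator_lt (N : ℕ∞) :
    ∑' k : ℕ, indicator {k : ℕ | (k : ℕ∞) < N} (1 : ℕ → ℝ≥0∞) k = (N : ℝ≥0∞) := by
  cases N with
  | top => simp
  | coe n =>
    rw [tsum_eq_sum (s := Finset.range n)]
    · rw [Finset.sum_congr rfl (g := fun _ => 1)]
      · simp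
      · intro k hk
        simpa [indicator] using hk
    · intro k hk
      simpa [indicator] using hk

lemma visits_univ (r : X) (x : ℕ → X) : visits r univ x = (returnTime r x : ℝ≥0∞) := by
  simp [visits, ← tsum_indicator_lt]

variable {Z : Type*} [MeasurableSpace Z] [MeasurableSpace X]

lemma measurableSet_lt_returnTime [MeasurableSingletonClass X] (r : X) (k : ℕ) :
    MeasurableSet {x : ℕ → X | (k : ℕ∞) < returnTime r x} := by
  simp only [lt_returnTime_iff, ofPred_forall]
  exact MeasurableSet.iInter fun j => MeasurableSet.iInter fun _ => MeasurableSet.iInter fun _ =>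
    measurableSet_coord j (measurableSet_singleton r).compl

lemma measurableSet_returnTime_eq [MeasurableSingletonClass X] (r : X) (n : ℕ) :
    MeasurableSet {x : ℕ → X | returnTime r x = n} := by
  have : {x : ℕ → X | returnTime r x = n} = {x | (n : ℕ∞) < returnTime r x}ᶜ ∩
      ⋂ k : ℕ, ⋂ _ : k < n, {x | (k : ℕ∞) < returnTime r x} := by
    ext x
    simp only [mem_ofPred_eq, mem_inter_iff, mem_compl_iff, not_lt, mem_iInter]
    refine ⟨fun h => ⟨h.le, fun k hk => by rw [h]; exact_mod_cast hk⟩, fun ⟨h1, h2⟩ => ?_⟩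
    obtain ⟨m, hm⟩ := ENat.ne_top_iff_exists.1 (h1.trans_lt (ENat.natCast_lt_top n)).ne
    rw [← hm] at h1 h2 ⊢
    have h1 : m ≤ n := by exact_mod_cast h1
    rcases h1.lt_or_eq with h | rfl
    · exact absurd (h2 m h) (lt_irrefl _)
    · rfl
  rw [this]
  exact (measurableSet_lt_returnTime r n).compl.inter (MeasurableSet.iInter fun k =>
    MeasurableSet.iInter fun _ => measurableSet_lt_returnTime r k)

lemma measurable_visits [MeasurableSingletonClass X] (r : X) {A : Set X} (hA : MeasurableSet A) :
    Measurable (visits r A) :=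
  Measurable.tsum fun k => measurable_one.indicator
    ((measurableSet_lt_returnTime r k).inter (measurableSet_coord k hA))

namespace IsRegenerative

/-- Law, up to time `k` of the cycle that starts at `z₀`, of the coding state at time `k`, on the
event that the cycle is not over then. -/
noncomputable def tabooLaw (P : Kernel Z Z) (s : Z → X) (z₀ : Z) : ℕ → Measure Z
  | 0 => Measure.dirac z₀
  | k + 1 => ((tabooLaw P s z₀ k).bind P).restrict (s ⁻¹' {s z₀}ᶜ)

/-- Expected occupation measure of a cycle. -/
noncomputable def occupation (P : Kernel Z Z) (s : Z → X) (z₀ : Z) : Measure Z :=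
  Measure.sum (tabooLaw P s z₀)

variable {P : Kernel Z Z} {Q : Kernel Z (ℕ → X)} {D : Set Z} {s : Z → X} {z₀ : Z}
  (h : IsRegenerative P Q D s z₀)
include h

lemma ae_mem_bind {m : Measure Z} (hm : ∀ᵐ z ∂m, z ∈ D) : ∀ᵐ z ∂m.bind P, z ∈ D := by
  have hD := h.measurableSet.compl
  have h0 : m.bind P Dᶜ = 0 := by
    rw [Measure.bind_apply hD P.aemeasurable, lintegral_eq_zero_iff (P.measurable_coe hD)]
    filter_upwards [hm] with z hz using ae_iff.1 (h.ae_mem z hz)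
  exact h0

lemma ae_mem_tabooLaw (k : ℕ) : ∀ᵐ z ∂tabooLaw P s z₀ k, z ∈ D := by
  induction k with
  | zero => exact (ae_dirac_iff h.measurableSet).2 h.start_mem
  | succ k ih => exact ae_restrict_of_ae (h.ae_mem_bind ih)

lemma ae_mem_occupation : ∀ᵐ z ∂occupation P s z₀, z ∈ D :=
  Measure.ae_sum_iff.2 h.ae_mem_tabooLaw

variable [MeasurableSingletonClass X]

lemma lintegral_tabooLaw (k : ℕ) {B : Set (ℕ → X)} (hB : MeasurableSet B) :
    ∫⁻ z, Q z B ∂tabooLaw P s z₀ k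
      = Q z₀ {x | (k : ℕ∞) < returnTime (s z₀) x ∧ (fun n => x (k + n)) ∈ B} := by
  have hA : MeasurableSet ({s z₀}ᶜ : Set X) := (measurableSet_singleton _).compl
  induction k generalizing B with
  | zero =>
    rw [tabooLaw, lintegral_dirac' _ (Q.measurable_coe hB)]
    congr 1
    ext x
    have : ((0 : ℕ) : ℕ∞) < returnTime (s z₀) x := lt_returnTime_iff.2 fun j h1 h2 => by omega
    simp only [zero_add, mem_ofPred_eq, this, true_and]
  | succ k ih =>
    have hAB : MeasurableSet {x : ℕ → X | x 0 ∈ ({s z₀}ᶜ : Set X) ∧ x ∈ B} :=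
      (measurableSet_coord 0 hA).inter hB
    rw [tabooLaw, ← lintegral_indicator (h.measurable_state hA), Measure.lintegral_bind
      P.aemeasurable ((Q.measurable_coe hB).indicator (h.measurable_state hA)).aemeasurable]
    calc _ = ∫⁻ z, Q z {x | (fun n => x (1 + n)) ∈ {x | x 0 ∈ ({s z₀}ᶜ : Set X) ∧ x ∈ B}}
          ∂tabooLaw P s z₀ k := by
          refine lintegral_congr_ae ?_
          filter_upwards [h.ae_mem_tabooLaw k] with z hz
          refine Eq.trans (lintegral_congr_ae ?_) (h.markov z hz _ hAB).symm
          filter_upwards [h.ae_mem z hz] with z' hz' using (h.start_inter hz' _ B).symm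
      _ = _ := by
          rw [ih (measurableSet_tail 1 hAB)]
          congr 1
          ext x
          have : ((k + 1 : ℕ) : ℕ∞) < returnTime (s z₀) x ↔
              (k : ℕ∞) < returnTime (s z₀) x ∧ x (k + 1) ≠ s z₀ := by
            simp only [lt_returnTime_iff]
            refine ⟨fun H => ⟨fun j h1 h2 => H j h1 (by omega), H _ (by omega) le_rfl⟩,
              fun H j h1 h2 => ?_⟩
            rcases Nat.lt_or_ge k j with h3 | h3
            · rw [show j = k + 1 by omega]; exact H.2
            · exact H.1 j h1 h3
          simp only [mem_ofPred_eq, this, and_assoc, add_zero, mem_compl_iff, mem_singleton_iff,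
            ne_eq, add_assoc]

lemma tabooLaw_apply (k : ℕ) {A : Set X} (hA : MeasurableSet A) :
    tabooLaw P s z₀ k (s ⁻¹' A)
      = Q z₀ {x | (k : ℕ∞) < returnTime (s z₀) x ∧ x k ∈ A} := by
  have := h.lintegral_tabooLaw k (measurableSet_coord 0 hA)
  simp only [mem_ofPred_eq, add_zero] at this
  rw [← this, ← lintegral_indicator_one (h.measurable_state hA)]
  refine lintegral_congr_ae ?_
  filter_upwards [h.ae_mem_tabooLaw k] with z hz
  have h1 := h.start_inter hz A univ
  have := h.isProb z hz
  simp only [mem_univ, and_true] at h1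
  rw [h1]
  simp [indicator]

lemma tabooLaw_univ (k : ℕ) :
    tabooLaw P s z₀ k univ = Q z₀ {x | (k : ℕ∞) < returnTime (s z₀) x} := by
  simpa using h.tabooLaw_apply k MeasurableSet.univ

/-- The occupation measure of the states is the expected number of visits in a cycle. -/
lemma occupation_apply {A : Set X} (hA : MeasurableSet A) :
    occupation P s z₀ (s ⁻¹' A) = ∫⁻ x, visits (s z₀) A x ∂Q z₀ := by
  have hm (k : ℕ) : MeasurableSet {x : ℕ → X | (k : ℕ∞) < returnTime (s z₀) x ∧ x k ∈ A} :=
    (measurableSet_lt_returnTime _ k).inter (measurableSet_coord k hA)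
  rw [occupation, Measure.sum_apply _ (h.measurable_state hA)]
  have hv : (fun x => visits (s z₀) A x) = fun x => ∑' k : ℕ,
      {x : ℕ → X | (k : ℕ∞) < returnTime (s z₀) x ∧ x k ∈ A}.indicator 1 x := rfl
  rw [hv, lintegral_tsum fun k => (measurable_one.indicator (hm k)).aemeasurable]
  exact tsum_congr fun k => by rw [lintegral_indicator_one (hm k), h.tabooLaw_apply k hA]

/-- The occupation measure of a cycle is an initial law that makes the sequence stationary (up to
normalisation): a step moves the law at each time of the cycle to the next, and at the end of the
cycle a new cycle begins. -/
lemma occupation_stationary (hN : ∀ᵐ x ∂Q z₀, returnTime (s z₀) x ≠ ⊤) {B : Set (ℕ → X)}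
    (hB : MeasurableSet B) :
    ∫⁻ z, Q z {x | (fun n => x (1 + n)) ∈ B} ∂occupation P s z₀
      = ∫⁻ z, Q z B ∂occupation P s z₀ := by
  have := h.isProb z₀ h.start_mem
  have hr : MeasurableSet ({s z₀} : Set X) := measurableSet_singleton _
  have hE : MeasurableSet (s ⁻¹' {s z₀}) := h.measurable_state hr
  have hQ := Q.measurable_coe hB
  -- probability that the cycle ends at time `k + 1`
  set u : ℕ → ℝ≥0∞ := fun k => (tabooLaw P s z₀ k).bind P (s ⁻¹' {s z₀}) with hu
  have hstep (k : ℕ) : ∫⁻ z, Q z {x | (fun n => x (1 + n)) ∈ B} ∂tabooLaw P s z₀ k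
      = u k * Q z₀ B + ∫⁻ z, Q z B ∂tabooLaw P s z₀ (k + 1) := by
    have hD := h.ae_mem_bind (h.ae_mem_tabooLaw k)
    calc _ = ∫⁻ z, ∫⁻ z', Q z' B ∂P z ∂tabooLaw P s z₀ k := by
          refine lintegral_congr_ae ?_
          filter_upwards [h.ae_mem_tabooLaw k] with z hz using h.markov z hz B hB
      _ = ∫⁻ z', Q z' B ∂(tabooLaw P s z₀ k).bind P :=
          (Measure.lintegral_bind P.aemeasurable hQ.aemeasurable).symm
      _ = _ := by
          rw [← lintegral_add_compl _ hE, tabooLaw, ← preimage_compl, mul_comm,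
            ← setLIntegral_const]
          congr 1
          refine setLIntegral_congr_fun_ae hE ?_
          filter_upwards [hD] with z hz hzE
          rw [h.regen z hz hzE]
  have hmass (k : ℕ) : tabooLaw P s z₀ k univ = u k + tabooLaw P s z₀ (k + 1) univ := by
    have h1 : (tabooLaw P s z₀ k).bind P univ = tabooLaw P s z₀ k univ := by
      rw [Measure.bind_apply MeasurableSet.univ P.aemeasurable, ← lintegral_one]
      refine lintegral_congr_ae ?_
      filter_upwards [h.ae_mem_tabooLaw k] with z hz
      have h2 := h.isProb z hz
      have h3 := h.markov z hz univ MeasurableSet.univ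
      simp only [mem_univ, ofPred_true, measure_univ] at h3
      rw [h3, ← setLIntegral_univ, ← setLIntegral_one, setLIntegral_univ, setLIntegral_univ]
      refine lintegral_congr_ae ?_
      filter_upwards [h.ae_mem z hz] with z' hz'
      have := h.isProb z' hz'
      exact measure_univ.symm
    rw [← h1, tabooLaw, Measure.restrict_apply_univ, hu, preimage_compl,
      measure_add_measure_compl hE]
  have hu1 : ∑' k, u k = 1 := by
    have hpart (n : ℕ) : ∑ k ∈ Finset.range n, u k + tabooLaw P s z₀ n univ = 1 := by
      induction n with
      | zero => simp [tabooLaw]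
      | succ n ih => rw [Finset.sum_range_succ, add_assoc, ← hmass, ih]
    have hlim : Tendsto (fun n => tabooLaw P s z₀ n univ) atTop (𝓝 0) := by
      simp only [h.tabooLaw_univ]
      have hanti : Antitone fun k : ℕ => {x : ℕ → X | (k : ℕ∞) < returnTime (s z₀) x} :=
        fun a b hab x hx =>
          lt_of_le_of_lt (b := (b : ℕ∞)) (by exact_mod_cast hab) hx
      have := tendsto_measure_iInter_atTop (μ := Q z₀)
        (fun k => (measurableSet_lt_returnTime (s z₀) k).nullMeasurableSet) hanti
        ⟨0, measure_ne_top _ _⟩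
      have h0 : Q z₀ (⋂ k : ℕ, {x : ℕ → X | (k : ℕ∞) < returnTime (s z₀) x}) = 0 := by
        refine measure_mono_null (fun x hx => ?_) (ae_iff.1 hN)
        simp only [mem_iInter, mem_ofPred_eq, not_not] at hx ⊢
        exact ENat.eq_top_iff_forall_gt.2 hx
      rwa [h0] at this
    have hsum := (ENNReal.tendsto_nat_tsum u).add hlim
    simp only [hpart, add_zero] at hsum
    exact (tendsto_nhds_unique tendsto_const_nhds hsum).symm
  rw [occupation, lintegral_sum_measure, lintegral_sum_measure]
  simp only [hstep]
  rw [ENNReal.tsum_add, ENNReal.tsum_mul_right, hu1, one_mul,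
    tsum_eq_zero_add' (f := fun k => ∫⁻ z, Q z B ∂tabooLaw P s z₀ k) ENNReal.summable]
  congr 1
  rw [tabooLaw, lintegral_dirac' _ hQ]

lemma occupation_stationary_iter (hN : ∀ᵐ x ∂Q z₀, returnTime (s z₀) x ≠ ⊤) (k : ℕ)
    {B : Set (ℕ → X)} (hB : MeasurableSet B) :
    ∫⁻ z, Q z {x | (fun n => x (k + n)) ∈ B} ∂occupation P s z₀
      = ∫⁻ z, Q z B ∂occupation P s z₀ := by
  induction k with
  | zero => simp only [zero_add]; rfl
  | succ k ih =>
    rw [← ih, ← h.occupation_stationary hN (measurableSet_tail k hB)]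
    simp only [mem_ofPred_eq, add_assoc, add_comm, add_left_comm]

end IsRegenerative

end Return

/-! ### Random times with geometric tails -/

section GeometricTail

lemma pow_div_le_geometric {ε : ℝ} (h0 : 0 < ε) (h1 : ε < 1) {m : ℕ} (hm : m ≠ 0) :
    ∃ C ρ : ℝ, 0 < C ∧ 0 < ρ ∧ ρ < 1 ∧ ∀ k : ℕ, (1 - ε) ^ (k / m) ≤ C * ρ ^ k := by
  have hε : 0 < 1 - ε := by linarith
  set ρ : ℝ := (1 - ε) ^ ((m : ℝ)⁻¹) with hρ
  have hρ0 : 0 < ρ := Real.rpow_pos_of_pos hε _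
  have hρ1 : ρ < 1 := Real.rpow_lt_one hε.le (by linarith) (by positivity)
  have hρm : ρ ^ m = 1 - ε := Real.rpow_inv_natCast_pow hε.le hm
  refine ⟨(1 - ε)⁻¹, ρ, by positivity, hρ0, hρ1, fun k => ?_⟩
  have hk : k ≤ m * (k / m + 1) := (Nat.lt_mul_div_succ k (Nat.pos_of_ne_zero hm)).le
  calc (1 - ε) ^ (k / m) = (1 - ε)⁻¹ * ρ ^ (m * (k / m + 1)) := by
        rw [pow_mul, hρm, pow_succ]
        field_simp
    _ ≤ (1 - ε)⁻¹ * ρ ^ k := by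
        gcongr ?_ * ?_
        exact pow_le_pow_of_le_one hρ0.le hρ1.le hk

variable {Ω : Type*} [MeasurableSpace Ω] {μ : Measure Ω} {N : Ω → ℕ∞} {C ρ : ℝ}

lemma ae_ne_top_of_geometric (hρ0 : 0 ≤ ρ) (hρ1 : ρ < 1)
    (hN : ∀ k : ℕ, μ {ω | (k : ℕ∞) < N ω} ≤ ENNReal.ofReal (C * ρ ^ k)) : ∀ᵐ ω ∂μ, N ω ≠ ⊤ := by
  rw [ae_iff]
  have hlim : Tendsto (fun k : ℕ => ENNReal.ofReal (C * ρ ^ k)) atTop (𝓝 0) := by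
    have := (tendsto_pow_atTop_nhds_zero_of_lt_one hρ0 hρ1).const_mul C
    simpa using ENNReal.tendsto_ofReal this
  refine le_antisymm (ge_of_tendsto' hlim fun k =>
    (measure_mono fun ω hω => ?_).trans (hN k)) bot_le
  simp only [mem_ofPred_eq, not_not] at hω
  simp [hω]

lemma lintegral_le_of_tail (hm : ∀ k : ℕ, MeasurableSet {ω | (k : ℕ∞) < N ω}) (f : ℕ → ℝ≥0∞)
    (hN : ∀ᵐ ω ∂μ, N ω ≠ ⊤) :
    ∫⁻ ω, f (N ω).toNat ∂μ ≤ f 0 * μ univ + ∑' k, f (k + 1) * μ {ω | (k : ℕ∞) < N ω} := by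
  calc _ ≤ ∫⁻ ω, (f 0 + ∑' k : ℕ, {ω | (k : ℕ∞) < N ω}.indicator (fun _ => f (k + 1)) ω) ∂μ := by
        refine lintegral_mono_ae ?_
        filter_upwards [hN] with ω hω
        obtain ⟨n, hn⟩ := ENat.ne_top_iff_exists.1 hω
        cases n with
        | zero => simp [← hn]
        | succ n =>
          have hmem : ω ∈ {ω | (n : ℕ∞) < N ω} := by
            rw [mem_ofPred_eq, ← hn]; exact_mod_cast Nat.lt_succ_self n
          rw [← hn, ENat.toNat_natCast]
          refine le_add_left ((ENNReal.le_tsum n).trans' ?_)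
          rw [indicator_of_mem hmem]
    _ = _ := by
        rw [lintegral_add_left measurable_const, lintegral_const,
          lintegral_tsum fun k => (measurable_const.indicator (hm k)).aemeasurable]
        congr 1
        exact tsum_congr fun k => lintegral_indicator_const (hm k) _

lemma measurable_toNat_of_tail (hm : ∀ k : ℕ, MeasurableSet {ω | (k : ℕ∞) < N ω}) :
    Measurable fun ω => (N ω).toNat := by
  have htop : MeasurableSet {ω | N ω = ⊤} := by
    have : {ω | N ω = ⊤} = ⋂ k : ℕ, {ω | (k : ℕ∞) < N ω} := by
      ext ω; simp [ENat.eq_top_iff_forall_gt]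
    rw [this]
    exact MeasurableSet.iInter hm
  refine measurable_of_Ioi fun k => ?_
  have : (fun ω => (N ω).toNat) ⁻¹' Ioi k = {ω | (k : ℕ∞) < N ω} \ {ω | N ω = ⊤} := by
    ext ω
    rcases eq_or_ne (N ω) ⊤ with h | h
    · simp [h]
    · obtain ⟨n, hn⟩ := ENat.ne_top_iff_exists.1 h
      simp [← hn]
  rw [this]
  exact (hm k).diff htop

/-- A random time with geometric tails integrates every function whose product with the tail is
summable. -/
lemma lintegral_lt_top_of_geometric [IsFiniteMeasure μ]
    (hm : ∀ k : ℕ, MeasurableSet {ω | (k : ℕ∞) < N ω}) (hρ0 : 0 ≤ ρ) (hρ1 : ρ < 1)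
    (hN : ∀ k : ℕ, μ {ω | (k : ℕ∞) < N ω} ≤ ENNReal.ofReal (C * ρ ^ k)) {f : ℕ → ℝ}
    (hf : ∀ k, 0 ≤ f k) (hs : Summable fun k => f (k + 1) * ρ ^ k) :
    ∫⁻ ω, ENNReal.ofReal (f (N ω).toNat) ∂μ < ⊤ := by
  refine (lintegral_le_of_tail hm (fun k => ENNReal.ofReal (f k))
    (ae_ne_top_of_geometric hρ0 hρ1 hN)).trans_lt ?_
  refine ENNReal.add_lt_top.2 ⟨ENNReal.mul_lt_top ENNReal.ofReal_lt_top (measure_lt_top _ _), ?_⟩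
  calc _ ≤ ∑' k : ℕ, ENNReal.ofReal (C * (f (k + 1) * ρ ^ k)) := by
        refine ENNReal.tsum_le_tsum fun k => ?_
        calc _ ≤ ENNReal.ofReal (f (k + 1)) * ENNReal.ofReal (C * ρ ^ k) := by
              gcongr; exact hN k
          _ = _ := by rw [← ENNReal.ofReal_mul (hf _)]; congr 1; ring
    _ < ⊤ := (hs.mul_left C).tsum_ofReal_lt_top

lemma lintegral_rpow_lt_top_of_geometric [IsFiniteMeasure μ]
    (hm : ∀ k : ℕ, MeasurableSet {ω | (k : ℕ∞) < N ω}) (hρ0 : 0 < ρ) (hρ1 : ρ < 1)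
    (hN : ∀ k : ℕ, μ {ω | (k : ℕ∞) < N ω} ≤ ENNReal.ofReal (C * ρ ^ k)) {α : ℝ} (hα : 0 < α) :
    ∫⁻ ω, (N ω : ℝ≥0∞) ^ α ∂μ < ⊤ := by
  have hs : Summable fun k : ℕ => ((k + 1 : ℕ) : ℝ) ^ α * ρ ^ k := by
    have h1 : Summable fun k : ℕ => ((k : ℕ) : ℝ) ^ ⌈α⌉₊ * ρ ^ k :=
      summable_pow_mul_geometric_of_norm_lt_one _ (by rwa [Real.norm_of_nonneg hρ0.le])
    have h2 := ((summable_nat_add_iff 1).2 h1).mul_left ρ⁻¹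
    refine h2.of_nonneg_of_le (fun k => by positivity) fun k => ?_
    have h3 : ((k + 1 : ℕ) : ℝ) ^ α ≤ ((k + 1 : ℕ) : ℝ) ^ ⌈α⌉₊ := by
      rw [← Real.rpow_natCast]
      exact Real.rpow_le_rpow_of_exponent_le (by simp) (Nat.le_ceil α)
    calc _ ≤ ((k + 1 : ℕ) : ℝ) ^ ⌈α⌉₊ * ρ ^ k := by gcongr
      _ = _ := by rw [pow_succ]; field_simp
  refine lt_of_eq_of_lt ?_ (lintegral_lt_top_of_geometric hm hρ0.le hρ1 hN
    (f := fun k => (k : ℝ) ^ α) (fun k => by positivity) hs)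
  refine lintegral_congr_ae ?_
  filter_upwards [ae_ne_top_of_geometric hρ0.le hρ1 hN] with ω hω
  obtain ⟨n, hn⟩ := ENat.ne_top_iff_exists.1 hω
  simp only [← hn, ENat.toNat_natCast, ENat.toENNReal_coe]
  rw [← ENNReal.ofReal_rpow_of_nonneg (by positivity) hα.le, ENNReal.ofReal_natCast]

lemma exists_integrable_exp_of_geometric [IsFiniteMeasure μ]
    (hm : ∀ k : ℕ, MeasurableSet {ω | (k : ℕ∞) < N ω}) (hρ0 : 0 < ρ) (hρ1 : ρ < 1)
    (hN : ∀ k : ℕ, μ {ω | (k : ℕ∞) < N ω} ≤ ENNReal.ofReal (C * ρ ^ k)) :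
    ∃ δ : ℝ, 0 < δ ∧ ∀ t : ℝ, |t| < δ →
      Integrable (fun ω => Real.exp (t * ((N ω).toNat : ℝ))) μ := by
  obtain ⟨r, hr0, hr1⟩ := exists_between hρ1
  have hr : 0 < r := hρ0.trans hr0
  refine ⟨Real.log (r / ρ), Real.log_pos ((one_lt_div hρ0).2 hr0), fun t ht => ?_⟩
  have hexp : Real.exp t ≤ r / ρ := by
    rw [← Real.exp_log (div_pos hr hρ0)]
    exact Real.exp_le_exp.2 ((le_abs_self t).trans ht.le)
  have hmeas : Measurable fun ω => Real.exp (t * ((N ω).toNat : ℝ)) :=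
    (measurable_from_nat (f := fun n => Real.exp (t * (n : ℝ)))).comp (measurable_toNat_of_tail hm)
  refine ⟨hmeas.aestronglyMeasurable, ?_⟩
  rw [hasFiniteIntegral_iff_ofReal (Eventually.of_forall fun ω => (Real.exp_pos _).le)]
  refine lintegral_lt_top_of_geometric hm hρ0.le hρ1 hN (f := fun k => Real.exp (t * k))
    (fun k => (Real.exp_pos _).le) ?_
  refine ((summable_geometric_of_lt_one hr.le hr1).mul_left (Real.exp t)).of_nonneg_of_le
    (fun k => by positivity) fun k => ?_
  calc Real.exp (t * (k + 1 : ℕ)) * ρ ^ k = Real.exp t * (Real.exp t * ρ) ^ k := by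
        rw [mul_pow, ← Real.exp_nat_mul, ← mul_assoc, ← Real.exp_add]
        congr 2
        push_cast
        ring
    _ ≤ Real.exp t * r ^ k := by
        gcongr
        calc Real.exp t * ρ ≤ r / ρ * ρ := by gcongr
          _ = r := div_mul_cancel₀ _ hρ0.ne'

end GeometricTail

/-! ### The TCP process is regenerative -/

namespace TcpModel

variable {Φ : Type u} (T : TcpModel Φ)

lemma admissible_regenStart : T.Admissible T.regenStart :=
  ⟨⟨⟨1, T.one_le_b, by simp [regenStart, regenState]⟩, rfl⟩, ⟨le_rfl, T.one_le_Wmax⟩,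
    ⟨le_rfl, T.one_le_Wmax⟩⟩

variable {T} in
lemma Admissible.isProbabilityMeasure_driveLaw {z : TcpStart Φ} (hz : T.Admissible z) :
    IsProbabilityMeasure (T.driveLaw z) := by
  have := T.isProbabilityMeasure_ageLaw fun h => (((T.admissible_iff z).1 hz).2 h).2
  rw [driveLaw_eq, residualLaw_eq]
  infer_instance

variable [Finite Φ]

lemma measurableSet_stateAdmissible : MeasurableSet {X : TcpState Φ | T.StateAdmissible X} := by
  refine measurableSet_setOfPred.2 (measurable_apply_countable (D := ChannelState Φ × ℕ × ℕ)
    (f := fun d (X : TcpState Φ) => T.StateAdmissible (d.1, X.2.1, d.2.1, d.2.2))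
    (g := fun X => (X.1, X.2.2.1, X.2.2.2)) ?_ (by fun_prop))
  rintro ⟨c, w, h⟩
  have hj (r : ℝ) : Measurable fun X : TcpState Φ => X.2.1 = r :=
    measurableSet_setOfPred.1 (measurableSet_eq_fun (by fun_prop) measurable_const)
  refine Measurable.and ?_ (measurable_const (a := w ∈ Icc 1 T.Wmax ∧ h ∈ Icc 1 T.Wmax))
  cases c with
  | on => exact hj T.R
  | off x =>
    refine Measurable.and ?_ (measurable_const (a := w = 1))
    exact Measurable.exists fun i => Measurable.and measurable_const (hj _)

lemma measurableSet_admissible : MeasurableSet {z : TcpStart Φ | T.Admissible z} := by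
  simp only [admissible_iff]
  exact (measurable_fst T.measurableSet_stateAdmissible).inter
    ((by fun_prop : Measurable fun z : TcpStart Φ => (z.1.1, z.2)) T.measurableSet_ageAdmissible)

variable {T} in
lemma Admissible.measurable_process {z : TcpStart Φ} (hz : T.Admissible z) :
    Measurable (T.process z) := by
  have h : T.process z = fun ω => T.tcpSeq z.1 (T.path z.1.1 ω) ω.lost :=
    funext fun ω => funext (process_eq ((T.admissible_iff z).1 hz).1 ω)
  rw [h]
  exact T.measurable_process_uncurry.comp measurable_prodMk_left

variable {T} in
lemma Admissible.map_process {z : TcpStart Φ} (hz : T.Admissible z) :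
    (T.driveLaw z).map (T.process z) = T.processKer z := by
  ext B hB
  rw [Measure.map_apply hz.measurable_process hB,
    T.processKer_eq_driveLaw ((T.admissible_iff z).1 hz).1 hB]
  rfl

variable {T} in
lemma Admissible.ae_stepKer {z : TcpStart Φ} (hz : T.Admissible z) :
    ∀ᵐ z' ∂T.stepKer z, T.Admissible z' := by
  obtain ⟨hX, hq⟩ := (T.admissible_iff z).1 hz
  have hS := T.measurableSet_admissible.compl
  rw [ae_iff, ← compl_ofPred, ← lintegral_indicator_one hS,
    T.lintegral_stepKer z (measurable_one.indicator hS)]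
  refine (lintegral_congr_ae (g := 0) ?_).trans lintegral_zero
  filter_upwards [hq.ae_transKer _] with q' hq'
  refine (lintegral_congr fun l => ?_).trans lintegral_zero
  have hadm : T.Admissible (T.step z.1 q'.1 (∃ i < z.1.2.2.1, l i = true), q'.2) := by
    refine (T.admissible_iff _).2 ⟨hX.step _ _, ?_⟩
    rw [step_fst]
    exact hq'
  exact indicator_of_notMem (s := {z | T.Admissible z}ᶜ) (fun hmem => hmem hadm) _

lemma processKer_congr_age (X : TcpState Φ) (hX : X.1 ≠ .on) (a a' : ℝ) :
    T.processKer (X, a) = T.processKer (X, a') := by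
  obtain ⟨_ | x, X⟩ := X
  · exact absurd rfl hX
  · ext B hB
    rw [T.processKer_apply _ hB, T.processKer_apply _ hB]
    rfl

/-- The pair of the TCP state and the age of the ON period codes the process, which regenerates at
`regenState`. -/
lemma isRegenerative :
    IsRegenerative T.stepKer T.processKer {z | T.Admissible z} Prod.fst T.regenStart where
  measurable_state := measurable_fst
  measurableSet := T.measurableSet_admissible
  start_mem := T.admissible_regenStart
  isProb z hz := by
    have := Admissible.isProbabilityMeasure_driveLaw hz
    rw [← Admissible.map_process hz]
    exact Measure.isProbabilityMeasure_map (Admissible.measurable_process hz).aemeasurable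
  ae_mem z hz := Admissible.ae_stepKer hz
  ae_start z hz := by
    rw [← Admissible.map_process hz]
    refine (ae_map_iff (Admissible.measurable_process hz).aemeasurable ?_).2
      (Eventually.of_forall fun ω => rfl)
    exact measurableSet_coord 0 (measurableSet_singleton z.1)
  markov z hz B hB := by
    simp only [add_comm 1]
    exact Admissible.processKer_shift hz hB
  regen z hz h := by
    obtain ⟨X, a⟩ := z
    obtain rfl : X = T.regenState := h
    exact T.processKer_congr_age _ (by simp [regenState]) _ _

/-! ### Lower bounds for channel paths -/

variable {T} {G : (ℝ≥0 → ChannelState Φ) → (ℕ × ℕ → Bool) → ℝ≥0∞}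

/-- Lower bound by the paths that stay in their initial state beyond time `t`. -/
lemma le_pathInt_of_stay (ρ : Measure ℝ) [IsProbabilityMeasure ρ] (hG : PathMeasurable G)
    (c : ChannelState Φ) (t : ℝ) (h : ∀ τ, t < τ → ∀ γ l, 1 ≤ G (glue c τ γ) l) :
    T.sojournLaw ρ c (Ioi t) ≤ T.pathInt ρ c G := by
  rw [T.pathInt_eq ρ hG c, ← setLIntegral_one]
  refine le_trans (setLIntegral_mono' measurableSet_Ioi fun τ hτ => ?_)
    (setLIntegral_le_lintegral _ _)
  calc (1 : ℝ≥0∞) = ∫⁻ _, ∫⁻ _, 1 ∂T.driveLawOf T.onLaw ∂(T.nextState c).toMeasure := by simp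
    _ ≤ _ := lintegral_mono fun c' => lintegral_mono fun ω => h τ hτ _ _

/-- Lower bound by the paths that jump to `c'` at a time in `S`. -/
lemma le_pathInt_of_jump (ρ : Measure ℝ) [IsProbabilityMeasure ρ] (hG : PathMeasurable G)
    (c c' : ChannelState Φ) {S : Set ℝ} (hS : MeasurableSet S) {η : ℝ → ℝ≥0∞}
    (h : ∀ τ ∈ S, η τ ≤ T.pathInt T.onLaw c' fun γ l => G (glue c τ γ) l) :
    ∫⁻ τ in S, η τ * T.nextState c c' ∂T.sojournLaw ρ c ≤ T.pathInt ρ c G := by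
  rw [T.pathInt_eq ρ hG c]
  refine le_trans (setLIntegral_mono' hS fun τ hτ => ?_) (setLIntegral_le_lintegral _ _)
  calc η τ * T.nextState c c' ≤ (T.pathInt T.onLaw c' fun γ l => G (glue c τ γ) l)
        * T.nextState c c' := by gcongr; exact h τ hτ
    _ = ∫⁻ y in {c'}, (T.pathInt T.onLaw y fun γ l => G (glue c τ γ) l)
        ∂(T.nextState c).toMeasure := by
        rw [lintegral_singleton, PMF.toMeasure_apply_singleton _ _ (measurableSet_singleton _)]
    _ ≤ _ := setLIntegral_le_lintegral _ _

lemma pathMeasurable_pair (t₁ t₂ : ℝ≥0) (g : ChannelState Φ × ChannelState Φ → ℝ≥0∞) :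
    PathMeasurable fun (γ : ℝ≥0 → ChannelState Φ) _ => g (γ t₁, γ t₂) := by
  intro A _ γ l hγ hl
  exact (measurable_of_countable g).comp ((hγ.comp (measurable_id.prodMk measurable_const)).prodMk
    (hγ.comp (measurable_id.prodMk measurable_const)))

lemma expMeasure_Ioc_pos {r : ℝ} (hr : 0 < r) {a b : ℝ} (ha : 0 ≤ a) (hab : a < b) :
    0 < expMeasure r (Ioc a b) := by
  have := isProbabilityMeasure_expMeasure hr
  rw [← Ioi_sdiff_Ioi, measure_sdiff (Ioi_subset_Ioi hab.le) measurableSet_Ioi.nullMeasurableSet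
    (measure_ne_top _ _), expMeasure_Ioi hr ha, expMeasure_Ioi hr (ha.trans hab.le),
    tsub_pos_iff_lt]
  refine (ENNReal.ofReal_lt_ofReal_iff (Real.exp_pos _)).2 (Real.exp_lt_exp.2 ?_)
  nlinarith

variable (T) in
/-- Probability that a channel that has just entered the state `c` is ON after the time `t`. -/
noncomputable def onProb (c : ChannelState Φ) (t : ℝ≥0) : ℝ≥0∞ :=
  T.pathInt T.onLaw c fun γ _ => ({.on} : Set (ChannelState Φ)).indicator 1 (γ t)

lemma pathMeasurable_on (t : ℝ≥0) : PathMeasurable fun (γ : ℝ≥0 → ChannelState Φ) _ =>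
    ({.on} : Set (ChannelState Φ)).indicator 1 (γ t) :=
  pathMeasurable_pair t t fun v => ({.on} : Set (ChannelState Φ)).indicator 1 v.1

variable (T) in
lemma measurable_onProb (c : ChannelState Φ) : Measurable (T.onProb c) := by
  have := (T.measurable_freshInt (pathMeasurable_on (Φ := Φ) 0)).comp
    (measurable_prodMk_left (x := c))
  simp only [Function.comp_def, freshInt, add_zero] at this
  exact this

/-- Whatever the OFF phase, the channel may be ON after any positive time. -/
lemma onProb_pos (hR1 : T.onLaw (Iic T.R) < 1) (x : Φ) {t : ℝ≥0} (ht : 0 < t) :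
    0 < T.onProb (.off x) t := by
  have hIoi : 0 < T.onLaw (Ioi T.R) := by
    rw [← compl_Iic, prob_compl_eq_one_sub measurableSet_Iic]
    exact tsub_pos_of_lt hR1
  obtain ⟨y, hxy, hy⟩ := T.exits x
  induction hxy using Relation.ReflTransGen.head_induction_on generalizing t with
  | refl =>
    have ht' : (0 : ℝ) < t := ht
    set a : ℝ := max 0 (t - T.R) with ha
    have hat : a < t := max_lt ht' (by linarith [T.R_pos])
    refine lt_of_lt_of_le ?_ (le_pathInt_of_jump T.onLaw (pathMeasurable_on t) (.off y) .on
      (S := Ioc a t) measurableSet_Ioc (η := fun _ => T.onLaw (Ioi T.R)) fun τ hτ => ?_)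
    · rw [setLIntegral_const]
      exact ENNReal.mul_pos (ENNReal.mul_pos hIoi.ne' hy).ne'
        (expMeasure_Ioc_pos (T.rate_pos y) (le_max_left _ _) hat).ne'
    · refine le_pathInt_of_stay T.onLaw ((pathMeasurable_on t).glue _ _) .on T.R fun τ' hτ' γ l => ?_
      have h1 : (t : ℝ) - τ < τ' := by
        have := (le_max_right 0 (t - T.R)).trans_lt hτ.1
        have : T.R < τ' := hτ'
        linarith
      rw [glue_of_le _ hτ.2, glue_of_lt]
      · simp
      · rw [Real.coe_toNNReal _ (by linarith [hτ.2])]; exact h1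
  | head huv _ ih =>
    rename_i u v _
    have ht' : (0 : ℝ) < t := ht
    refine lt_of_lt_of_le ?_ (le_pathInt_of_jump T.onLaw (pathMeasurable_on t) (.off u) (.off v)
      (S := Ioc 0 (t / 2)) measurableSet_Ioc
      (η := fun τ => T.onProb (.off v) (t - τ).toNNReal) fun τ hτ => ?_)
    · have hm : Measurable fun τ : ℝ => T.onProb (.off v) (t - τ).toNNReal *
          T.nextState (.off u) (.off v) :=
        ((T.measurable_onProb _).comp (by fun_prop)).mul_const _
      refine (setLIntegral_pos_iff hm).2 ?_
      refine (expMeasure_Ioc_pos (T.rate_pos u) le_rfl (half_pos ht')).trans_le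
        (measure_mono fun τ hτ => ⟨?_, hτ⟩)
      exact (ENNReal.mul_pos (ih (Real.toNNReal_pos.2 (by linarith [hτ.2]))).ne' huv).ne'
    · refine le_of_eq ?_
      have : τ ≤ t := by linarith [hτ.2]
      simp only [onProb, glue_of_le _ this]

end TcpModel

/-! ### Reaching the regeneration state -/

namespace TcpModel

variable {Φ : Type u} {T : TcpModel Φ}

/-- The bound on the hazard of `onLaw` carries over to the residual ON duration at any age. -/
lemma le_ageLaw_Icc {ε₀ : ℝ}
    (hNBU : ∀ s : ℝ, 0 ≤ s → 0 < T.onLaw (Set.Ici s) →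
      ENNReal.ofReal ε₀ ≤ (ProbabilityTheory.cond T.onLaw (Set.Ici s)) (Set.Iic (s + T.R)))
    {a : ℝ} (ha : 0 ≤ a) (ha' : 0 < T.onLaw (Ioi a)) :
    ENNReal.ofReal ε₀ ≤ T.ageLaw (.on, a) (Icc 0 T.R) := by
  have h1 (s : ℝ) (hs : 0 ≤ s) :
      ENNReal.ofReal ε₀ * T.onLaw (Ici s) ≤ T.onLaw (Icc s (s + T.R)) := by
    rcases eq_or_ne (T.onLaw (Ici s)) 0 with h0 | h0
    · simp [h0]
    · have := hNBU s hs (pos_iff_ne_zero.2 h0)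
      rw [cond_apply measurableSet_Ici, Ici_inter_Iic] at this
      calc _ ≤ (T.onLaw (Ici s))⁻¹ * T.onLaw (Icc s (s + T.R)) * T.onLaw (Ici s) := by gcongr
        _ = _ := by
          rw [mul_right_comm, ENNReal.inv_mul_cancel h0 (measure_ne_top _ _), one_mul]
  -- the hypothesis concerns `Ici s`; let `s` decrease to `a` to reach `Ioi a`
  set u : ℕ → ℝ := fun n => a + 1 / ((n : ℝ) + 1) with hu
  have hu0 (n : ℕ) : a < u n := by
    have : (0 : ℝ) < 1 / ((n : ℝ) + 1) := by positivity
    simp only [hu]; linarith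
  have hlim : Tendsto u atTop (𝓝 a) := by
    simpa [hu] using (tendsto_one_div_add_atTop_nhds_zero_nat (𝕜 := ℝ)).const_add a
  have huanti : Antitone u := fun m n hmn => by
    have : (m : ℝ) ≤ n := by exact_mod_cast hmn
    simp only [hu]
    gcongr
  have h2 : Tendsto (fun n => T.onLaw (Ici (u n))) atTop (𝓝 (T.onLaw (Ioi a))) := by
    have : Ioi a = ⋃ n, Ici (u n) := by
      ext y
      simp only [mem_Ioi, mem_iUnion, mem_Ici]
      refine ⟨fun hy => ?_, fun ⟨n, hn⟩ => (hu0 n).trans_le hn⟩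
      obtain ⟨n, hn⟩ := (hlim.eventually_lt_const hy).exists
      exact ⟨n, hn.le⟩
    rw [this]
    exact tendsto_measure_iUnion_atTop fun m n hmn => Ici_subset_Ici.2 (huanti hmn)
  have h3 : Tendsto (fun n => T.onLaw (Ioc a (u n + T.R))) atTop
      (𝓝 (T.onLaw (Ioc a (a + T.R)))) := by
    have : Ioc a (a + T.R) = ⋂ n, Ioc a (u n + T.R) := by
      ext y
      simp only [mem_Ioc, mem_iInter]
      refine ⟨fun hy n => ⟨hy.1, hy.2.trans (by linarith [hu0 n])⟩, fun hy => ⟨(hy 0).1, ?_⟩⟩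
      exact ge_of_tendsto' (hlim.add_const T.R) fun n => (hy n).2
    rw [this]
    exact tendsto_measure_iInter_atTop (fun n => measurableSet_Ioc.nullMeasurableSet)
      (fun m n hmn => Ioc_subset_Ioc_right (by linarith [huanti hmn])) ⟨0, measure_ne_top _ _⟩
  have h4 : ENNReal.ofReal ε₀ * T.onLaw (Ioi a) ≤ T.onLaw (Ioc a (a + T.R)) := by
    refine le_of_tendsto_of_tendsto' (ENNReal.Tendsto.const_mul h2 (Or.inr ENNReal.ofReal_ne_top))
      h3 fun n => (h1 (u n) (ha.trans (hu0 n).le)).trans (measure_mono fun y hy => ?_)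
    exact ⟨(hu0 n).trans_le hy.1, hy.2⟩
  rw [ageLaw_on, Measure.smul_apply, tailShift_apply _ _ measurableSet_Icc, smul_eq_mul]
  have hset : {y : ℝ | y - a ∈ Icc 0 T.R ∧ a < y} = Ioc a (a + T.R) := by
    ext y
    simp only [mem_ofPred_eq, mem_Icc, mem_Ioc]
    constructor
    · rintro ⟨⟨_, h⟩, h'⟩; exact ⟨h', by linarith⟩
    · rintro ⟨h', h⟩; exact ⟨⟨by linarith, by linarith⟩, h'⟩
  rw [hset]
  calc ENNReal.ofReal ε₀ = (T.onLaw (Ioi a))⁻¹ * (ENNReal.ofReal ε₀ * T.onLaw (Ioi a)) := by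
        rw [mul_comm, mul_assoc, ENNReal.mul_inv_cancel ha'.ne' (measure_ne_top _ _), mul_one]
    _ ≤ _ := by gcongr

lemma R_add_M_pos : 0 < T.R + T.M := add_pos T.R_pos T.M_pos

variable [Finite Φ]

/-- Lower bound for the probability of an event that the channel states at two times imply. -/
lemma le_processKer_of_path {z : TcpStart Φ} (t₁ t₂ : ℝ≥0) (c₁ c₂ : ChannelState Φ)
    {B : Set (ℕ → TcpState Φ)} (hB : MeasurableSet B)
    (h : ∀ γ l, γ t₁ = c₁ → γ t₂ = c₂ → T.tcpSeq z.1 γ l ∈ B) :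
    T.ageInt (z.1.1, z.2) (fun γ _ => ({(c₁, c₂)} : Set (ChannelState Φ × ChannelState Φ)).indicator 1
      (γ t₁, γ t₂)) ≤ T.processKer z B := by
  rw [T.processKer_apply z hB]
  refine lintegral_mono fun ω => ?_
  beta_reduce
  by_cases hω : T.path z.1.1 ω t₁ = c₁ ∧ T.path z.1.1 ω t₂ = c₂
  · rw [indicator_of_mem (h _ _ hω.1 hω.2)]
    exact indicator_le_self' (fun _ _ => zero_le) _
  · rw [indicator_of_notMem]
    · exact zero_le
    · simpa using hω

/-- An ON period that ends before the next attempt, followed by a long stay in `i₀`, leads to the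
regeneration state in two steps. -/
lemma exists_le_processKer_on {ε₀ : ℝ} (hε₀ : 0 < ε₀)
    (hNBU : ∀ s : ℝ, 0 ≤ s → 0 < T.onLaw (Set.Ici s) →
      ENNReal.ofReal ε₀ ≤ (ProbabilityTheory.cond T.onLaw (Set.Ici s)) (Set.Iic (s + T.R))) :
    ∃ ε : ℝ≥0∞, 0 < ε ∧ ∀ z, T.Admissible z → z.1.1 = .on →
      ε ≤ T.processKer z {x | x 1 ≠ T.regenState ∧ x 2 = T.regenState} := by
  refine ⟨expMeasure (T.rate T.i₀) (Ioi (T.R + T.M)) * ENNReal.ofReal ε₀, ?_, fun z hz hon => ?_⟩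
  · rw [expMeasure_Ioi (T.rate_pos _) R_add_M_pos.le]
    exact ENNReal.mul_pos (by simpa using Real.exp_pos _) (by simpa using hε₀)
  obtain ⟨⟨c, J, w, h⟩, a⟩ := z
  obtain rfl : c = .on := hon
  obtain ⟨hX, hq⟩ := (T.admissible_iff _).1 hz
  obtain rfl : J = T.R := hX.1
  obtain ⟨ha, ha'⟩ := hq rfl
  have := T.isProbabilityMeasure_ageLaw fun h => (hq h).2
  have hM := T.M_pos
  have hR := T.R_pos
  have hr : MeasurableSet ({T.regenState} : Set (TcpState Φ)) := measurableSet_singleton _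
  refine le_trans ?_ (le_processKer_of_path T.R.toNNReal (T.R.toNNReal + T.M.toNNReal) (.off T.i₀)
    (.off T.i₀) ((measurableSet_coord 1 hr.compl).inter (measurableSet_coord 2 hr)) ?_)
  · set G : (ℝ≥0 → ChannelState Φ) → (ℕ × ℕ → Bool) → ℝ≥0∞ := fun γ _ =>
      ({(.off T.i₀, .off T.i₀)} : Set (ChannelState Φ × ChannelState Φ)).indicator 1
        (γ T.R.toNNReal, γ (T.R.toNNReal + T.M.toNNReal)) with hG
    have hGm : PathMeasurable G := pathMeasurable_pair _ _ _
    refine le_trans ?_ (le_pathInt_of_jump (T.ageLaw (.on, a)) hGm .on (.off T.i₀) (S := Icc 0 T.R)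
      measurableSet_Icc (η := fun _ => expMeasure (T.rate T.i₀) (Ioi (T.R + T.M))) fun τ hτ => ?_)
    · rw [setLIntegral_const]
      simp only [nextState, PMF.pure_apply, if_true, mul_one]
      gcongr
      exact le_ageLaw_Icc hNBU ha ha'
    · refine le_pathInt_of_stay T.onLaw (hGm.glue _ _) (.off T.i₀) (T.R + T.M) fun τ' hτ' γ l => ?_
      have e1 : τ ≤ (T.R.toNNReal : ℝ) := by rw [Real.coe_toNNReal _ hR.le]; exact hτ.2
      have e2 : τ ≤ ((T.R.toNNReal + T.M.toNNReal : ℝ≥0) : ℝ) := by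
        rw [NNReal.coe_add, Real.coe_toNNReal _ hR.le, Real.coe_toNNReal _ hM.le]
        linarith [hτ.2]
      have hτ0 := hτ.1
      simp only [hG]
      rw [glue_of_le _ e1, glue_of_le _ e2, glue_of_lt, glue_of_lt]
      · simp
      · rw [Real.coe_toNNReal _ (by linarith), NNReal.coe_add, Real.coe_toNNReal _ hR.le,
          Real.coe_toNNReal _ hM.le]
        linarith
      · rw [Real.coe_toNNReal _ (by linarith), Real.coe_toNNReal _ hR.le]
        linarith
  · intro γ l h1 h2
    have hs1 : T.tcpSeq (.on, T.R, w, h) γ l 1 = (.off T.i₀, T.M, 1, half w) := by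
      simp [tcpSeq, tcpTimeState, h1, step]
    have hs2 : T.tcpSeq (.on, T.R, w, h) γ l 2 = T.regenState := by
      have hb : 2 * T.M ≤ T.Tmax := by
        rw [Tmax]
        gcongr
        simpa using pow_le_pow_right₀ (one_le_two (α := ℝ)) T.one_le_b
      simp [tcpSeq, tcpTimeState, h1, h2, step, regenState, hb, half]
    refine ⟨?_, hs2⟩
    change T.tcpSeq (.on, T.R, w, h) γ l 1 ≠ _
    rw [hs1]
    simp only [regenState, ne_eq, Prod.mk.injEq, not_and]
    intro _ h3
    linarith

/-- From every OFF state, the channel is ON at the next attempt with a probability bounded below: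
up to the age, which is irrelevant, only finitely many phases and timeouts matter. -/
lemma exists_le_processKer_off (hR1 : T.onLaw (Iic T.R) < 1) :
    ∃ ε : ℝ≥0∞, 0 < ε ∧ ∀ z, T.Admissible z → z.1.1 ≠ .on →
      ε ≤ T.processKer z {x | x 1 ∈ {X : TcpState Φ | X.1 = .on}} := by
  have hM := T.M_pos
  have : Nonempty Φ := ⟨T.i₀⟩
  obtain ⟨v, hv⟩ := Finite.exists_min fun v : Φ × Fin (T.b + 1) =>
    T.onProb (.off v.1) (2 ^ (v.2 : ℕ) * T.M).toNNReal
  refine ⟨T.onProb (.off v.1) (2 ^ (v.2 : ℕ) * T.M).toNNReal,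
    onProb_pos hR1 v.1 (Real.toNNReal_pos.2 (by positivity)), fun z hz hoff => ?_⟩
  obtain ⟨⟨c, J, w, h⟩, a⟩ := z
  obtain ⟨hX, hq⟩ := (T.admissible_iff _).1 hz
  cases c with
  | on => exact absurd rfl hoff
  | off x =>
    obtain ⟨i, hi, rfl⟩ := hX.1.1
    have := T.isProbabilityMeasure_ageLaw fun h => (hq h).2
    refine (hv (x, ⟨i, by omega⟩)).trans ?_
    have hmeas : MeasurableSet {X : TcpState Φ | X.1 = .on} :=
      measurable_fst (MeasurableSet.of_discrete (s := {c : ChannelState Φ | c = .on}))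
    refine le_trans ?_ (le_processKer_of_path (2 ^ i * T.M).toNNReal (2 ^ i * T.M).toNNReal .on .on
      (measurableSet_coord 1 hmeas) fun γ l h1 _ => ?_)
    · rw [onProb, T.pathInt_off_residual T.onLaw (T.ageLaw (.off x, a)) (pathMeasurable_on _)]
      have hpair (c : ChannelState Φ) :
          ({.on} : Set (ChannelState Φ)).indicator (1 : ChannelState Φ → ℝ≥0∞) c
          = ({(.on, .on)} : Set (ChannelState Φ × ChannelState Φ)).indicator 1 (c, c) := by
        by_cases h : c = .on <;> simp [h]
      exact le_of_eq (lintegral_congr fun ω => hpair _)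
    · simp only [mem_ofPred_eq, tcpSeq, tcpTimeState, step_fst, zero_add]
      exact h1

variable (T) in
/-- State after a timeout in the regeneration state, if the channel is then found in `i₀` again. -/
def afterRegen : TcpState Φ := (.off T.i₀, min (2 * (2 * T.M)) T.Tmax, 1, 1)

lemma processKer_afterRegen_pos :
    0 < T.processKer T.regenStart {x | x 1 ∈ ({T.afterRegen} : Set (TcpState Φ))} := by
  have hM := T.M_pos
  refine lt_of_lt_of_le ?_ (le_processKer_of_path (2 * T.M).toNNReal (2 * T.M).toNNReal (.off T.i₀)
    (.off T.i₀) (measurableSet_coord 1 (measurableSet_singleton _)) fun γ l h1 _ => ?_)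
  · have := T.isProbabilityMeasure_ageLaw (q := (T.regenStart.1.1, T.regenStart.2))
      fun h => by simp [regenStart, regenState] at h
    refine lt_of_lt_of_le ?_ (le_pathInt_of_stay _ (pathMeasurable_pair _ _ _) (.off T.i₀) (2 * T.M)
      fun τ hτ γ l => ?_)
    · rw [sojournLaw, expMeasure_Ioi (T.rate_pos _) (by positivity)]
      simpa using Real.exp_pos _
    · rw [glue_of_lt _ (by rw [Real.coe_toNNReal _ (by positivity)]; exact hτ)]
      simp
  · simp only [mem_ofPred_eq, mem_singleton_iff]
    simp [tcpSeq, tcpTimeState, regenStart, regenState, h1, step, afterRegen, half]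

end TcpModel

namespace TcpModel

variable {Φ : Type u} {T : TcpModel Φ}

/-! ### Return times of the regeneration state -/

lemma regenState_ne_of_on {X : TcpState Φ} (h : X.1 = .on) : X ≠ T.regenState := by
  rintro rfl
  simp [regenState] at h

variable [Finite Φ]

/-- Return in three steps: to ON, to OFF, and to the regeneration state. -/
lemma mul_le_processKer_three {ε₁ ε₂ : ℝ≥0∞}
    (h₁ : ∀ z, T.Admissible z → z.1.1 = .on →
      ε₁ ≤ T.processKer z {x | x 1 ≠ T.regenState ∧ x 2 = T.regenState})
    (h₂ : ∀ z, T.Admissible z → z.1.1 ≠ .on →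
      ε₂ ≤ T.processKer z {x | x 1 ∈ {X : TcpState Φ | X.1 = .on}})
    {z : TcpStart Φ} (hz : T.Admissible z) (hoff : z.1.1 ≠ .on) :
    ε₁ * ε₂ ≤ T.processKer z {x | (x 1).1 = .on ∧ x 2 ≠ T.regenState ∧ x 3 = T.regenState} := by
  have hr : MeasurableSet ({T.regenState} : Set (TcpState Φ)) := measurableSet_singleton _
  have hon : MeasurableSet {X : TcpState Φ | X.1 = .on} :=
    measurable_fst (MeasurableSet.of_discrete (s := {c : ChannelState Φ | c = .on}))
  calc ε₁ * ε₂ ≤ ε₁ * T.processKer z {x | x 1 ∈ {X : TcpState Φ | X.1 = .on}} := by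
        gcongr; exact h₂ z hz hoff
    _ ≤ _ := T.isRegenerative.mul_le_measure_tail hz 1 hon
        ((measurableSet_coord 1 hr.compl).inter (measurableSet_coord 2 hr))
        fun z' hz' h => h₁ z' hz' h
    _ = _ := rfl

/-- The regeneration state is hit after six steps with a probability bounded below; starting from
it, cycles of length three and of length one or four have positive probability. If `b = 1`, the
timeout after the one in the regeneration state is not doubled, which allows cycles of length one;
otherwise the first timeout leads elsewhere, and three more steps back. -/
lemma exists_minorization {ε₀ : ℝ} (hε₀ : 0 < ε₀)
    (hNBU : ∀ s : ℝ, 0 ≤ s → 0 < T.onLaw (Set.Ici s) →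
      ENNReal.ofReal ε₀ ≤ (ProbabilityTheory.cond T.onLaw (Set.Ici s)) (Set.Iic (s + T.R)))
    (hR1 : T.onLaw (Iic T.R) < 1) :
    (∃ ε : ℝ≥0∞, 0 < ε ∧ ∀ z, T.Admissible z → ε ≤ T.processKer z {x | x 6 = T.regenState}) ∧
    0 < T.processKer T.regenStart {x | returnTime T.regenState x = 3} ∧
    (0 < T.processKer T.regenStart {x | returnTime T.regenState x = 1} ∨
      0 < T.processKer T.regenStart {x | returnTime T.regenState x = 4}) := by
  obtain ⟨ε₁, hε₁, h₁⟩ := exists_le_processKer_on hε₀ hNBU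
  obtain ⟨ε₂, hε₂, h₂⟩ := exists_le_processKer_off hR1
  have hreg := T.isRegenerative
  have hstart := T.admissible_regenStart
  have hr : MeasurableSet ({T.regenState} : Set (TcpState Φ)) := measurableSet_singleton _
  have hon : MeasurableSet {X : TcpState Φ | X.1 = .on} :=
    measurable_fst (MeasurableSet.of_discrete (s := {c : ChannelState Φ | c = .on}))
  have hm3 : MeasurableSet {x : ℕ → TcpState Φ |
      (x 1).1 = .on ∧ x 2 ≠ T.regenState ∧ x 3 = T.regenState} :=
    (measurableSet_coord 1 hon).inter
      ((measurableSet_coord 2 hr.compl).inter (measurableSet_coord 3 hr))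
  set ε₃ := ε₁ * ε₂ with hε₃
  have hε₃0 : 0 < ε₃ := ENNReal.mul_pos hε₁.ne' hε₂.ne'
  have h₃ {z : TcpStart Φ} (hz : T.Admissible z) (hoff : z.1.1 ≠ .on) :=
    mul_le_processKer_three h₁ h₂ hz hoff
  have hoff₀ : T.regenStart.1.1 ≠ .on := by simp [regenStart, regenState]
  set ε₅ := T.processKer T.regenStart {x | x 1 ∈ ({T.afterRegen} : Set (TcpState Φ))} with hε₅
  have hε₅0 : 0 < ε₅ := processKer_afterRegen_pos
  have h₄ : ε₃ * ε₅ ≤ T.processKer T.regenStart {x | x 1 ∈ ({T.afterRegen} : Set (TcpState Φ)) ∧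
      (fun n => x (1 + n)) ∈ {x : ℕ → TcpState Φ |
        (x 1).1 = .on ∧ x 2 ≠ T.regenState ∧ x 3 = T.regenState}} :=
    hreg.mul_le_measure_tail hstart 1 (measurableSet_singleton _) hm3 fun z hz h =>
      h₃ hz (by rw [show z.1 = T.afterRegen from h]; simp [afterRegen])
  have hprob {z : TcpStart Φ} (hz : T.Admissible z) : IsProbabilityMeasure (T.processKer z) :=
    hreg.isProb z hz
  have := hprob hstart
  have hε₅1 : ε₅ ≤ 1 := prob_le_one
  have hε₃1 : ε₃ ≤ 1 := (h₃ hstart hoff₀).trans prob_le_one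
  refine ⟨⟨ε₃ * ε₅ * min ε₁ ε₃, ?_, fun z hz => ?_⟩, ?_, ?_⟩
  · exact ENNReal.mul_pos (ENNReal.mul_pos hε₃0.ne' hε₅0.ne').ne'
      (lt_min hε₁ hε₃0).ne'
  · by_cases h : z.1.1 = .on
    · calc ε₃ * ε₅ * min ε₁ ε₃
            ≤ ε₃ * ε₅ * T.processKer z {x | x 2 ∈ ({T.regenState} : Set (TcpState Φ))} := by
            gcongr
            exact ((min_le_left _ _).trans (h₁ z hz h)).trans (measure_mono fun x hx => hx.2)
        _ ≤ _ := hreg.mul_le_measure_tail hz 2 hr (measurableSet_coord 4 hr) fun z' hz' h' => by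
            rw [hreg.regen z' hz' h']
            exact h₄.trans (measure_mono fun x hx => hx.2.2.2)
        _ ≤ _ := measure_mono fun x hx => hx.2
    · calc ε₃ * ε₅ * min ε₁ ε₃ ≤ ε₃ * 1 *
              T.processKer z {x | x 3 ∈ ({T.regenState} : Set (TcpState Φ))} := by
            gcongr
            exact ((min_le_right _ _).trans (h₃ hz h)).trans (measure_mono fun x hx => hx.2.2)
        _ = ε₃ * T.processKer z {x | x 3 ∈ ({T.regenState} : Set (TcpState Φ))} := by rw [mul_one]
        _ ≤ _ := hreg.mul_le_measure_tail hz 3 hr (measurableSet_coord 3 hr) fun z' hz' h' => by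
            rw [hreg.regen z' hz' h']
            exact (h₃ hstart hoff₀).trans (measure_mono fun x hx => hx.2.2)
        _ ≤ _ := measure_mono fun x hx => hx.2
  · refine hε₃0.trans_le ((h₃ hstart hoff₀).trans (measure_mono fun x hx => ?_))
    refine returnTime_eq_coe (k := 2) hx.2.2 fun j hj1 hj2 => ?_
    obtain rfl | rfl : j = 1 ∨ j = 2 := by omega
    · exact regenState_ne_of_on hx.1
    · exact hx.2.1
  · by_cases h : T.afterRegen = T.regenState
    · refine Or.inl (hε₅0.trans_le (measure_mono fun x hx => ?_))
      exact returnTime_eq_coe (k := 0) (hx.trans h) fun j hj1 hj2 => by omega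
    · refine Or.inr ((ENNReal.mul_pos hε₃0.ne' hε₅0.ne').trans_le
        (h₄.trans (measure_mono fun x hx => ?_)))
      refine returnTime_eq_coe (k := 3) hx.2.2.2 fun j hj1 hj2 => ?_
      obtain rfl | rfl | rfl : j = 1 ∨ j = 2 ∨ j = 3 := by omega
      · exact fun h' => h (hx.1.symm.trans h')
      · exact regenState_ne_of_on hx.2.1
      · exact hx.2.2.1

end TcpModel

/-! ### Stationarity and exponential convergence -/

theorem proposition2 {Φ : Type*} [Finite Φ] (T : TcpModel Φ)
    (ε₀ : ℝ) (hε₀ : 0 < ε₀)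
    (hNBU : ∀ s : ℝ, 0 ≤ s → 0 < T.onLaw (Set.Ici s) →
      ENNReal.ofReal ε₀ ≤ (ProbabilityTheory.cond T.onLaw (Set.Ici s)) (Set.Iic (s + T.R)))
    (hR0 : 0 < T.onLaw (Set.Iic T.R)) (hR1 : T.onLaw (Set.Iic T.R) < 1) :
    -- the cycle length is almost surely finite and has finite moments of all orders
    (∀ᵐ ω ∂(T.driveLaw T.regenStart), T.cycleLength ω ≠ ⊤) ∧
    (∀ α : ℝ, 0 < α →
      ∫⁻ ω, ((T.cycleLength ω : ℕ∞) : ℝ≥0∞) ^ α ∂(T.driveLaw T.regenStart) < ⊤) ∧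
    -- its moment generating function is finite in a neighbourhood of `0`
    (∃ δ : ℝ, 0 < δ ∧ ∀ t : ℝ, |t| < δ →
      Integrable (fun ω => Real.exp (t * ((T.cycleLength ω).toNat : ℝ)))
        (T.driveLaw T.regenStart)) ∧
    -- it is aperiodic
    (∀ d : ℕ, (∀ n : ℕ, 0 < T.driveLaw T.regenStart {ω | T.cycleLength ω = n} → d ∣ n) → d = 1) ∧
    ∃ μ : Measure (TcpState Φ), IsProbabilityMeasure μ ∧
      -- the regenerative formula
      (∀ A, MeasurableSet A →
        μ A = (∫⁻ ω, T.cycleVisits A ω ∂(T.driveLaw T.regenStart)) /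
          ∫⁻ ω, ((T.cycleLength ω : ℕ∞) : ℝ≥0∞) ∂(T.driveLaw T.regenStart)) ∧
      -- `μ` is the unique stationary distribution
      T.IsStationaryDistribution μ ∧
      (∀ μ' : Measure (TcpState Φ), T.IsStationaryDistribution μ' → μ' = μ) ∧
      -- exponential convergence in total variation from every initial law
      ∃ C ρ : ℝ, 0 < ρ ∧ ρ < 1 ∧ ∀ ν : Measure (TcpStart Φ), T.IsInitialLaw ν →
        ∀ (k : ℕ) (A : Set (TcpState Φ)), MeasurableSet A →
          |(T.stateProb ν k A).toReal - (μ A).toReal| ≤ C * ρ ^ k := by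
  obtain ⟨⟨ε, hε0, hε⟩, h3, h14⟩ := T.exists_minorization hε₀ hNBU hR1
  have hreg := T.isRegenerative
  have hstart := T.admissible_regenStart
  have hmp := hstart.measurable_process
  have hmap := hstart.map_process
  have := hstart.isProbabilityMeasure_driveLaw
  have hpr {z : TcpStart Φ} (hz : T.Admissible z) : IsProbabilityMeasure (T.processKer z) :=
    hreg.isProb z hz
  have hprob := hpr hstart
  have hlen (ω : Drive Φ) : T.cycleLength ω = returnTime T.regenState (T.process T.regenStart ω) :=
    rfl
  have hmlt (k : ℕ) : MeasurableSet {ω : Drive Φ | (k : ℕ∞) < T.cycleLength ω} :=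
    hmp (measurableSet_lt_returnTime T.regenState k)
  -- a real lower bound in `(0, 1)` for the probability of regeneration after six steps
  set e : ℝ := min ε.toReal 2⁻¹ with he
  have hε1 : ε ≠ ⊤ := ((hε _ hstart).trans_lt (measure_lt_top _ _)).ne
  have he0 : 0 < e := lt_min (ENNReal.toReal_pos hε0.ne' hε1) (by norm_num)
  have he1 : e < 1 := (min_le_right _ _).trans_lt (by norm_num)
  have hereal : ∀ z ∈ {z | T.Admissible z},
      e ≤ (T.processKer z).real {x | x 6 = T.regenStart.1} := fun z hz => by
    have := hpr hz
    exact (min_le_left _ _).trans (ENNReal.toReal_mono (measure_ne_top _ _) (hε z hz))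
  have heenn : ∀ z ∈ {z | T.Admissible z},
      ENNReal.ofReal e ≤ T.processKer z {x | x 6 = T.regenStart.1} := fun z hz => by
    have := hpr hz
    exact (ENNReal.ofReal_le_iff_le_toReal (measure_ne_top _ _)).2 (hereal z hz)
  obtain ⟨C, ρ, hC, hρ0, hρ1, hCρ⟩ := pow_div_le_geometric he0 he1 (m := 6) (by norm_num)
  have htail (k : ℕ) : T.driveLaw T.regenStart {ω | (k : ℕ∞) < T.cycleLength ω}
      ≤ ENNReal.ofReal (C * ρ ^ k) := by
    calc _ = T.processKer T.regenStart {x | (k : ℕ∞) < returnTime T.regenState x} := by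
          rw [← hmap, Measure.map_apply hmp (measurableSet_lt_returnTime _ _)]
          rfl
      _ ≤ T.processKer T.regenStart {x | ∀ j < k / 6, x (6 * (j + 1)) ≠ T.regenStart.1} :=
          measure_mono fun x hx j hj => lt_returnTime_iff.1 hx _ (by omega) (by omega)
      _ ≤ (1 - ENNReal.ofReal e) ^ (k / 6) := hreg.measure_avoid_le heenn _ hstart
      _ = ENNReal.ofReal ((1 - e) ^ (k / 6)) := by
          rw [← ENNReal.ofReal_one, ← ENNReal.ofReal_sub _ he0.le,
            ENNReal.ofReal_pow (by linarith)]
      _ ≤ _ := ENNReal.ofReal_le_ofReal (hCρ k)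
  have hfin := ae_ne_top_of_geometric hρ0.le hρ1 htail
  have hNtop : ∀ᵐ x ∂T.processKer T.regenStart, returnTime T.regenStart.1 x ≠ ⊤ := by
    have hS : MeasurableSet {x : ℕ → TcpState Φ | returnTime T.regenStart.1 x ≠ ⊤} := by
      have : {x : ℕ → TcpState Φ | returnTime T.regenStart.1 x ≠ ⊤}
          = (⋂ k : ℕ, {x | (k : ℕ∞) < returnTime T.regenStart.1 x})ᶜ := by
        ext x; simp [ENat.eq_top_iff_forall_gt]
      rw [this]
      exact (MeasurableSet.iInter fun k => measurableSet_lt_returnTime _ k).compl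
    rw [← hmap]
    exact (ae_map_iff hmp.aemeasurable hS).2 hfin
  -- transfer of expectations between the two descriptions of a cycle
  have hvis {A : Set (TcpState Φ)} (hA : MeasurableSet A) :
      ∫⁻ ω, T.cycleVisits A ω ∂T.driveLaw T.regenStart
        = IsRegenerative.occupation T.stepKer Prod.fst T.regenStart (Prod.fst ⁻¹' A) := by
    rw [hreg.occupation_apply hA, ← hmap, lintegral_map (measurable_visits _ hA) hmp]
    rfl
  have hlenint : ∫⁻ ω, ((T.cycleLength ω : ℕ∞) : ℝ≥0∞) ∂T.driveLaw T.regenStart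
      = IsRegenerative.occupation T.stepKer Prod.fst T.regenStart univ := by
    rw [← preimage_univ (f := Prod.fst), ← hvis MeasurableSet.univ]
    exact lintegral_congr fun ω => (visits_univ _ _).symm
  set occ := IsRegenerative.occupation T.stepKer Prod.fst T.regenStart with hocc
  have hoccfin : occ univ ≠ ⊤ := by
    rw [← hlenint]
    have := lintegral_rpow_lt_top_of_geometric hmlt hρ0 hρ1 htail one_pos
    simpa only [ENNReal.rpow_one] using this.ne
  have hocc0 : occ univ ≠ 0 := by
    have h1 : IsRegenerative.tabooLaw T.stepKer Prod.fst T.regenStart 0 univ ≤ occ univ :=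
      Measure.le_sum _ 0 univ
    rw [IsRegenerative.tabooLaw, measure_univ] at h1
    exact (one_pos.trans_le h1).ne'
  -- the normalised occupation measure is a stationary initial law
  set ν : Measure (TcpStart Φ) := (occ univ)⁻¹ • occ with hν
  have hνprob : IsProbabilityMeasure ν :=
    ⟨by rw [hν, Measure.smul_apply, smul_eq_mul, ENNReal.inv_mul_cancel hocc0 hoccfin]⟩
  have hνadm : ∀ᵐ z ∂ν, T.Admissible z := Measure.ae_smul_measure hreg.ae_mem_occupation _
  have hνinit : T.IsInitialLaw ν := ⟨hνprob, hνadm⟩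
  have hshift {κ : Measure (TcpStart Φ)} (hκ : T.IsInitialLaw κ) (k : ℕ)
      {B : Set (ℕ → TcpState Φ)} (hB : MeasurableSet B) :
      T.shiftProb κ k B = ∫⁻ z, T.processKer z {x | (fun n => x (k + n)) ∈ B} ∂κ := by
    refine lintegral_congr_ae ?_
    filter_upwards [hκ.2] with z hz
    exact (T.processKer_eq_driveLaw ((T.admissible_iff z).1 hz).1 (measurableSet_tail k hB)).symm
  have hstate {κ : Measure (TcpStart Φ)} (hκ : T.IsInitialLaw κ) (k : ℕ)
      {A : Set (TcpState Φ)} (hA : MeasurableSet A) :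
      T.stateProb κ k A = ∫⁻ z, T.processKer z {x | x k ∈ A} ∂κ :=
    hshift hκ k (measurableSet_coord 0 hA)
  have hsame {κ : Measure (TcpStart Φ)} (k : ℕ) (A : Set (TcpState Φ)) :
      T.stateProb κ k A = T.shiftProb κ k {x | x 0 ∈ A} := rfl
  have hνstat (k : ℕ) {B : Set (ℕ → TcpState Φ)} (hB : MeasurableSet B) :
      T.shiftProb ν k B = T.shiftProb ν 0 B := by
    rw [hshift hνinit k hB, hshift hνinit 0 hB, hν, lintegral_smul_measure, lintegral_smul_measure,
      hreg.occupation_stationary_iter hNtop k hB, hreg.occupation_stationary_iter hNtop 0 hB]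
  have hν0 {A : Set (TcpState Φ)} (hA : MeasurableSet A) :
      T.stateProb ν 0 A = ν.map Prod.fst A := by
    rw [hstate hνinit 0 hA, Measure.map_apply measurable_fst hA,
      ← lintegral_indicator_one (measurable_fst hA)]
    refine lintegral_congr_ae ?_
    filter_upwards [hνadm] with z hz
    have := hpr hz
    have h1 := hreg.start_inter hz A univ
    simp only [mem_univ, and_true] at h1
    rw [h1]
    simp [indicator]
  have htv {κ κ' : Measure (TcpStart Φ)} (hκ : T.IsInitialLaw κ) (hκ' : T.IsInitialLaw κ')
      (k : ℕ) {A : Set (TcpState Φ)} (hA : MeasurableSet A) :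
      |(T.stateProb κ k A).toReal - (T.stateProb κ' k A).toReal| ≤ C * ρ ^ k := by
    have := hκ.1
    have := hκ'.1
    rw [hstate hκ k hA, hstate hκ' k hA]
    exact (hreg.abs_sub_le hereal hκ.2 hκ'.2 hA k).trans (hCρ k)
  -- along a stationary initial law the law of the state does not change
  have hνk (k : ℕ) {A : Set (TcpState Φ)} (hA : MeasurableSet A) :
      T.stateProb ν k A = ν.map Prod.fst A := by
    rw [hsame, hνstat k (measurableSet_coord 0 hA), ← hsame, hν0 hA]
  have hμprob : IsProbabilityMeasure (ν.map Prod.fst) :=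
    Measure.isProbabilityMeasure_map measurable_fst.aemeasurable
  refine ⟨hfin, fun α hα => lintegral_rpow_lt_top_of_geometric hmlt hρ0 hρ1 htail hα,
    exists_integrable_exp_of_geometric hmlt hρ0 hρ1 htail, fun d hd => ?_, ν.map Prod.fst, hμprob,
    fun A hA => ?_, ⟨ν, hνinit, fun k B hB => hνstat k hB, fun A hA => hν0 hA⟩, ?_,
    C, ρ, hρ0, hρ1, fun κ hκ k A hA => ?_⟩
  · have hdvd (n : ℕ) (hn : 0 < T.processKer T.regenStart {x | returnTime T.regenState x = n}) :
        d ∣ n := by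
      refine hd n (hn.trans_le ?_)
      rw [← hmap, Measure.map_apply hmp (measurableSet_returnTime_eq _ n)]
      rfl
    have h3' := hdvd 3 h3
    rcases h14 with h1 | h4
    · exact Nat.dvd_one.1 (hdvd 1 h1)
    · have h4' := hdvd 4 h4
      exact Nat.dvd_one.1 ((Nat.dvd_sub h4' h3'))
  · rw [hvis hA, hlenint, Measure.map_apply measurable_fst hA, hν, Measure.smul_apply, smul_eq_mul,
      div_eq_mul_inv, mul_comm]
  · rintro μ' ⟨κ, hκ, hκstat, hκ0⟩
    ext A hA
    have hκk (k : ℕ) : T.stateProb κ k A = μ' A := by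
      rw [hsame, hκstat k _ (measurableSet_coord 0 hA), ← hsame, hκ0 A hA]
    have hlim : Tendsto (fun k : ℕ => C * ρ ^ k) atTop (𝓝 0) := by
      simpa using (tendsto_pow_atTop_nhds_zero_of_lt_one hρ0.le hρ1).const_mul C
    have hle : |(μ' A).toReal - (ν.map Prod.fst A).toReal| ≤ 0 :=
      ge_of_tendsto' hlim fun k => by
        rw [← hκk k, ← hνk k hA]
        exact htv hκ hνinit k hA
    have hμ'top : μ' A ≠ ⊤ := by
      have := hκ.1
      rw [← hκk 0, hstate hκ 0 hA]
      refine ((lintegral_mono_ae (g := fun _ => 1) ?_).trans_lt (by simp)).ne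
      filter_upwards [hκ.2] with z hz
      have := hpr hz
      exact prob_le_one
    exact (ENNReal.toReal_eq_toReal_iff' hμ'top (measure_ne_top _ _)).1
      (sub_eq_zero.1 (abs_nonpos_iff.1 hle))
  · rw [← hνk k hA]
    exact htv hκ hνinit k hA
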